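/- Let $d\ge 1$. For $\sigma\in\{+,-\}^d$ let $P_\sigma$ be the orthogonal projection of $L^2(\mathbb R^d)$ onto the functions whose Fourier transform is supported in the orthant $\{\xi:\ \sigma(j)\xi_j\ge 0 \text{ for all } j\}$; write $P_\oplus=P_{(+,\dots,+)}$, let $H^2(\mathbb C_+^d)=P_\oplus L^2(\mathbb R^d)$, and let $H_j=P_{+,j}-P_{-,j}$ be the Hilbert transform in the $j$-th coordinate, where $P_{\pm,j}$ is the projection onto the frequencies with $\pm\xi_j\ge0$. Let $H^1(\mathbb C_+^d)$ be the space of $f\in L^1(\mathbb R^d)$ with $\widehat f(\xi)=0$ whenever some $\xi_j<0$, with the $L^1$ norm, and let $\operatorname{Re}H^1(\mathbb C_+^d)$ carry the norm $\sum_\sigma\|P_\sigma f\|_{L^1}$. The product space $\mathrm{BMO}(\mathbb R^d)$ is the dual of $\operatorname{Re}H^1(\mathbb C_+^d)$ and the analytic space $\mathrm{BMO}(\mathbb C_+^d)$ is the dual of $H^1(\mathbb C_+^d)$, both under the pairing $\langle b,f\rangle=\int b\,\overline f$, with the dual norms (the suprema run over those $f$ in $L^2$ and in the unit ball of the Hardy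 space for which the pairing integrals, with $P_\sigma f$ for every $\sigma$, converge absolutely); $P_\oplus b$ is given by $\langle P_\oplus b,f\rangle=\langle b,P_\oplus f\rangle$. A symbol is a measurable $b:\mathbb R^d\to\mathbb C$ with $\int |b(x)|^2\prod_j(1+x_j^2)^{-1}\,dx<\infty$; $M_b$ is multiplication by $b$. The Hankel operator is $\mathsf H_b\varphi=P_\oplus M_b\overline\varphi$ for $\varphi\in H^2(\mathbb C_+^d)$, and $C_b=[\cdots[[M_b,H_1],H_2],\dots,H_d]$; both are taken on their natural domains in $L^2$ (where every product with $b$ that occurs is in $L^2$), and all norms may be $+\infty$. For $f\in H^1(\mathbb C_+^d)$ let $$\|f\|_{H^2\widehat\otimes H^2}=\inf\Bigl\{\sum_j\|\varphi_j\|_2\|\psi_j\|_2:\ f=\sum_j\varphi_j\psi_j,\ \varphi_j,\psi_j\in H^2(\mathbb C_+^d)\Bigr\}.$$ Write $\simeq$ when each side is at most a constant times the other, with a constant independent of the function concerned. Then the following statements are equivalent to each other: 1. $\|\mathsf H_b\|\simeq\|P_\oplus b\|_{\mathrm{BMO}(\mathbb R^d)}$ for all symbols $b$; 2. $\|C_b\|_{L^2\to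 L^2}\simeq\|b\|_{\mathrm{BMO}(\mathbb R^d)}$ for all symbols $b$; - (2a) the same for all real-valued symbols $b$; - (2b) $\|C_b\|_{L^2\to L^2}\simeq\|b\|_{\mathrm{BMO}(\mathbb C_+^d)}$ for all analytic symbols $b$ (those with $P_\oplus b=b$ as functionals on $\operatorname{Re}H^1(\mathbb C_+^d)$); 3. $\|f\|_{H^1(\mathbb C_+^d)}\simeq\|f\|_{H^2\widehat\otimes H^2}$ for all $f\in H^1(\mathbb C_+^d)$ (weak factorization). -/

import Mathlib

open MeasureTheory
open scoped FourierTransform ENNReal NNReal ComplexConjugate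

noncomputable section

namespace Polydisk

/-- `ℝ^d`, viewed as the distinguished boundary of `ℂ_+^d`. -/
abbrev Rd (d : ℕ) : Type := EuclideanSpace ℝ (Fin d)

/-- `L²(ℝ^d)`, complex valued. -/
abbrev L2 (d : ℕ) : Type := Lp ℂ 2 (volume : Measure (Rd d))

variable {d : ℕ}

/-! ### Fourier projections, Hardy spaces, Hilbert transforms -/

/-- The Fourier transform (Plancherel) on `L²(ℝ^d)`. -/
abbrev fourierL2 : L2 d ≃ₗᵢ[ℂ] L2 d := Lp.fourierTransformₗᵢ (Rd d) ℂ

/-- Multiplication by the indicator function of `S`. -/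
def restrictTo (S : Set (Rd d)) (hS : MeasurableSet S) (f : L2 d) : L2 d :=
  ((Lp.memLp f).indicator hS).toLp (S.indicator f)

/-- The orthogonal projection of `L²(ℝ^d)` onto the functions whose Fourier transform lives on the
measurable set `S`: the Fourier multiplier with symbol `1_S`. -/
def freqProj (S : Set (Rd d)) (hS : MeasurableSet S) (f : L2 d) : L2 d :=
  fourierL2.symm (restrictTo S hS (fourierL2 f))

/-- The frequencies whose `j`-th coordinate has sign `s`. -/
def halfSpace (s : ℤˣ) (j : Fin d) : Set (Rd d) := {ξ | 0 < ((s : ℤ) : ℝ) * ξ j}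

/-- The frequencies whose coordinates have the signs prescribed by `σ`. -/
def orthant (σ : Fin d → ℤˣ) : Set (Rd d) := ⋂ j, halfSpace (σ j) j

lemma measurableSet_halfSpace (s : ℤˣ) (j : Fin d) : MeasurableSet (halfSpace s j) :=
  measurableSet_lt measurable_const (by fun_prop)

lemma measurableSet_orthant (σ : Fin d → ℤˣ) : MeasurableSet (orthant σ) :=
  MeasurableSet.iInter fun j => measurableSet_halfSpace (σ j) j

/-- `P_{±,j}`: the one dimensional Fourier projection in the `j`-th coordinate. -/
def projCoord (s : ℤˣ) (j : Fin d) : L2 d → L2 d :=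
  freqProj (halfSpace s j) (measurableSet_halfSpace s j)

/-- `P_σ = ⨂_j P_{σ(j),j}`. -/
def proj (σ : Fin d → ℤˣ) : L2 d → L2 d :=
  freqProj (orthant σ) (measurableSet_orthant σ)

/-- `P_⊕ = P_σ` with all the signs `σ(j)` equal to `+`. -/
def projPlus : L2 d → L2 d := proj fun _ => 1

/-- The Hardy space `H²(ℂ_+^d)`: the range of `P_⊕`. -/
def hardyTwo (d : ℕ) : Set (L2 d) := Set.range projPlus

/-- The Hilbert transform in the `j`-th coordinate, `H_j = -P_{-,j} + P_{+,j}`. -/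
def hilbert (j : Fin d) (f : L2 d) : L2 d := -projCoord (-1) j f + projCoord 1 j f

/-- Membership in the analytic Hardy space `H¹(ℂ_+^d)`, in terms of the boundary function on
`ℝ^d`: it is integrable and its Fourier transform vanishes off the closed positive orthant.
The norm of `H¹(ℂ_+^d)` is the `L¹` norm of the boundary function. -/
def HardyOne (f : Rd d → ℂ) : Prop :=
  Integrable f volume ∧ ∀ ξ : Rd d, (∃ j, ξ j < 0) → 𝓕 f ξ = 0

/-- The norm of the real Hardy space `Re H¹(ℂ_+^d)`: the sum of the `L¹` norms of all the `2^d`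
components `P_σ f`. -/
def reHardyNorm (f : L2 d) : ℝ≥0∞ := ∑ σ : Fin d → ℤˣ, eLpNorm (proj σ f) 1 volume

/-! ### Symbols and their BMO norms -/

/-- The admissible symbols: functions `b` with `∫ |b(x)|² ∏_j (1 + x_j²)⁻¹ dx < ∞`. Under the
Cayley transform these are the square integrable functions on the torus `𝕋^d`; they include all
of `L²(ℝ^d)` and all of `L^∞(ℝ^d)`. -/
def IsSymbol (b : Rd d → ℂ) : Prop :=
  MemLp (fun x => b x / ((∏ j, √(1 + x j ^ 2) : ℝ) : ℂ)) 2 volume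

/-- The duality pairing `⟨b, f⟩ = ∫ b f̄`. -/
def pairing (b : Rd d → ℂ) (f : L2 d) : ℂ := ∫ x, b x * conj (f x)

/-- The (dense) set of those `f` in the real Hardy space for which `⟨b, P_σ f⟩` is an absolutely
convergent integral for all `σ`. -/
def pairingDomain (b : Rd d → ℂ) : Set (L2 d) :=
  {f | ∀ σ : Fin d → ℤˣ, Integrable (proj σ f) volume ∧
    Integrable (fun x => b x * conj (proj σ f x)) volume}

/-- The norm, in the dual of `Re H¹(ℂ_+^d)`, of the functional `Λ` defined on the set `D`. -/
def dualNorm (D : Set (L2 d)) (Λ : L2 d → ℂ) : ℝ≥0∞ :=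
  ⨆ f ∈ D, ⨆ _ : reHardyNorm f ≤ 1, ‖Λ f‖ₑ

/-- The product BMO norm of `b`, i.e. its norm in `BMO(ℝ^d) = (Re H¹(ℂ_+^d))^*`. -/
def bmoNorm (b : Rd d → ℂ) : ℝ≥0∞ := dualNorm (pairingDomain b) (pairing b)

/-- The product BMO norm of `P_⊕ b`, where `⟨P_⊕ b, f⟩ = ⟨b, P_⊕ f⟩`. -/
def bmoNormProjPlus (b : Rd d → ℂ) : ℝ≥0∞ :=
  dualNorm (pairingDomain b) fun f => pairing b (projPlus f)

/-- The symbol `b` is analytic: `b = P_⊕ b`, as a functional on the real Hardy space. -/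
def IsAnalyticSymbol (b : Rd d → ℂ) : Prop :=
  IsSymbol b ∧ ∀ f ∈ pairingDomain b, pairing b (projPlus f) = pairing b f

/-- The analytic BMO norm of `b`, i.e. its norm in `BMO(ℂ_+^d) = H¹(ℂ_+^d)^*`. -/
def analyticBmoNorm (b : Rd d → ℂ) : ℝ≥0∞ :=
  ⨆ (f : L2 d) (_ : HardyOne f) (_ : Integrable (fun x => b x * conj (f x)) volume)
    (_ : eLpNorm f 1 volume ≤ 1), ‖pairing b f‖ₑ

/-! ### Multiplication, Hankel and commutator operators -/

/-- An operator in `L²(ℝ^d)` with a domain. Values off the domain are meaningless and never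
enter `opNorm`. -/
structure PartialOp (d : ℕ) where
  /-- the domain -/
  dom : Set (L2 d)
  /-- the action on the domain -/
  app : L2 d → L2 d

/-- The norm of an operator: the supremum of `‖T φ‖` over the `φ` in its domain of norm at most
one. -/
def PartialOp.opNorm (T : PartialOp d) : ℝ≥0∞ :=
  ⨆ φ ∈ T.dom, ⨆ _ : ‖φ‖ ≤ 1, ‖T.app φ‖ₑ

open Classical in
/-- `M_b`, pointwise multiplication by `b`, on its natural domain `{φ ∈ L² : b φ ∈ L²}`. -/
def mulOp (b : Rd d → ℂ) : PartialOp d where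
  dom := {φ | MemLp (fun x => b x * φ x) 2 volume}
  app φ := if h : MemLp (fun x => b x * φ x) 2 volume then h.toLp _ else 0

/-- The Hankel operator `H_b φ = P_⊕ M_b φ̄`, for `φ ∈ H²(ℂ_+^d)` with `φ̄` in the domain of
`M_b`. -/
def hankel (b : Rd d → ℂ) : PartialOp d where
  dom := {φ | φ ∈ hardyTwo d ∧ star φ ∈ (mulOp b).dom}
  app φ := projPlus ((mulOp b).app (star φ))

/-- The commutator `[T, S] = T S - S T` with an everywhere defined operator `S`, on its natural
domain. -/
def PartialOp.comm (T : PartialOp d) (S : L2 d → L2 d) : PartialOp d where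
  dom := {φ | φ ∈ T.dom ∧ S φ ∈ T.dom}
  app φ := T.app (S φ) - S (T.app φ)

/-- The iterated commutator `C_b = [⋯[[M_b, H_1], H_2], …, H_d]`. -/
def commutator (b : Rd d → ℂ) : PartialOp d :=
  (List.finRange d).foldl (fun T j => T.comm (hilbert j)) (mulOp b)

/-! ### The projective tensor norm, and equivalence of norms -/

/-- The norm of `f` in `H²(ℂ_+^d) ⊗̂ H²(ℂ_+^d)`: the infimum of `∑_j ‖φ_j‖ ‖ψ_j‖` over all
representations `f = ∑_j φ_j ψ_j`. It is `⊤` if there is none with a finite sum of norms (and for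
those with a finite sum of norms the series converges absolutely in `L¹` and almost everywhere). -/
def tensorNorm (f : Rd d → ℂ) : ℝ≥0∞ :=
  ⨅ (φ : ℕ → L2 d) (ψ : ℕ → L2 d) (_ : ∀ j, φ j ∈ hardyTwo d ∧ ψ j ∈ hardyTwo d)
    (_ : ∀ᵐ x, HasSum (fun j => φ j x * ψ j x) (f x)), ∑' j, ‖φ j‖ₑ * ‖ψ j‖ₑ

/-- `N ≃ M` on the class `S`: each is at most a constant multiple of the other, with a constant
that does not depend on the element of `S`. -/
def Equivalent {α : Type*} (S : α → Prop) (N M : α → ℝ≥0∞) : Prop :=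
  ∃ C : ℝ≥0, ∀ a, S a → N a ≤ C * M a ∧ M a ≤ C * N a

end Polydisk

end

noncomputable section

namespace Polydisk

variable {d : ℕ}

/-! ### The Fourier transform on `L¹ ∩ L²` and on `L²` -/

/-! Every norm of a symbol is encoded by two kinds of bounds, one orthant `σ` at a time. `BddE σ b
A` bounds `∫ b ḡ` by `A‖g‖₁` for test functions `g` with frequencies in `σ`. `BddH σ b A` bounds the
same integral by `A‖φ‖‖ψ‖` when `g = φψ` is a product of two such functions. The first implies the
second by Cauchy–Schwarz (`BddE.bddH`), which is the easy half of the four operator statements;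
their content is the converse, up to a constant.

The Hankel norm is the best `A` in `BddH 1` (`hankel_opNorm_le_iff`), and the BMO norms are the best
`A` in `BddE` for `σ = 1` or for all `σ` (`bmoNormProjPlus_le_iff`, `analyticBmoNorm_le_iff`,
`bmoNorm_le_iff`). On functions with frequencies in `σ` each `H_j` is the scalar `σ(j)`, so there
`C_b` is a scalar of modulus `2^d` times `P_{-σ} M_b` (`commutator_of_spec`). As inputs and outputs
for different `σ` are orthogonal, `‖C_b‖` is comparable to the largest of the Hankel bounds over all
orthants.

Reflecting coordinates carries the Hankel estimate to every orthant, which gives the commutator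
estimate. Conversely, replacing `b` by its analytic part (`exists_analytic_part`) keeps the positive
orthant and removes all the others, so the analytic, or by taking real parts the real, commutator
estimate returns the Hankel estimate.

Weak factorization is dual to the Hankel estimate. If the estimate holds, Hahn–Banach puts a ball of
`H¹` in the closure of finite sums of products (`mem_closure_finiteProducts`), and successive
approximation turns the closure into convergent series. If weak factorization holds, a Hankel form
can be summed along a factorization of `g`.

The analytic difficulty is that symbols are only square integrable against a weight, so pairings and
operators have restricted domains. Multiplication by `damp` preserves frequencies in an orthant and
supplies the missing decay; averaging over translates supplies boundedness. These two
regularizations show that all the domains in use give the same bounds. -/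

lemma L2.ext_ae {f g : L2 d} (h : ∀ᵐ x, f x = g x) : f = g := Lp.ext h

/-- On `L¹ ∩ L²` the Plancherel transform is the Fourier integral. -/
lemma fourierL2_ae_eq {f : L2 d} (hf : Integrable f volume) :
    ∀ᵐ ξ, fourierL2 f ξ = 𝓕 (f : Rd d → ℂ) ξ := by
  have hcont : Continuous (𝓕 (f : Rd d → ℂ)) :=
    VectorFourier.fourierIntegral_continuous Real.continuous_fourierChar (by simp only [innerₗ_apply_apply]; fun_prop) hf
  have hloc : LocallyIntegrable (fun ξ => fourierL2 f ξ - 𝓕 (f : Rd d → ℂ) ξ) volume :=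
    ((Lp.memLp (fourierL2 f)).locallyIntegrable (by norm_num)).sub hcont.locallyIntegrable
  have key := ae_eq_zero_of_integral_contDiff_smul_eq_zero hloc ?_
  · filter_upwards [key] with ξ h using sub_eq_zero.1 h
  intro g hg hgc
  have hG1 : HasCompactSupport (fun x => (g x : ℂ)) := hgc.comp_left (g := fun t : ℝ => (t : ℂ)) rfl
  have hG2 : ContDiff ℝ (⊤ : ℕ∞) (fun x => (g x : ℂ)) := Complex.ofRealCLM.contDiff.comp hg
  set G : SchwartzMap (Rd d) ℂ := hG1.toSchwartzMap hG2 with hGdef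
  have hG : ∀ x, G x = (g x : ℂ) := fun x => rfl
  have h1 := congrArg (fun T => T G) (Lp.fourier_toTemperedDistribution_eq f)
  simp only [TemperedDistribution.fourier_apply, Lp.toTemperedDistribution_apply] at h1
  have h2 : ∫ x, 𝓕 (f : Rd d → ℂ) x • G x = ∫ x, f x • 𝓕 (G : Rd d → ℂ) x := by
    have := VectorFourier.integral_fourierIntegral_smul_eq_flip (μ := volume) (ν := volume)
      (L := innerₗ (Rd d)) (f := (f : Rd d → ℂ)) (g := (G : Rd d → ℂ)) Real.continuous_fourierChar
      (by simp only [innerₗ_apply_apply]; fun_prop) hf G.integrable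
    rw [flip_innerₗ] at this
    exact this
  rw [← SchwartzMap.fourier_coe] at h2
  -- Both transforms satisfy the multiplication formula, so each pairs with `G` as `f` pairs with `𝓕
  -- G`.
  have h3 : ∫ x, G x • fourierL2 f x = ∫ x, G x • 𝓕 (f : Rd d → ℂ) x := by
    calc _ = ∫ x, (𝓕 G) x • f x := h1.symm
      _ = ∫ x, f x • (𝓕 G) x := by simp only [smul_eq_mul, mul_comm]
      _ = _ := by rw [← h2]; simp only [smul_eq_mul, mul_comm]
  have hi1 : Integrable (fun x => g x • fourierL2 f x) volume :=
    ((Lp.memLp (fourierL2 f)).locallyIntegrable (by norm_num)).integrable_smul_left_of_hasCompactSupport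
      hg.continuous hgc
  have hi2 : Integrable (fun x => g x • 𝓕 (f : Rd d → ℂ) x) volume :=
    hcont.locallyIntegrable.integrable_smul_left_of_hasCompactSupport hg.continuous hgc
  simp only [smul_sub]
  rw [integral_sub hi1 hi2, sub_eq_zero]
  simpa only [hG, smul_eq_mul, Complex.real_smul] using h3

lemma continuous_fourier {f : Rd d → ℂ} (hf : Integrable f volume) : Continuous (𝓕 f) :=
  VectorFourier.fourierIntegral_continuous Real.continuous_fourierChar (by simp only [innerₗ_apply_apply]; fun_prop) hf

/-- Two continuous maps on `L²` that agree on `L¹ ∩ L²` are equal. -/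
lemma L2.eq_of_integrable {X : Type*} [TopologicalSpace X] [T2Space X] {A B : L2 d → X}
    (hA : Continuous A) (hB : Continuous B)
    (h : ∀ f : L2 d, Integrable f volume → A f = B f) (f : L2 d) : A f = B f := by
  refine DenseRange.induction_on (p := fun f => A f = B f)
    (SchwartzMap.denseRange_toLpCLM (p := 2) ENNReal.ofNat_ne_top) f
    (isClosed_eq hA hB) fun g => h _ ?_
  exact (integrable_congr (g.coeFn_toLp 2 volume)).2 g.integrable

/-! ### Multiplication by bounded functions, translations, reflections, conjugation on `L²` -/

lemma memLp_two_mul_of_le {m f : Rd d → ℂ} {C : ℝ} (hm : AEStronglyMeasurable m volume)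
    (hC : ∀ᵐ x, ‖m x‖ ≤ C) (hf : MemLp f 2 volume) : MemLp (fun x => m x * f x) 2 volume :=
  hf.of_le_mul (c := C) (hm.mul hf.1) (by
    filter_upwards [hC] with x hx
    rw [norm_mul]; gcongr)

open Classical in
/-- Multiplication by the function `m`, if it is measurable and bounded by `1`. -/
def mulUnit (m : Rd d → ℂ) (f : L2 d) : L2 d :=
  if h : MemLp (fun x => m x * f x) 2 volume then h.toLp _ else 0

/-- `m` is measurable and bounded by `1`. -/
structure IsContractor (m : Rd d → ℂ) : Prop where
  meas : AEStronglyMeasurable m volume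
  le : ∀ x, ‖m x‖ ≤ 1

variable {m : Rd d → ℂ}

lemma IsContractor.memLp (hm : IsContractor m) {f : Rd d → ℂ} (hf : MemLp f 2 volume) :
    MemLp (fun x => m x * f x) 2 volume :=
  memLp_two_mul_of_le hm.meas (.of_forall hm.le) hf

lemma mulUnit_ae (hm : IsContractor m) (f : L2 d) : ∀ᵐ x, mulUnit m f x = m x * f x := by
  have h := hm.memLp (Lp.memLp f)
  rw [mulUnit, dif_pos h]
  exact h.coeFn_toLp

lemma norm_mulUnit_le (hm : IsContractor m) (f : L2 d) : ‖mulUnit m f‖ ≤ ‖f‖ := by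
  refine Lp.norm_le_norm_of_ae_le ?_
  filter_upwards [mulUnit_ae hm f] with x hx
  rw [hx, norm_mul]
  exact mul_le_of_le_one_left (norm_nonneg _) (hm.le x)

lemma mulUnit_sub (hm : IsContractor m) (f g : L2 d) :
    mulUnit m (f - g) = mulUnit m f - mulUnit m g := by
  refine L2.ext_ae ?_
  filter_upwards [mulUnit_ae hm f, mulUnit_ae hm g, mulUnit_ae hm (f - g), Lp.coeFn_sub f g,
    Lp.coeFn_sub (mulUnit m f) (mulUnit m g)] with x h1 h2 h3 h4 h5
  rw [h3, h4, h5, Pi.sub_apply, Pi.sub_apply, h1, h2, mul_sub]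

lemma continuous_mulUnit (hm : IsContractor m) : Continuous (mulUnit m : L2 d → L2 d) :=
  (LipschitzWith.of_dist_le_mul (K := 1) fun f g => by
    rw [dist_eq_norm, dist_eq_norm, ← mulUnit_sub hm, NNReal.coe_one, one_mul]
    exact norm_mulUnit_le hm _).continuous

/-- The character `x ↦ e^{2πi⟨x, t⟩}`. -/
def character (t x : Rd d) : ℂ := Real.fourierChar (inner ℝ x t)

lemma norm_character (t x : Rd d) : ‖character t x‖ = 1 := Circle.norm_coe _

lemma continuous_character (t : Rd d) : Continuous (character t) := by
  unfold character
  exact continuous_subtype_val.comp (Real.continuous_fourierChar.comp (by fun_prop))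

lemma conj_character (t x : Rd d) : conj (character t x) = character (-t) x := by
  unfold character
  rw [inner_neg_right, AddChar.map_neg_eq_inv, Circle.coe_inv_eq_conj]

lemma character_add (s t x : Rd d) : character (s + t) x = character s x * character t x := by
  unfold character
  rw [inner_add_right, AddChar.map_add_eq_mul, Circle.coe_mul]

lemma fourier_eq_character (f : Rd d → ℂ) (ξ : Rd d) :
    𝓕 f ξ = ∫ x, character (-ξ) x * f x := by
  rw [Real.fourier_eq]
  simp only [character, inner_neg_right]
  rfl

lemma isContractor_character (t : Rd d) : IsContractor (character t) :=
  ⟨(continuous_character t).aestronglyMeasurable, fun x => (norm_character t x).le⟩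

/-- Translation of an `L²` function. -/
def translate (y : Rd d) (f : L2 d) : L2 d :=
  Lp.compMeasurePreserving (· + y) (measurePreserving_add_right volume y) f

lemma translate_ae (y : Rd d) (f : L2 d) : ∀ᵐ x, translate y f x = f (x + y) :=
  Lp.coeFn_compMeasurePreserving _ _

lemma continuous_translate (y : Rd d) : Continuous (translate y : L2 d → L2 d) :=
  (Lp.isometry_compMeasurePreserving _).continuous

lemma norm_translate (y : Rd d) (f : L2 d) : ‖translate y f‖ = ‖f‖ :=
  Lp.norm_compMeasurePreserving _ _

/-- Composition of an `L²` function with a linear isometry. -/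
def reflect (R : Rd d ≃ₗᵢ[ℝ] Rd d) (f : L2 d) : L2 d :=
  Lp.compMeasurePreserving R R.measurePreserving f

lemma reflect_ae (R : Rd d ≃ₗᵢ[ℝ] Rd d) (f : L2 d) : ∀ᵐ x, reflect R f x = f (R x) :=
  Lp.coeFn_compMeasurePreserving _ _

lemma continuous_reflect (R : Rd d ≃ₗᵢ[ℝ] Rd d) : Continuous (reflect R : L2 d → L2 d) :=
  (Lp.isometry_compMeasurePreserving _).continuous

lemma norm_reflect (R : Rd d ≃ₗᵢ[ℝ] Rd d) (f : L2 d) : ‖reflect R f‖ = ‖f‖ :=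
  Lp.norm_compMeasurePreserving _ _

lemma star_ae (f : L2 d) : ∀ᵐ x, (star f : L2 d) x = conj (f x) := Lp.coeFn_star f

lemma norm_star_L2 (f : L2 d) : ‖(star f : L2 d)‖ = ‖f‖ := by
  have h : ∀ᵐ x, ‖(star f : L2 d) x‖ = ‖f x‖ := by
    filter_upwards [star_ae f] with x hx
    rw [hx, RCLike.norm_conj]
  exact le_antisymm (Lp.norm_le_norm_of_ae_le (h.mono fun x hx => hx.le))
    (Lp.norm_le_norm_of_ae_le (h.mono fun x hx => hx.ge))

lemma star_sub_L2 (f g : L2 d) : (star (f - g) : L2 d) = star f - star g := by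
  refine L2.ext_ae ?_
  filter_upwards [star_ae f, star_ae g, star_ae (f - g), Lp.coeFn_sub f g,
    Lp.coeFn_sub (star f) (star g)] with x h1 h2 h3 h4 h5
  rw [h3, h4, h5, Pi.sub_apply, Pi.sub_apply, h1, h2, map_sub]

lemma continuous_star_L2 : Continuous (star : L2 d → L2 d) :=
  (LipschitzWith.of_dist_le_mul (K := 1) fun f g => by
    rw [dist_eq_norm, dist_eq_norm, ← star_sub_L2, NNReal.coe_one, one_mul, norm_star_L2]).continuous

lemma quasi_add (t : Rd d) : Measure.QuasiMeasurePreserving (· + t) (volume : Measure (Rd d)) volume :=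
  (measurePreserving_add_right volume t).quasiMeasurePreserving

/-- Both sides are continuous in `f`, so the integral formula on `L¹ ∩ L²` suffices. The rules for
translations, reflections and conjugation follow by the same density argument. -/
lemma fourierL2_mulUnit_character (t : Rd d) (f : L2 d) :
    fourierL2 (mulUnit (character t) f) = translate (-t) (fourierL2 f) := by
  revert f
  refine L2.eq_of_integrable (fourierL2.continuous.comp (continuous_mulUnit (isContractor_character t)))
    ((continuous_translate _).comp fourierL2.continuous) fun f hf => L2.ext_ae ?_
  have hm := mulUnit_ae (isContractor_character t) f
  have hi : Integrable (mulUnit (character t) f) volume :=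
    (integrable_congr hm).2 (hf.bdd_mul (isContractor_character t).meas (.of_forall (isContractor_character t).le))
  filter_upwards [fourierL2_ae_eq hi, translate_ae (-t) (fourierL2 f),
    (quasi_add (-t)).ae (fourierL2_ae_eq hf)] with ξ h1 h2 h3
  rw [h1, h2, h3, Real.fourier_congr_ae hm, fourier_eq_character, fourier_eq_character]
  congr 1; ext x
  rw [← mul_assoc, ← character_add]
  congr 2; abel

lemma fourierL2_translate (y : Rd d) (f : L2 d) :
    fourierL2 (translate y f) = mulUnit (character y) (fourierL2 f) := by
  revert f
  refine L2.eq_of_integrable (fourierL2.continuous.comp (continuous_translate y))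
    ((continuous_mulUnit (isContractor_character y)).comp fourierL2.continuous) fun f hf => L2.ext_ae ?_
  have hm := translate_ae y f
  have hi : Integrable (translate y f) volume := (integrable_congr hm).2 (hf.comp_add_right y)
  filter_upwards [fourierL2_ae_eq hi, mulUnit_ae (isContractor_character y) (fourierL2 f),
    fourierL2_ae_eq hf] with ξ h1 h2 h3
  rw [h1, h2, h3, Real.fourier_congr_ae hm, fourier_eq_character, fourier_eq_character,
    ← integral_const_mul,
    ← integral_add_right_eq_self (fun x => character y ξ * (character (-ξ) x * f x)) y]
  congr 1; ext x
  have : character y ξ * character (-ξ) (x + y) = character (-ξ) x := by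
    unfold character
    rw [← Circle.coe_mul, ← AddChar.map_add_eq_mul, inner_add_left]
    simp [inner_neg_right, real_inner_comm]
  rw [← mul_assoc, this]

lemma fourierL2_reflect (R : Rd d ≃ₗᵢ[ℝ] Rd d) (f : L2 d) :
    fourierL2 (reflect R f) = reflect R (fourierL2 f) := by
  revert f
  refine L2.eq_of_integrable (fourierL2.continuous.comp (continuous_reflect R))
    ((continuous_reflect R).comp fourierL2.continuous) fun f hf => L2.ext_ae ?_
  have hm := reflect_ae R f
  have hi : Integrable (reflect R f) volume :=
    (integrable_congr hm).2 ((R.measurePreserving.integrable_comp_emb R.toHomeomorph.measurableEmbedding).2 hf)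
  filter_upwards [fourierL2_ae_eq hi, reflect_ae R (fourierL2 f),
    R.measurePreserving.quasiMeasurePreserving.ae (fourierL2_ae_eq hf)] with ξ h1 h2 h3
  rw [h1, h2, h3, Real.fourier_congr_ae hm, ← Real.fourier_comp_linearIsometry]
  rfl

lemma fourierL2_star (f : L2 d) :
    fourierL2 (star f) = reflect (LinearIsometryEquiv.neg ℝ) (star (fourierL2 f)) := by
  revert f
  refine L2.eq_of_integrable (fourierL2.continuous.comp continuous_star_L2)
    ((continuous_reflect _).comp (continuous_star_L2.comp fourierL2.continuous)) fun f hf => L2.ext_ae ?_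
  have hm := star_ae f
  have hi : Integrable (star f : L2 d) volume :=
    (integrable_congr hm).2 ((Complex.conjLIE.toContinuousLinearEquiv : ℂ →L[ℝ] ℂ).integrable_comp hf)
  have q := (LinearIsometryEquiv.neg ℝ (E := Rd d)).measurePreserving.quasiMeasurePreserving
  filter_upwards [fourierL2_ae_eq hi, reflect_ae (LinearIsometryEquiv.neg ℝ) (star (fourierL2 f)),
    q.ae (fourierL2_ae_eq hf), q.ae (star_ae (fourierL2 f))] with ξ h1 h2 h3 h4
  rw [h1, h2, h4, h3, Real.fourier_congr_ae hm, fourier_eq_character, fourier_eq_character,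
    ← integral_conj]
  congr 1; ext x
  simp [conj_character]

/-! ### Frequency projections -/

lemma restrictTo_ae (S : Set (Rd d)) (hS : MeasurableSet S) (f : L2 d) :
    ∀ᵐ x, restrictTo S hS f x = S.indicator f x := MemLp.coeFn_toLp _

lemma restrictTo_add (S : Set (Rd d)) (hS : MeasurableSet S) (f g : L2 d) :
    restrictTo S hS (f + g) = restrictTo S hS f + restrictTo S hS g := by
  refine L2.ext_ae ?_
  filter_upwards [restrictTo_ae S hS f, restrictTo_ae S hS g, restrictTo_ae S hS (f + g),
    Lp.coeFn_add f g, Lp.coeFn_add (restrictTo S hS f) (restrictTo S hS g)] with x h1 h2 h3 h4 h5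
  rw [h3, h5, Pi.add_apply, h1, h2]
  by_cases hx : x ∈ S
  · simp only [Set.indicator_of_mem hx]; exact h4
  · simp only [Set.indicator_of_notMem hx, add_zero]

lemma restrictTo_smul (S : Set (Rd d)) (hS : MeasurableSet S) (c : ℂ) (f : L2 d) :
    restrictTo S hS (c • f) = c • restrictTo S hS f := by
  refine L2.ext_ae ?_
  filter_upwards [restrictTo_ae S hS f, restrictTo_ae S hS (c • f),
    Lp.coeFn_smul c f, Lp.coeFn_smul c (restrictTo S hS f)] with x h1 h3 h4 h5
  rw [h3, h5, Pi.smul_apply, h1]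
  by_cases hx : x ∈ S <;> simp [hx, h4]

lemma norm_restrictTo_le (S : Set (Rd d)) (hS : MeasurableSet S) (f : L2 d) :
    ‖restrictTo S hS f‖ ≤ ‖f‖ := by
  refine Lp.norm_le_norm_of_ae_le ?_
  filter_upwards [restrictTo_ae S hS f] with x hx
  rw [hx]
  exact norm_indicator_le_norm_self _ _

/-- The frequency projection as a continuous linear map. -/
def freqProjL (S : Set (Rd d)) (hS : MeasurableSet S) : L2 d →L[ℂ] L2 d :=
  LinearMap.mkContinuous
    { toFun := freqProj S hS
      map_add' := fun f g => by simp only [freqProj, map_add, restrictTo_add]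
      map_smul' := fun c f => by simp only [freqProj, map_smul, restrictTo_smul, RingHom.id_apply] }
    1 fun f => by
      change ‖fourierL2.symm (restrictTo S hS (fourierL2 f))‖ ≤ 1 * ‖f‖
      rw [one_mul, LinearIsometryEquiv.norm_map]
      exact (norm_restrictTo_le S hS _).trans (LinearIsometryEquiv.norm_map _ _).le

lemma freqProjL_apply (S : Set (Rd d)) (hS : MeasurableSet S) (f : L2 d) :
    freqProjL S hS f = freqProj S hS f := rfl

variable {S T : Set (Rd d)} {hS : MeasurableSet S} {hT : MeasurableSet T}

lemma fourierL2_freqProj (f : L2 d) :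
    fourierL2 (freqProj S hS f) = restrictTo S hS (fourierL2 f) :=
  LinearIsometryEquiv.apply_symm_apply _ _

lemma fourierL2_freqProj_ae (f : L2 d) :
    ∀ᵐ ξ, fourierL2 (freqProj S hS f) ξ = S.indicator (fourierL2 f) ξ := by
  rw [fourierL2_freqProj]
  exact restrictTo_ae _ _ _

lemma L2.ext_fourier {f g : L2 d} (h : ∀ᵐ ξ, fourierL2 f ξ = fourierL2 g ξ) : f = g :=
  fourierL2.injective (L2.ext_ae h)

lemma freqProj_comp (f : L2 d) :
    freqProj S hS (freqProj T hT f) = freqProj (S ∩ T) (hS.inter hT) f := by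
  refine L2.ext_fourier ?_
  filter_upwards [fourierL2_freqProj_ae (hS := hS) (freqProj T hT f),
    fourierL2_freqProj_ae (hS := hT) f, fourierL2_freqProj_ae (hS := hS.inter hT) f] with ξ h1 h2 h3
  rw [h1, h3]
  by_cases a : ξ ∈ S <;> by_cases b : ξ ∈ T <;> simp [a, b, h2]

lemma freqProj_congr (h : ∀ᵐ ξ, ξ ∈ S ↔ ξ ∈ T) (f : L2 d) : freqProj S hS f = freqProj T hT f := by
  refine L2.ext_fourier ?_
  filter_upwards [fourierL2_freqProj_ae (hS := hS) f, fourierL2_freqProj_ae (hS := hT) f, h]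
    with ξ h1 h2 h3
  rw [h1, h2]
  by_cases a : ξ ∈ S
  · simp [a, h3.1 a]
  · rw [Set.indicator_of_notMem a, Set.indicator_of_notMem fun b => a (h3.2 b)]

lemma freqProj_eq_self_iff (f : L2 d) :
    freqProj S hS f = f ↔ ∀ᵐ ξ, ξ ∉ S → fourierL2 f ξ = 0 := by
  constructor
  · intro h
    filter_upwards [fourierL2_freqProj_ae (hS := hS) f] with ξ h1 h2
    rw [h] at h1
    rw [h1, Set.indicator_of_notMem h2]
  · intro h
    refine L2.ext_fourier ?_
    filter_upwards [fourierL2_freqProj_ae (hS := hS) f, h] with ξ h1 h2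
    rw [h1]
    by_cases a : ξ ∈ S
    · simp [a]
    · simp [a, h2 a]

lemma inner_freqProj_left (f g : L2 d) :
    inner ℂ (freqProj S hS f) g = inner ℂ f (freqProj S hS g) := by
  rw [← fourierL2.inner_map_map, ← fourierL2.inner_map_map f, L2.inner_def, L2.inner_def]
  refine integral_congr_ae ?_
  filter_upwards [fourierL2_freqProj_ae (hS := hS) f, fourierL2_freqProj_ae (hS := hS) g]
    with ξ h1 h2
  rw [h1, h2]
  by_cases a : ξ ∈ S <;> simp [a]

lemma freqProj_freqProj (f : L2 d) : freqProj S hS (freqProj S hS f) = freqProj S hS f := by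
  rw [freqProj_comp]
  exact freqProj_congr (by simp) f

/-- The range of an orthogonal projection is the orthogonal complement of its kernel. This makes a
frequency condition testable by integrals, so that Fubini applies to superpositions of functions. -/
lemma freqProj_eq_self_iff_inner (f : L2 d) :
    freqProj S hS f = f ↔ ∀ g, freqProj S hS g = 0 → inner ℂ g f = 0 := by
  constructor
  · intro h g hg
    rw [← h, ← inner_freqProj_left, hg, inner_zero_left]
  · intro h
    have h1 := h (f - freqProj S hS f) (by
      rw [← freqProjL_apply, map_sub, freqProjL_apply, freqProjL_apply, freqProj_freqProj, sub_self])
    have h2 : inner ℂ (f - freqProj S hS f) (freqProj S hS f) = 0 := by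
      rw [← inner_freqProj_left, ← freqProjL_apply, map_sub, freqProjL_apply, freqProjL_apply,
        freqProj_freqProj, sub_self, inner_zero_left]
    have h3 : inner ℂ (f - freqProj S hS f) (f - freqProj S hS f) = 0 := by
      rw [inner_sub_right, h1, h2, sub_zero]
    exact (sub_eq_zero.1 (inner_self_eq_zero.1 h3)).symm

/-! ### Functions with frequencies in an orthant -/

lemma mem_orthant {σ : Fin d → ℤˣ} {ξ : Rd d} : ξ ∈ orthant σ ↔ ∀ j, 0 < ((σ j : ℤ) : ℝ) * ξ j := by
  simp [orthant, halfSpace]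

lemma disjoint_orthant {σ τ : Fin d → ℤˣ} (h : σ ≠ τ) : Disjoint (orthant σ) (orthant τ) := by
  rw [Set.disjoint_left]
  intro ξ h1 h2
  rw [mem_orthant] at h1 h2
  obtain ⟨j, hj⟩ := Function.ne_iff.1 h
  have a := h1 j
  have b := h2 j
  rcases Int.units_eq_one_or (σ j) with p | p <;> rcases Int.units_eq_one_or (τ j) with q | q <;>
    simp [p, q] at a b hj <;> linarith

/-- Coordinate hyperplanes are proper subspaces, hence null. This is why open orthants suffice for
the decomposition of `L²`. -/
lemma ae_coord_ne_zero : ∀ᵐ ξ : Rd d, ∀ j, ξ j ≠ 0 := by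
  rw [ae_all_iff]
  intro j
  have h := Measure.addHaar_submodule (volume : Measure (Rd d))
    (LinearMap.ker (EuclideanSpace.proj (𝕜 := ℝ) j : Rd d →L[ℝ] ℝ).toLinearMap) (by
      intro h
      have : EuclideanSpace.single j (1 : ℝ) ∈
        LinearMap.ker (EuclideanSpace.proj (𝕜 := ℝ) j : Rd d →L[ℝ] ℝ).toLinearMap := by rw [h]; trivial
      simp at this)
  rw [ae_iff]
  convert h using 2
  ext ξ
  simp

/-- The sign pattern of `ξ`. -/
def signs (ξ : Rd d) : Fin d → ℤˣ := fun j => if 0 < ξ j then 1 else -1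

lemma ae_mem_orthant_iff : ∀ᵐ ξ : Rd d, ∀ σ, ξ ∈ orthant σ ↔ σ = signs ξ := by
  filter_upwards [ae_coord_ne_zero] with ξ h σ
  have hs : ξ ∈ orthant (signs ξ) := by
    rw [mem_orthant]
    intro j
    unfold signs
    split_ifs with hj
    · simpa using hj
    · simpa using lt_of_le_of_ne (not_lt.1 hj) (h j)
  constructor
  · intro hσ
    by_contra hne
    exact Set.disjoint_left.1 (disjoint_orthant hne) hσ hs
  · rintro rfl
    exact hs

/-- The frequencies of `f` lie in the orthant with signs `σ`. -/
def Spec (σ : Fin d → ℤˣ) (f : L2 d) : Prop := proj σ f = f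

/-- `P_σ` as a continuous linear map. -/
abbrev projL (σ : Fin d → ℤˣ) : L2 d →L[ℂ] L2 d := freqProjL (orthant σ) (measurableSet_orthant σ)

lemma projL_apply (σ : Fin d → ℤˣ) (f : L2 d) : projL σ f = proj σ f := rfl

lemma spec_iff {σ : Fin d → ℤˣ} {f : L2 d} :
    Spec σ f ↔ ∀ᵐ ξ, ξ ∉ orthant σ → fourierL2 f ξ = 0 := freqProj_eq_self_iff f

lemma spec_iff_inner {σ : Fin d → ℤˣ} {f : L2 d} :
    Spec σ f ↔ ∀ g, proj σ g = 0 → inner ℂ g f = 0 := freqProj_eq_self_iff_inner f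

lemma spec_proj (σ : Fin d → ℤˣ) (f : L2 d) : Spec σ (proj σ f) := by
  exact freqProj_freqProj f

lemma proj_eq_zero_of_ne {σ τ : Fin d → ℤˣ} (h : σ ≠ τ) {f : L2 d} (hf : Spec τ f) :
    proj σ f = 0 := by
  rw [← hf]
  refine L2.ext_fourier ?_
  unfold proj
  rw [freqProj_comp]
  filter_upwards [fourierL2_freqProj_ae
    (hS := (measurableSet_orthant σ).inter (measurableSet_orthant τ)) f,
    Lp.coeFn_zero ℂ 2 (volume : Measure (Rd d))] with ξ h1 h2
  rw [h1, (disjoint_orthant h).inter_eq, map_zero, h2]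
  simp

lemma sum_proj (f : L2 d) : ∑ σ : Fin d → ℤˣ, proj σ f = f := by
  refine L2.ext_fourier ?_
  rw [map_sum]
  have h1 : ∀ᵐ ξ, ∀ σ : Fin d → ℤˣ, fourierL2 (proj σ f) ξ = (orthant σ).indicator (fourierL2 f) ξ :=
    ae_all_iff.2 fun σ => fourierL2_freqProj_ae f
  filter_upwards [h1, ae_mem_orthant_iff,
    Lp.coeFn_finsetSum (s := Finset.univ) (fun σ => fourierL2 (proj σ f))] with ξ h1 h2 h3
  rw [h3, Finset.sum_apply, Finset.sum_eq_single (signs ξ)]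
  · rw [h1, Set.indicator_of_mem ((h2 _).2 rfl)]
  · intro σ _ hσ
    rw [h1, Set.indicator_of_notMem (fun h => hσ ((h2 _).1 h))]
  · simp

lemma inner_eq_zero_of_spec {σ τ : Fin d → ℤˣ} (h : σ ≠ τ) {f g : L2 d} (hf : Spec σ f)
    (hg : Spec τ g) : inner ℂ f g = 0 := by
  rw [← hf, proj, inner_freqProj_left]
  change inner ℂ f (proj σ g) = 0
  rw [proj_eq_zero_of_ne h hg, inner_zero_right]

/-- Pythagoras: functions with frequencies in different orthants are orthogonal. -/
lemma norm_sq_sum_of_spec {g : (Fin d → ℤˣ) → L2 d} (hg : ∀ σ, Spec σ (g σ)) :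
    ‖∑ σ, g σ‖ ^ 2 = ∑ σ, ‖g σ‖ ^ 2 := by
  have h : (inner ℂ (∑ σ, g σ) (∑ σ, g σ) : ℂ) = ∑ σ, inner ℂ (g σ) (g σ) := by
    rw [sum_inner]
    refine Finset.sum_congr rfl fun σ _ => ?_
    rw [inner_sum, Finset.sum_eq_single σ]
    · intro τ _ hτ
      exact inner_eq_zero_of_spec hτ.symm (hg σ) (hg τ)
    · simp
  simp only [inner_self_eq_norm_sq_to_K] at h
  exact_mod_cast h

lemma isClosed_spec (σ : Fin d → ℤˣ) : IsClosed {f : L2 d | Spec σ f} :=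
  isClosed_eq (projL σ).continuous continuous_id

lemma Spec.smul {σ : Fin d → ℤˣ} {f : L2 d} (hf : Spec σ f) (c : ℂ) : Spec σ (c • f) := by
  unfold Spec; rw [← projL_apply, map_smul, projL_apply, hf]

lemma Spec.sub {σ : Fin d → ℤˣ} {f g : L2 d} (hf : Spec σ f) (hg : Spec σ g) : Spec σ (f - g) := by
  unfold Spec; rw [← projL_apply, map_sub, projL_apply, projL_apply, hf, hg]

lemma Spec.add {σ : Fin d → ℤˣ} {f g : L2 d} (hf : Spec σ f) (hg : Spec σ g) : Spec σ (f + g) := by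
  unfold Spec; rw [← projL_apply, map_add, projL_apply, projL_apply, hf, hg]

lemma spec_one_iff {f : L2 d} : Spec 1 f ↔ f ∈ hardyTwo d :=
  ⟨fun h => ⟨f, h⟩, by rintro ⟨g, rfl⟩; exact spec_proj 1 g⟩

/-- Modulation translates the spectrum by `t`, and an orthant is stable under adding elements of its
closure. -/
lemma Spec.mulUnit_character {σ : Fin d → ℤˣ} {t : Rd d} (ht : ∀ j, 0 ≤ ((σ j : ℤ) : ℝ) * t j)
    {f : L2 d} (hf : Spec σ f) : Spec σ (mulUnit (character t) f) := by
  rw [spec_iff] at hf ⊢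
  rw [fourierL2_mulUnit_character]
  filter_upwards [translate_ae (-t) (fourierL2 f), (quasi_add (-t)).ae hf] with ξ h1 h2 h3
  rw [h1]
  refine h2 fun h4 => h3 ?_
  rw [mem_orthant] at h4 ⊢
  intro j
  have a := h4 j
  have b := ht j
  simp only [PiLp.add_apply, PiLp.neg_apply, mul_add, mul_neg] at a
  linarith

lemma Spec.translate {σ : Fin d → ℤˣ} {f : L2 d} (hf : Spec σ f) (y : Rd d) :
    Spec σ (translate y f) := by
  rw [spec_iff] at hf ⊢
  rw [fourierL2_translate]
  filter_upwards [mulUnit_ae (isContractor_character y) (fourierL2 f), hf] with ξ h1 h2 h3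
  rw [h1, h2 h3, mul_zero]

lemma Spec.star {σ : Fin d → ℤˣ} {f : L2 d} (hf : Spec σ f) : Spec (-σ) (star f) := by
  rw [spec_iff] at hf ⊢
  rw [fourierL2_star]
  have q := (LinearIsometryEquiv.neg ℝ (E := Rd d)).measurePreserving.quasiMeasurePreserving
  filter_upwards [reflect_ae (LinearIsometryEquiv.neg ℝ) (Star.star (fourierL2 f)),
    q.ae (star_ae (fourierL2 f)), q.ae hf] with ξ h1 h2 h3 h4
  rw [h1, h2, h3, map_zero]
  intro h5
  apply h4
  rw [mem_orthant] at h5 ⊢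
  intro j
  simpa using h5 j

/-- Reflection in the coordinate hyperplanes selected by the signs `σ`. -/
def signFlip (σ : Fin d → ℤˣ) : Rd d ≃ₗᵢ[ℝ] Rd d :=
  LinearIsometryEquiv.piLpCongrRight 2 fun j =>
    if σ j = 1 then LinearIsometryEquiv.refl ℝ ℝ else LinearIsometryEquiv.neg ℝ

lemma signFlip_apply (σ : Fin d → ℤˣ) (x : Rd d) (j : Fin d) :
    signFlip σ x j = ((σ j : ℤ) : ℝ) * x j := by
  rcases Int.units_eq_one_or (σ j) with h | h <;> simp [signFlip, h]

lemma signFlip_signFlip (σ : Fin d → ℤˣ) (x : Rd d) : signFlip σ (signFlip σ x) = x := by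
  ext j
  rw [signFlip_apply, signFlip_apply]
  rcases Int.units_eq_one_or (σ j) with h | h <;> simp [h]

lemma Spec.reflect {σ τ : Fin d → ℤˣ} {f : L2 d} (hf : Spec σ f) :
    Spec (τ * σ) (reflect (signFlip τ) f) := by
  rw [spec_iff] at hf ⊢
  rw [fourierL2_reflect]
  filter_upwards [reflect_ae (signFlip τ) (fourierL2 f),
    (signFlip τ).measurePreserving.quasiMeasurePreserving.ae hf] with ξ h1 h3 h4
  rw [h1, h3]
  intro h5
  apply h4
  rw [mem_orthant] at h5 ⊢
  intro j
  have := h5 j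
  rw [signFlip_apply] at this
  simp only [Pi.mul_apply, Units.val_mul, Int.cast_mul]
  linarith

/-! ### Hardy spaces of integrable functions -/

/-- Integrable functions whose frequencies lie in the closed orthant with signs `σ`. -/
def HardySign (σ : Fin d → ℤˣ) (f : Rd d → ℂ) : Prop :=
  Integrable f volume ∧ ∀ ξ : Rd d, (∃ j, ((σ j : ℤ) : ℝ) * ξ j < 0) → 𝓕 f ξ = 0

lemma hardySign_one_iff {f : Rd d → ℂ} : HardySign 1 f ↔ HardyOne f := by
  simp [HardySign, HardyOne]

lemma HardySign.congr {σ : Fin d → ℤˣ} {f g : Rd d → ℂ} (hf : HardySign σ f) (h : ∀ᵐ x, f x = g x) :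
    HardySign σ g :=
  ⟨(integrable_congr h).1 hf.1, fun ξ hξ => by rw [← Real.fourier_congr_ae h]; exact hf.2 ξ hξ⟩

/-- The Fourier integral of `f` is continuous, so vanishing almost everywhere on an open half-space
of wrong sign is vanishing everywhere there. Up to the null coordinate hyperplanes these half-spaces
cover the complement of the orthant. -/
lemma spec_iff_hardySign {σ : Fin d → ℤˣ} {f : L2 d} (hf : Integrable f volume) :
    Spec σ f ↔ HardySign σ f := by
  rw [spec_iff, HardySign, and_iff_right hf]
  constructor
  · rintro h ξ ⟨j, hj⟩
    by_contra hne
    have hopen : IsOpen ({ξ : Rd d | ((σ j : ℤ) : ℝ) * ξ j < 0} ∩ {ξ | 𝓕 (f : Rd d → ℂ) ξ ≠ 0}) :=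
      (isOpen_lt (by fun_prop) continuous_const).inter
        (isOpen_ne_fun (continuous_fourier hf) continuous_const)
    refine (hopen.measure_pos volume ⟨ξ, hj, hne⟩).ne' ?_
    rw [measure_eq_zero_iff_ae_notMem]
    filter_upwards [h, fourierL2_ae_eq hf] with η h1 h2 h3
    refine h3.2 (h2 ▸ h1 fun h4 => ?_)
    have := mem_orthant.1 h4 j
    have := h3.1
    simp only [Set.mem_ofPred_eq] at this
    linarith
  · intro h
    filter_upwards [fourierL2_ae_eq hf, ae_coord_ne_zero] with ξ h1 h2 h3
    rw [h1]
    apply h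
    by_contra hne
    push Not at hne
    refine h3 (mem_orthant.2 fun j => lt_of_le_of_ne (hne j) ?_)
    rcases Int.units_eq_one_or (σ j) with p | p <;> simp [p, (h2 j).symm, h2 j]

lemma inner_star_left (f g : L2 d) : inner ℂ (star f) g = ∫ x, f x * g x := by
  rw [L2.inner_def]
  refine integral_congr_ae ?_
  filter_upwards [star_ae f] with x hx
  simp [hx, mul_comm]

lemma integrable_mul_L2 (f g : L2 d) : Integrable (fun x => f x * g x) volume :=
  (Lp.memLp f).integrable_mul (Lp.memLp g)

/-- The transform of a product is the convolution of the transforms, here written through Plancherel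
as an inner product. If `η` and `ξ - η` both lie in the orthant, so does `ξ`; hence the integrand
vanishes for a `ξ` with a coordinate of wrong sign. -/
lemma Spec.mul {σ : Fin d → ℤˣ} {φ ψ : L2 d} (hφ : Spec σ φ) (hψ : Spec σ ψ) :
    HardySign σ (fun x => φ x * ψ x) := by
  refine ⟨integrable_mul_L2 φ ψ, ?_⟩
  rintro ξ ⟨j, hj⟩
  have h1 : 𝓕 (fun x => φ x * ψ x) ξ = inner ℂ (Star.star (mulUnit (character (-ξ)) φ)) ψ := by
    rw [fourier_eq_character, inner_star_left]
    refine integral_congr_ae ?_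
    filter_upwards [mulUnit_ae (isContractor_character (-ξ)) φ] with x hx
    rw [hx, mul_assoc]
  rw [h1, ← fourierL2.inner_map_map, L2.inner_def]
  refine integral_eq_zero_of_ae ?_
  rw [spec_iff] at hφ hψ
  rw [fourierL2_star, fourierL2_mulUnit_character]
  have q := (LinearIsometryEquiv.neg ℝ (E := Rd d)).measurePreserving.quasiMeasurePreserving
  filter_upwards [reflect_ae (LinearIsometryEquiv.neg ℝ) (Star.star (Polydisk.translate (-(-ξ)) (fourierL2 φ))),
    q.ae (star_ae (Polydisk.translate (-(-ξ)) (fourierL2 φ))), q.ae (translate_ae (-(-ξ)) (fourierL2 φ)),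
    q.ae ((quasi_add (-(-ξ))).ae hφ), hψ] with η h1 h2 h3 h4 h5
  simp only [Pi.zero_apply]
  by_cases h6 : η ∈ orthant σ
  · rw [h1, h2, h3, h4, map_zero, inner_zero_left]
    intro h7
    have a := mem_orthant.1 h6 j
    have b := mem_orthant.1 h7 j
    simp only [LinearIsometryEquiv.coe_neg, neg_neg, PiLp.add_apply, PiLp.neg_apply, mul_add,
      mul_neg] at b
    linarith
  · rw [h5 h6, inner_zero_right]

/-! ### The weight, and damping factors -/

/-- The weight `∏_j √(1 + x_j²)`. -/
def weight (x : Rd d) : ℝ := ∏ j, √(1 + x j ^ 2)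

lemma weight_pos (x : Rd d) : 0 < weight x :=
  Finset.prod_pos fun j _ => Real.sqrt_pos.2 (by positivity)

lemma one_le_weight (x : Rd d) : 1 ≤ weight x := by
  unfold weight
  calc (1 : ℝ) = ∏ j : Fin d, 1 := by simp
    _ ≤ _ := Finset.prod_le_prod (by simp) fun j _ => Real.one_le_sqrt.2 (by nlinarith [sq_nonneg (x j)])

lemma continuous_weight : Continuous (weight : Rd d → ℝ) := by
  unfold weight; fun_prop

lemma isSymbol_iff {b : Rd d → ℂ} : IsSymbol b ↔ MemLp (fun x => b x / (weight x : ℂ)) 2 volume :=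
  Iff.rfl

lemma IsSymbol.aestronglyMeasurable {b : Rd d → ℂ} (hb : IsSymbol b) :
    AEStronglyMeasurable b volume := by
  have h := hb.1.mul (Complex.continuous_ofReal.comp continuous_weight).aestronglyMeasurable
  refine h.congr (.of_forall fun x => ?_)
  simp only [Pi.mul_apply, Function.comp_apply]
  exact div_mul_cancel₀ _ (by exact_mod_cast (weight_pos x).ne')

/-- One factor of the damping function. -/
def dampFactor (s : ℝ) (j : Fin d) (x : Rd d) : ℂ := (1 - Complex.I * (s * x j : ℝ))⁻¹

lemma norm_dampFactor (s : ℝ) (j : Fin d) (x : Rd d) :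
    ‖dampFactor s j x‖ = (√(1 + (s * x j) ^ 2))⁻¹ := by
  unfold dampFactor
  rw [norm_inv, Complex.norm_def, Complex.normSq_apply]
  congr 2
  simp
  ring

lemma continuous_dampFactor (s : ℝ) (j : Fin d) : Continuous (dampFactor s j) := by
  unfold dampFactor
  refine Continuous.inv₀ (by fun_prop) fun x h => ?_
  have := congrArg Complex.re h
  simp at this

lemma norm_dampFactor_le (s : ℝ) (j : Fin d) (x : Rd d) : ‖dampFactor s j x‖ ≤ 1 := by
  rw [norm_dampFactor]
  exact inv_le_one_of_one_le₀ (Real.one_le_sqrt.2 (by nlinarith [sq_nonneg (s * x j)]))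

lemma isContractor_dampFactor (s : ℝ) (j : Fin d) : IsContractor (dampFactor s j) :=
  ⟨(continuous_dampFactor s j).aestronglyMeasurable, norm_dampFactor_le s j⟩

lemma inner_mulUnit {m : Rd d → ℂ} (hm : IsContractor m) (g f : L2 d) :
    inner ℂ g (mulUnit m f) = ∫ x, m x * (conj (g x) * f x) := by
  rw [L2.inner_def]
  refine integral_congr_ae ?_
  filter_upwards [mulUnit_ae hm f] with x hx
  simp [hx]; ring

/-- The Laplace transform of `e^{-t}` at imaginary argument: a superposition of characters whose
frequencies all lie on the ray in direction `s` of the `j`-th axis. -/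
lemma dampFactor_eq_integral (s : ℝ) (j : Fin d) (x : Rd d) :
    dampFactor s j x = ∫ t in Set.Ioi (0 : ℝ), (Real.exp (-t) : ℂ) *
      character (t • EuclideanSpace.single j (s / (2 * Real.pi))) x := by
  have h := integral_exp_mul_complex_Ioi (a := -(1 - Complex.I * (s * x j : ℝ))) (by simp) 0
  rw [Complex.ofReal_zero, mul_zero, Complex.exp_zero, neg_div_neg_eq, one_div] at h
  rw [dampFactor, ← h]
  congr 1; ext t
  unfold character
  rw [Real.fourierChar_apply, Complex.ofReal_exp, ← Complex.exp_add]
  congr 1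
  rw [inner_smul_right, EuclideanSpace.inner_single_right]
  simp
  field_simp
  ring

/-- The product is an average of modulations of `f` by frequencies in the closed orthant. Each of
them is orthogonal to the kernel of `P_σ`, and Fubini passes this to the average. -/
lemma Spec.dampFactor {σ : Fin d → ℤˣ} {s : ℝ} {j : Fin d} (hs : 0 ≤ ((σ j : ℤ) : ℝ) * s)
    {f : L2 d} (hf : Spec σ f) : Spec σ (mulUnit (dampFactor s j) f) := by
  rw [spec_iff_inner]
  intro g hg
  rw [inner_mulUnit (isContractor_dampFactor s j)]
  have hF : Integrable (fun x => conj (g x) * f x) volume := by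
    refine (integrable_congr ?_).1 (integrable_mul_L2 (Star.star g) f)
    filter_upwards [star_ae g] with x hx
    rw [hx]
  simp only [dampFactor_eq_integral, ← integral_mul_const]
  rw [integral_integral_swap]
  · refine integral_eq_zero_of_ae ?_
    filter_upwards [ae_restrict_mem measurableSet_Ioi] with t ht
    have h1 : Spec σ (mulUnit (character (t • EuclideanSpace.single j (s / (2 * Real.pi)))) f) := by
      refine hf.mulUnit_character fun i => ?_
      have : (0 : ℝ) < t := ht
      by_cases hij : i = j
      · subst hij
        simp only [PiLp.smul_apply, PiLp.single_apply, if_true, smul_eq_mul]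
        have : ((σ i : ℤ) : ℝ) * (t * (s / (2 * Real.pi))) =
          (((σ i : ℤ) : ℝ) * s) * (t / (2 * Real.pi)) := by ring
        rw [this]
        positivity
      · simp [hij]
    have h2 := spec_iff_inner.1 h1 g hg
    rw [inner_mulUnit (isContractor_character _)] at h2
    simp only [mul_assoc, Pi.zero_apply]
    rw [integral_const_mul, h2, mul_zero]
  · have h1 : Integrable (fun t : ℝ => (Real.exp (-t) : ℂ)) (volume.restrict (Set.Ioi 0)) :=
      (integrableOn_exp_neg_Ioi 0).ofReal
    have h2 := hF.mul_prod h1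
    have hc : Continuous (fun z : Rd d × ℝ =>
        character (z.2 • EuclideanSpace.single j (s / (2 * Real.pi))) z.1) := by
      unfold character
      exact continuous_subtype_val.comp (Real.continuous_fourierChar.comp (by fun_prop))
    refine (h2.bdd_mul (c := 1) hc.aestronglyMeasurable
      (.of_forall fun z => (norm_character _ _).le)).congr (.of_forall fun z => ?_)
    simp only [Function.uncurry]
    ring

/-- The damping function: it has modulus at most one, decays like the inverse of the weight,
and multiplication by it preserves the functions with frequencies in the orthant of `σ`. -/
def damp (σ : Fin d → ℤˣ) (δ : ℝ) (x : Rd d) : ℂ := ∏ j, dampFactor (((σ j : ℤ) : ℝ) * δ) j x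

lemma continuous_damp (σ : Fin d → ℤˣ) (δ : ℝ) : Continuous (damp σ δ) :=
  continuous_finsetProd _ fun j _ => continuous_dampFactor _ j

lemma norm_damp_le (σ : Fin d → ℤˣ) (δ : ℝ) (x : Rd d) : ‖damp σ δ x‖ ≤ 1 := by
  unfold damp
  rw [norm_prod]
  exact Finset.prod_le_one (fun _ _ => norm_nonneg _) fun j _ => norm_dampFactor_le _ j x

lemma isContractor_damp (σ : Fin d → ℤˣ) (δ : ℝ) : IsContractor (damp σ δ) :=
  ⟨(continuous_damp σ δ).aestronglyMeasurable, norm_damp_le σ δ⟩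

/-- In each coordinate `1 + x_j² ≤ δ⁻²(1 + δ²x_j²)`, because `δ ≤ 1`. -/
lemma weight_mul_norm_damp_le (σ : Fin d → ℤˣ) {δ : ℝ} (h0 : 0 < δ) (h1 : δ ≤ 1) (x : Rd d) :
    weight x * ‖damp σ δ x‖ ≤ (δ⁻¹) ^ d := by
  unfold damp weight
  rw [norm_prod, ← Finset.prod_mul_distrib]
  calc _ ≤ ∏ j : Fin d, δ⁻¹ := Finset.prod_le_prod (fun j _ => by positivity) fun j _ => ?_
    _ = _ := by simp
  rw [norm_dampFactor, ← div_eq_mul_inv, div_le_iff₀ (Real.sqrt_pos.2 (by positivity))]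
  refine Real.sqrt_le_iff.2 ⟨by positivity, ?_⟩
  rw [mul_pow, Real.sq_sqrt (by positivity)]
  have hs : (((σ j : ℤ) : ℝ) * δ * x j) ^ 2 = δ ^ 2 * x j ^ 2 := by
    rcases Int.units_eq_one_or (σ j) with p | p <;> simp [p] <;> ring
  rw [hs, mul_add, inv_pow, ← mul_assoc, inv_mul_cancel₀ (by positivity), mul_one, one_mul]
  have : 1 ≤ (δ ^ 2)⁻¹ := (one_le_inv₀ (by positivity)).2 (by nlinarith)
  linarith

lemma tendsto_damp (σ : Fin d → ℤˣ) (x : Rd d) {u : ℕ → ℝ} (hu : Filter.Tendsto u Filter.atTop (nhds 0)) :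
    Filter.Tendsto (fun n => damp σ (u n) x) Filter.atTop (nhds 1) := by
  have : Continuous (fun δ : ℝ => damp σ δ x) := by
    unfold damp dampFactor
    refine continuous_finsetProd _ fun j _ => Continuous.inv₀ (by fun_prop) fun δ h => ?_
    have := congrArg Complex.re h
    simp at this
  have h2 := (this.tendsto 0).comp hu
  simpa [damp, dampFactor, Function.comp_def] using h2

lemma Spec.damp {σ : Fin d → ℤˣ} {δ : ℝ} (hδ : 0 ≤ δ) {f : L2 d} (hf : Spec σ f) :
    Spec σ (mulUnit (damp σ δ) f) := by
  have key : ∀ s : Finset (Fin d), ∃ g : L2 d, Spec σ g ∧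
      ∀ᵐ x, g x = (∏ j ∈ s, Polydisk.dampFactor (((σ j : ℤ) : ℝ) * δ) j x) * f x := by
    intro s
    induction s using Finset.induction_on with
    | empty => exact ⟨f, hf, by simp⟩
    | insert a s ha ih =>
      obtain ⟨g, hg, hgf⟩ := ih
      refine ⟨_, hg.dampFactor (s := ((σ a : ℤ) : ℝ) * δ) (j := a) ?_, ?_⟩
      · rcases Int.units_eq_one_or (σ a) with p | p <;> simpa [p] using hδ
      · filter_upwards [hgf, mulUnit_ae (isContractor_dampFactor (((σ a : ℤ) : ℝ) * δ) a) g]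
          with x h1 h2
        rw [h2, h1, Finset.prod_insert ha, mul_assoc]
  obtain ⟨g, hg, hgf⟩ := key Finset.univ
  have : mulUnit (Polydisk.damp σ δ) f = g := by
    refine L2.ext_ae ?_
    filter_upwards [hgf, mulUnit_ae (isContractor_damp σ δ) f] with x h1 h2
    rw [h1, h2]; rfl
  rw [this]; exact hg

/-! ### Convergence in `L²` -/

lemma L2.norm_sq_eq (f : L2 d) : ‖f‖ ^ 2 = ∫ x, ‖f x‖ ^ 2 := by
  have h : (inner ℂ f f : ℂ) = ∫ x, ((‖f x‖ ^ 2 : ℝ) : ℂ) := by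
    rw [L2.inner_def]
    refine integral_congr_ae (.of_forall fun x => ?_)
    simp only [inner_self_eq_norm_sq_to_K]
    norm_cast
  rw [inner_self_eq_norm_sq_to_K] at h
  have h2 : ((∫ x, ‖f x‖ ^ 2 : ℝ) : ℂ) = ∫ x, ((‖f x‖ ^ 2 : ℝ) : ℂ) := integral_complex_ofReal.symm
  rw [← h2] at h
  exact Complex.ofReal_injective (by rw [← h]; push_cast; rfl)

lemma integrable_norm_sq {f : Rd d → ℂ} (hf : MemLp f 2 volume) :
    Integrable (fun x => ‖f x‖ ^ 2) volume :=
  (memLp_two_iff_integrable_sq_norm hf.1).1 hf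

lemma tendsto_L2_of_dominated {F : ℕ → L2 d} {f : L2 d} {g : Rd d → ℂ} (hg : MemLp g 2 volume)
    (hb : ∀ n, ∀ᵐ x, ‖F n x‖ ≤ ‖g x‖)
    (hl : ∀ᵐ x, Filter.Tendsto (fun n => F n x) Filter.atTop (nhds (f x))) :
    Filter.Tendsto F Filter.atTop (nhds f) := by
  rw [tendsto_iff_norm_sub_tendsto_zero]
  have h1 : Filter.Tendsto (fun n => ∫ x, ‖F n x - f x‖ ^ 2) Filter.atTop
      (nhds (∫ _ : Rd d, (0 : ℝ))) := by
    -- The limit is also dominated by `g`, so the difference is at most `2‖g‖`.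
    refine tendsto_integral_of_dominated_convergence (fun x => 4 * ‖g x‖ ^ 2)
      (fun n => ((Lp.aestronglyMeasurable _).sub (Lp.aestronglyMeasurable _)).norm.pow 2)
      ((integrable_norm_sq hg).const_mul 4) (fun n => ?_) ?_
    · filter_upwards [hl, ae_all_iff.2 hb] with x h1 h2
      have h3 : ‖f x‖ ≤ ‖g x‖ := le_of_tendsto h1.norm (.of_forall fun n => h2 n)
      have h4 : ‖F n x - f x‖ ≤ 2 * ‖g x‖ := (norm_sub_le _ _).trans (by linarith [h2 n])
      rw [Real.norm_of_nonneg (by positivity)]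
      nlinarith [norm_nonneg (F n x - f x)]
    · filter_upwards [hl] with x h1
      simpa using ((h1.sub_const (f x)).norm.pow 2)
  have h2 : ∀ n, ‖F n - f‖ = √(∫ x, ‖F n x - f x‖ ^ 2) := fun n => by
    rw [← Real.sqrt_sq (norm_nonneg _), L2.norm_sq_eq]
    congr 1
    refine integral_congr_ae ?_
    filter_upwards [Lp.coeFn_sub (F n) f] with x hx
    rw [hx, Pi.sub_apply]
  simp only [h2]
  simpa [Function.comp_def] using (Real.continuous_sqrt.tendsto _).comp h1

/-- A null sequence in `(0, 1]`. -/
def scale (n : ℕ) : ℝ := 1 / ((n : ℝ) + 1)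

lemma scale_pos (n : ℕ) : 0 < scale n := Nat.one_div_pos_of_nat

lemma scale_le_one (n : ℕ) : scale n ≤ 1 := by
  rw [scale, div_le_one (by positivity)]; simp

lemma tendsto_scale : Filter.Tendsto scale Filter.atTop (nhds 0) :=
  tendsto_one_div_add_atTop_nhds_zero_nat

lemma tendsto_mulUnit_damp (σ : Fin d → ℤˣ) (f : L2 d) :
    Filter.Tendsto (fun n => mulUnit (damp σ (scale n)) f) Filter.atTop (nhds f) := by
  have h := ae_all_iff.2 fun n => mulUnit_ae (isContractor_damp σ (scale n)) f
  refine tendsto_L2_of_dominated (Lp.memLp f) (fun n => ?_) ?_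
  · filter_upwards [h] with x hx
    rw [hx, norm_mul]
    exact mul_le_of_le_one_left (norm_nonneg _) (norm_damp_le _ _ x)
  · filter_upwards [h] with x hx
    simp only [hx]
    simpa using (tendsto_damp σ x tendsto_scale).mul_const (f x)

/-! ### Density of bounded functions with decay -/

lemma fourierL2_symm_eq_schwartz (g : SchwartzMap (Rd d) ℂ) :
    fourierL2.symm (g.toLp 2 volume) =
      reflect (LinearIsometryEquiv.neg ℝ) (fourierL2 (g.toLp 2 volume)) := by
  have h1 : fourierL2.symm (g.toLp 2 volume) = (𝓕⁻ g).toLp 2 volume := SchwartzMap.toLp_fourierInv_eq g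
  have h2 : fourierL2 (g.toLp 2 volume) = (𝓕 g).toLp 2 volume := SchwartzMap.toLp_fourier_eq g
  have q := (LinearIsometryEquiv.neg ℝ (E := Rd d)).measurePreserving.quasiMeasurePreserving
  rw [h1, h2]
  refine L2.ext_ae ?_
  filter_upwards [reflect_ae (LinearIsometryEquiv.neg ℝ) ((𝓕 g).toLp 2 volume),
    (𝓕⁻ g).coeFn_toLp 2 volume, q.ae ((𝓕 g).coeFn_toLp 2 volume)] with x h3 h4 h5
  rw [h3, h4, h5, SchwartzMap.fourier_coe, SchwartzMap.fourierInv_coe,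
    Real.fourierInv_eq_fourier_neg]
  rfl

lemma fourierL2_symm_eq (f : L2 d) :
    fourierL2.symm f = reflect (LinearIsometryEquiv.neg ℝ) (fourierL2 f) :=
  DenseRange.induction_on
    (p := fun f => fourierL2.symm f = reflect (LinearIsometryEquiv.neg ℝ) (fourierL2 f))
    (SchwartzMap.denseRange_toLpCLM (p := 2) ENNReal.ofNat_ne_top) f
    (isClosed_eq fourierL2.symm.continuous ((continuous_reflect _).comp fourierL2.continuous))
    fourierL2_symm_eq_schwartz

lemma fourierL2_symm_bound {f : L2 d} (hf : Integrable f volume) :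
    ∀ᵐ x, ‖fourierL2.symm f x‖ ≤ ∫ ξ, ‖f ξ‖ := by
  have q := (LinearIsometryEquiv.neg ℝ (E := Rd d)).measurePreserving.quasiMeasurePreserving
  rw [fourierL2_symm_eq]
  filter_upwards [reflect_ae (LinearIsometryEquiv.neg ℝ) (fourierL2 f), q.ae (fourierL2_ae_eq hf)]
    with x h1 h2
  rw [h1, h2]
  exact VectorFourier.norm_fourierIntegral_le_integral_norm _ _ _ _ _

/-- Pointwise decay like the inverse of the weight. -/
def Nice (f : L2 d) : Prop := ∃ M : ℝ, ∀ᵐ x, weight x * ‖f x‖ ≤ M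

lemma nice_mulUnit_damp (σ : Fin d → ℤˣ) {δ : ℝ} (h0 : 0 < δ) (h1 : δ ≤ 1) {f : L2 d} {M : ℝ}
    (hf : ∀ᵐ x, ‖f x‖ ≤ M) : Nice (mulUnit (damp σ δ) f) := by
  refine ⟨(δ⁻¹) ^ d * M, ?_⟩
  filter_upwards [mulUnit_ae (isContractor_damp σ δ) f, hf] with x h2 h3
  rw [h2, norm_mul, ← mul_assoc]
  exact mul_le_mul (weight_mul_norm_damp_le σ h0 h1 x) h3 (norm_nonneg _) (by positivity)

/-- Truncating the spectrum to a large ball respects the orthant, and leaves a transform that is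
square integrable on a set of finite measure. It is then integrable, so the truncated function is
bounded. -/
lemma exists_bounded_spec_near {σ : Fin d → ℤˣ} {f : L2 d} (hf : Spec σ f) {ε : ℝ} (hε : 0 < ε) :
    ∃ g : L2 d, Spec σ g ∧ (∃ M : ℝ, ∀ᵐ x, ‖g x‖ ≤ M) ∧ ‖f - g‖ < ε := by
  set B : ℕ → Set (Rd d) := fun n => Metric.ball 0 n with hB
  have hBm : ∀ n, MeasurableSet (B n) := fun n => measurableSet_ball
  have h1 : Filter.Tendsto (fun n => freqProj (B n) (hBm n) f) Filter.atTop (nhds f) := by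
    have : Filter.Tendsto (fun n => restrictTo (B n) (hBm n) (fourierL2 f)) Filter.atTop
        (nhds (fourierL2 f)) := by
      have h := ae_all_iff.2 fun n => restrictTo_ae (B n) (hBm n) (fourierL2 f)
      refine tendsto_L2_of_dominated (Lp.memLp (fourierL2 f)) (fun n => ?_) ?_
      · filter_upwards [h] with x hx
        rw [hx]
        exact norm_indicator_le_norm_self _ _
      · filter_upwards [h] with x hx
        obtain ⟨N, hN⟩ := exists_nat_gt ‖x‖
        refine tendsto_const_nhds.congr' ?_
        filter_upwards [Filter.eventually_ge_atTop N] with n hn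
        rw [hx, Set.indicator_of_mem]
        simp only [hB, mem_ball_zero_iff]
        exact hN.trans_le (by exact_mod_cast hn)
    simpa [freqProj, Function.comp_def] using (fourierL2.symm.continuous.tendsto _).comp this
  obtain ⟨n, hn⟩ := ((Metric.tendsto_nhds.1 h1) ε hε).exists
  refine ⟨freqProj (B n) (hBm n) f, ?_, ⟨_, fourierL2_symm_bound ?_⟩, ?_⟩
  · rw [spec_iff] at hf ⊢
    filter_upwards [hf, fourierL2_freqProj_ae (hS := hBm n) f] with ξ h2 h3 h4
    rw [h3]
    by_cases h5 : ξ ∈ B n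
    · rw [Set.indicator_of_mem h5, h2 h4]
    · rw [Set.indicator_of_notMem h5]
  · refine (integrable_congr (restrictTo_ae (B n) (hBm n) (fourierL2 f))).2 ?_
    rw [integrable_indicator_iff (hBm n)]
    have : IsFiniteMeasure (volume.restrict (B n)) := ⟨by simpa using measure_ball_lt_top⟩
    exact ((Lp.memLp (fourierL2 f)).restrict _).integrable (by norm_num)
  · rwa [← dist_eq_norm, dist_comm]

/-- A bounded function acquires the decay of the inverse weight when multiplied by `damp`, without
leaving the orthant. -/
lemma exists_nice_spec_near {σ : Fin d → ℤˣ} {f : L2 d} (hf : Spec σ f) {ε : ℝ} (hε : 0 < ε) :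
    ∃ g : L2 d, Spec σ g ∧ Nice g ∧ ‖f - g‖ < ε := by
  obtain ⟨g, h1, ⟨M, hM⟩, h2⟩ := exists_bounded_spec_near hf (half_pos hε)
  obtain ⟨n, hn⟩ := ((Metric.tendsto_nhds.1 (tendsto_mulUnit_damp σ g)) (ε / 2) (half_pos hε)).exists
  refine ⟨_, h1.damp (scale_pos n).le, nice_mulUnit_damp σ (scale_pos n) (scale_le_one n) hM, ?_⟩
  rw [dist_comm, dist_eq_norm] at hn
  calc ‖f - mulUnit (damp σ (scale n)) g‖ = ‖(f - g) + (g - mulUnit (damp σ (scale n)) g)‖ := by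
        congr 1; abel
    _ ≤ _ := norm_add_le _ _
    _ < ε := by linarith

/-- A continuous inequality on the functions with frequencies in an orthant may be checked on
those with decay. -/
lemma le_of_forall_nice {σ : Fin d → ℤˣ} {u v : L2 d → ℝ} (hu : Continuous u) (hv : Continuous v)
    (h : ∀ ψ, Spec σ ψ → Nice ψ → u ψ ≤ v ψ) {f : L2 d} (hf : Spec σ f) : u f ≤ v f := by
  have hmem : f ∈ closure {ψ : L2 d | Spec σ ψ ∧ Nice ψ} := by
    rw [Metric.mem_closure_iff]
    intro ε hε
    obtain ⟨g, h1, h2, h3⟩ := exists_nice_spec_near hf hε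
    exact ⟨g, ⟨h1, h2⟩, by rwa [dist_eq_norm]⟩
  exact closure_minimal (fun ψ hψ => h ψ hψ.1 hψ.2) (isClosed_le hu hv) hmem

/-! ### Weighted test functions -/

/-- Its square is the product of the one-variable integrable functions `(1 + t²)⁻¹`. -/
lemma memLp_inv_weight : MemLp (fun x : Rd d => (((weight x)⁻¹ : ℝ) : ℂ)) 2 volume := by
  have hc : Continuous (fun x : Rd d => (((weight x)⁻¹ : ℝ) : ℂ)) :=
    Complex.continuous_ofReal.comp (continuous_weight.inv₀ fun x => (weight_pos x).ne')
  rw [memLp_two_iff_integrable_sq_norm hc.aestronglyMeasurable]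
  have h1 : Integrable (fun y : Fin d → ℝ => ∏ j, (1 + y j ^ 2)⁻¹) volume :=
    Integrable.fintype_prod (f := fun _ t => (1 + t ^ 2)⁻¹) fun _ => integrable_inv_one_add_sq
  have h2 := (EuclideanSpace.volume_preserving_symm_measurableEquiv_toLp (Fin d)).integrable_comp_emb
    (MeasurableEquiv.measurableEmbedding _) |>.2 h1
  refine h2.congr (.of_forall fun x => ?_)
  simp only [Function.comp_apply, Complex.norm_real, norm_inv, Real.norm_eq_abs, inv_pow, sq_abs]
  unfold weight
  rw [← Finset.prod_pow, Finset.prod_inv_distrib]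
  congr 1
  refine Finset.prod_congr rfl fun j _ => ?_
  rw [Real.sq_sqrt (by positivity)]
  rfl

/-- The functions with frequencies in the orthant of `σ` that are square integrable against the
square of the weight. Every symbol pairs with them. -/
def InE (σ : Fin d → ℤˣ) (g : L2 d) : Prop :=
  Spec σ g ∧ MemLp (fun x => (weight x : ℂ) * g x) 2 volume

lemma weight_ne_zero (x : Rd d) : (weight x : ℂ) ≠ 0 := by exact_mod_cast (weight_pos x).ne'

lemma integrable_of_weight {g : Rd d → ℂ} (hg : MemLp (fun x => (weight x : ℂ) * g x) 2 volume) :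
    Integrable g volume := by
  refine (hg.integrable_mul memLp_inv_weight).congr (.of_forall fun x => ?_)
  have := weight_ne_zero x
  simp only [Pi.mul_apply, Complex.ofReal_inv]
  field_simp

lemma conj_memLp {f : Rd d → ℂ} {p : ℝ≥0∞} (hf : MemLp f p volume) :
    MemLp (fun x => conj (f x)) p volume :=
  hf.of_le (Complex.continuous_conj.comp_aestronglyMeasurable hf.1) (.of_forall fun x => by simp)

lemma IsSymbol.integrable_mul_conj {b g : Rd d → ℂ} (hb : IsSymbol b)
    (hg : MemLp (fun x => (weight x : ℂ) * g x) 2 volume) :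
    Integrable (fun x => b x * conj (g x)) volume := by
  refine ((isSymbol_iff.1 hb).integrable_mul (conj_memLp hg)).congr (.of_forall fun x => ?_)
  have := weight_ne_zero x
  simp only [Pi.mul_apply, map_mul, Complex.conj_ofReal]
  field_simp

lemma memLp_weight_mul_damp (σ : Fin d → ℤˣ) {δ : ℝ} (h0 : 0 < δ) (h1 : δ ≤ 1) {f : Rd d → ℂ}
    (hf : MemLp f 2 volume) : MemLp (fun x => (weight x : ℂ) * (damp σ δ x * f x)) 2 volume := by
  have h : MemLp (fun x => ((weight x : ℂ) * damp σ δ x) * f x) 2 volume := by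
    refine memLp_two_mul_of_le (C := (δ⁻¹) ^ d)
      ((Complex.continuous_ofReal.comp continuous_weight).mul (continuous_damp σ δ)).aestronglyMeasurable
      (.of_forall fun x => ?_) hf
    rw [norm_mul, Complex.norm_real, Real.norm_of_nonneg (weight_pos x).le]
    exact weight_mul_norm_damp_le σ h0 h1 x
  simpa only [mul_assoc] using h

lemma Spec.inE_damp {σ : Fin d → ℤˣ} {δ : ℝ} (h0 : 0 < δ) (h1 : δ ≤ 1) {f : L2 d}
    (hf : Spec σ f) : InE σ (mulUnit (Polydisk.damp σ δ) f) := by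
  refine ⟨hf.damp h0.le, (memLp_weight_mul_damp σ h0 h1 (Lp.memLp f)).ae_eq ?_⟩
  filter_upwards [mulUnit_ae (isContractor_damp σ δ) f] with x hx
  rw [hx]

/-- The product of a function in a Hardy space with one with decay is a weighted test function. -/
lemma exists_inE_mul {σ : Fin d → ℤˣ} {φ ψ : L2 d} (hφ : Spec σ φ) (hψ : Spec σ ψ) (hn : Nice ψ) :
    ∃ g : L2 d, InE σ g ∧ ∀ᵐ x, g x = φ x * ψ x := by
  obtain ⟨M, hM⟩ := hn
  have hw : MemLp (fun x => ((weight x : ℂ) * ψ x) * φ x) 2 volume := by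
    refine memLp_two_mul_of_le (C := M)
      ((Complex.continuous_ofReal.comp continuous_weight).aestronglyMeasurable.mul
        (Lp.aestronglyMeasurable ψ)) ?_ (Lp.memLp φ)
    filter_upwards [hM] with x hx
    rwa [norm_mul, Complex.norm_real, Real.norm_of_nonneg (weight_pos x).le]
  have h2 : MemLp (fun x => φ x * ψ x) 2 volume := by
    refine hw.of_le ((Lp.aestronglyMeasurable φ).mul (Lp.aestronglyMeasurable ψ))
      (.of_forall fun x => ?_)
    rw [norm_mul, norm_mul, norm_mul, Complex.norm_real, Real.norm_of_nonneg (weight_pos x).le]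
    have := mul_le_mul_of_nonneg_right (one_le_weight x) (mul_nonneg (norm_nonneg (ψ x)) (norm_nonneg (φ x)))
    linarith
  have h3 := h2.coeFn_toLp
  refine ⟨h2.toLp _, ⟨?_, hw.ae_eq ?_⟩, h3⟩
  · rw [spec_iff_hardySign ((integrable_congr h3).2 (integrable_mul_L2 φ ψ))]
    exact (hφ.mul hψ).congr (h3.mono fun x hx => hx.symm)
  · filter_upwards [h3] with x hx
    rw [hx]; ring

lemma integral_norm_mul_le (φ ψ : L2 d) : ∫ x, ‖φ x * ψ x‖ ≤ ‖φ‖ * ‖ψ‖ := by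
  have h := integral_mul_norm_le_Lp_mul_Lq (μ := (volume : Measure (Rd d))) (f := φ) (g := ψ)
    Real.HolderConjugate.two_two (by simpa using Lp.memLp φ) (by simpa using Lp.memLp ψ)
  simp only [norm_mul]
  refine h.trans (le_of_eq ?_)
  have : ∀ f : L2 d, (∫ x, ‖f x‖ ^ (2 : ℝ)) ^ (1 / (2 : ℝ)) = ‖f‖ := fun f => by
    simp only [Real.rpow_two]
    rw [← L2.norm_sq_eq, ← Real.sqrt_eq_rpow, Real.sqrt_sq (norm_nonneg _)]
  rw [this, this]

/-! ### Bounds for the pairing and for the Hankel form of a symbol -/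

/-- The functional of `b` on the weighted test functions is bounded by `A` in the `L¹` norm. -/
def BddE (σ : Fin d → ℤˣ) (b : Rd d → ℂ) (A : ℝ≥0) : Prop :=
  ∀ g, InE σ g → ‖pairing b g‖ ≤ A * ∫ x, ‖g x‖

/-- The Hankel form of `b` is bounded by `A`. -/
def BddH (σ : Fin d → ℤˣ) (b : Rd d → ℂ) (A : ℝ≥0) : Prop :=
  ∀ φ ψ : L2 d, Spec σ φ → Spec σ ψ → Nice ψ → ‖∫ x, b x * conj (φ x * ψ x)‖ ≤ A * (‖φ‖ * ‖ψ‖)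

lemma pairing_congr {b : Rd d → ℂ} {g : L2 d} {h : Rd d → ℂ} (hg : ∀ᵐ x, g x = h x) :
    pairing b g = ∫ x, b x * conj (h x) :=
  integral_congr_ae (hg.mono fun x hx => by simp only [hx])

variable {σ : Fin d → ℤˣ} {b : Rd d → ℂ} {A : ℝ≥0}

/-- The product `φψ` is a weighted test function with `L¹` norm at most `‖φ‖‖ψ‖`. This is the
direction that holds with no estimate assumed. -/
lemma BddE.bddH (h : BddE σ b A) : BddH σ b A := by
  intro φ ψ hφ hψ hn
  obtain ⟨g, hg, hgf⟩ := exists_inE_mul hφ hψ hn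
  rw [← pairing_congr hgf]
  refine (h g hg).trans ?_
  have : ∫ x, ‖g x‖ = ∫ x, ‖φ x * ψ x‖ := integral_congr_ae (hgf.mono fun x hx => by simp only [hx])
  rw [this]
  exact mul_le_mul_of_nonneg_left (integral_norm_mul_le φ ψ) A.2

lemma tendsto_pairing_damp {f : Rd d → ℂ} (hfb : Integrable (fun x => b x * conj (f x)) volume) :
    Filter.Tendsto (fun n => ∫ x, b x * conj (damp σ (scale n) x * f x)) Filter.atTop
      (nhds (∫ x, b x * conj (f x))) := by
  have hrw : ∀ n x, b x * conj (damp σ (scale n) x * f x) =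
      conj (damp σ (scale n) x) * (b x * conj (f x)) := fun n x => by rw [map_mul]; ring
  simp only [hrw]
  refine tendsto_integral_of_dominated_convergence (fun x => ‖b x * conj (f x)‖)
    (fun n => ((Complex.continuous_conj.comp (continuous_damp σ (scale n))).aestronglyMeasurable).mul
      hfb.1) hfb.norm (fun n => .of_forall fun x => ?_) (.of_forall fun x => ?_)
  · rw [norm_mul, RCLike.norm_conj]
    exact mul_le_of_le_one_left (norm_nonneg _) (norm_damp_le _ _ x)
  · simpa using (((Complex.continuous_conj.tendsto _).comp (tendsto_damp σ x tendsto_scale)).mul_const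
      (b x * conj (f x)))

/-- Damping moves `f` into the weighted class without increasing its `L¹` norm, and the damped
pairings converge by dominated convergence. Hence the weighted class already determines the norm
over the larger domains that define BMO. -/
lemma BddE.of_integrable (h : BddE σ b A) {f : L2 d} (hf : Spec σ f) (hfi : Integrable f volume)
    (hfb : Integrable (fun x => b x * conj (f x)) volume) : ‖pairing b f‖ ≤ A * ∫ x, ‖f x‖ := by
  refine le_of_tendsto (tendsto_pairing_damp (σ := σ) hfb).norm (.of_forall fun n => ?_)
  have hm := mulUnit_ae (isContractor_damp σ (scale n)) f
  rw [← pairing_congr hm]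
  refine (h _ (hf.inE_damp (scale_pos n) (scale_le_one n))).trans ?_
  refine mul_le_mul_of_nonneg_left (integral_mono_ae ?_ hfi.norm ?_) A.2
  · exact (integrable_of_weight (hf.inE_damp (scale_pos n) (scale_le_one n)).2).norm
  · filter_upwards [hm] with x hx
    rw [hx, norm_mul]
    exact mul_le_of_le_one_left (norm_nonneg _) (norm_damp_le _ _ x)

lemma inner_toLp_mul_conj (φ ψ : L2 d) {b : Rd d → ℂ}
    (h : MemLp (fun x => b x * conj (φ x)) 2 volume) :
    inner ℂ ψ (h.toLp _) = ∫ x, b x * conj (φ x * ψ x) := by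
  rw [L2.inner_def]
  refine integral_congr_ae ?_
  filter_upwards [h.coeFn_toLp] with x hx
  rw [hx]
  simp; ring

lemma inner_proj_right_of_spec {ψ : L2 d} (hψ : Spec σ ψ) (f : L2 d) :
    inner ℂ ψ (proj σ f) = inner ℂ ψ f := by
  unfold proj
  rw [← inner_freqProj_left]
  change inner ℂ (proj σ ψ) f = _
  rw [hψ]

/-- The decay of `ψ` cancels the weight of the symbol, so such functions lie in the domain of every
Hankel operator. -/
lemma memLp_mul_conj_of_nice (hb : IsSymbol b) {ψ : L2 d} (hn : Nice ψ) :
    MemLp (fun x => b x * conj (ψ x)) 2 volume := by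
  obtain ⟨M, hM⟩ := hn
  have h : MemLp (fun x => ((weight x : ℂ) * conj (ψ x)) * (b x / (weight x : ℂ))) 2 volume := by
    refine memLp_two_mul_of_le (C := M)
      ((Complex.continuous_ofReal.comp continuous_weight).aestronglyMeasurable.mul
        (conj_memLp (Lp.memLp ψ)).1) ?_ (isSymbol_iff.1 hb)
    filter_upwards [hM] with x hx
    rwa [norm_mul, RCLike.norm_conj, Complex.norm_real, Real.norm_of_nonneg (weight_pos x).le]
  refine h.ae_eq (.of_forall fun x => ?_)
  have := weight_ne_zero x
  simp only
  field_simp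

/-- The Hankel form is bounded by `A` iff the Hankel operator is. -/
lemma bddH_iff (hb : IsSymbol b) : BddH σ b A ↔ ∀ φ : L2 d, Spec σ φ →
    ∀ h : MemLp (fun x => b x * conj (φ x)) 2 volume, ‖proj σ (h.toLp _)‖ ≤ A * ‖φ‖ := by
  constructor
  · intro H φ hφ h
    set v := proj σ (h.toLp _) with hv
    -- Since `v` is in `L²`, both sides are continuous in `ψ` and functions with decay suffice.
    -- Afterwards `ψ = v` gives the norm of `v`.
    have h1 : ∀ ψ : L2 d, Spec σ ψ → ‖(inner ℂ ψ v : ℂ)‖ ≤ A * ‖φ‖ * ‖ψ‖ := by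
      intro ψ hψ
      refine le_of_forall_nice (σ := σ) (u := fun ψ => ‖(inner ℂ ψ v : ℂ)‖)
        (v := fun ψ => A * ‖φ‖ * ‖ψ‖) (by fun_prop) (by fun_prop) (fun ψ hψ hn => ?_) hψ
      rw [hv, inner_proj_right_of_spec hψ, inner_toLp_mul_conj]
      exact (H φ ψ hφ hψ hn).trans (by rw [mul_assoc])
    have h2 := h1 v (spec_proj σ _)
    rw [inner_self_eq_norm_sq_to_K] at h2
    simp only [norm_pow, Complex.coe_algebraMap, Complex.norm_real, norm_norm] at h2
    rcases eq_or_lt_of_le (norm_nonneg v) with h0 | h0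
    · rw [← h0]; positivity
    · rw [sq] at h2
      exact le_of_mul_le_mul_right h2 h0
  · intro H φ ψ hφ hψ hn
    have h := memLp_mul_conj_of_nice hb hn
    -- The form is symmetric: the operator is applied to the factor with decay, which is certainly
    -- in its domain.
    have h1 : ∫ x, b x * conj (φ x * ψ x) = inner ℂ φ (proj σ (h.toLp _)) := by
      rw [inner_proj_right_of_spec hφ, inner_toLp_mul_conj]
      simp only [mul_comm]
    rw [h1]
    refine (norm_inner_le_norm _ _).trans ?_
    have := mul_le_mul_of_nonneg_left (H ψ hψ h) (norm_nonneg φ)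
    linarith

/-! ### The Hankel operator -/

section

variable {b : Rd d → ℂ} {A : ℝ≥0} {σ : Fin d → ℤˣ}

lemma mulOp_app_ae {φ : L2 d} (h : φ ∈ (mulOp b).dom) :
    ∀ᵐ x, (mulOp b).app φ x = b x * φ x := by
  have h' : MemLp (fun x => b x * φ x) 2 volume := h
  simp only [mulOp, dif_pos h']
  exact h'.coeFn_toLp

lemma memLp_conj_of_star_mem {φ : L2 d} (h : star φ ∈ (mulOp b).dom) :
    MemLp (fun x => b x * conj (φ x)) 2 volume :=
  MemLp.ae_eq (by filter_upwards [star_ae φ] with x hx; rw [hx]) h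

lemma star_mem_of_memLp_conj {φ : L2 d} (h : MemLp (fun x => b x * conj (φ x)) 2 volume) :
    star φ ∈ (mulOp b).dom :=
  MemLp.ae_eq (by filter_upwards [star_ae φ] with x hx; rw [hx]) h

lemma mulOp_app_star {φ : L2 d} (h : MemLp (fun x => b x * conj (φ x)) 2 volume) :
    (mulOp b).app (star φ) = h.toLp _ := by
  refine L2.ext_ae ?_
  filter_upwards [mulOp_app_ae (star_mem_of_memLp_conj h), h.coeFn_toLp, star_ae φ] with x h1 h2 h3
  rw [h1, h2, h3]

lemma mulOp_dom_smul (c : ℂ) {φ : L2 d} (h : φ ∈ (mulOp b).dom) : c • φ ∈ (mulOp b).dom := by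
  refine MemLp.ae_eq ?_ (MemLp.const_smul (show MemLp (fun x => b x * φ x) 2 volume from h) c)
  filter_upwards [Lp.coeFn_smul c φ] with x hx
  rw [hx]
  simp only [Pi.smul_apply, smul_eq_mul]; ring

lemma mulOp_dom_add {φ ψ : L2 d} (h : φ ∈ (mulOp b).dom) (h' : ψ ∈ (mulOp b).dom) :
    φ + ψ ∈ (mulOp b).dom := by
  refine MemLp.ae_eq ?_ (MemLp.add (show MemLp (fun x => b x * φ x) 2 volume from h)
    (show MemLp (fun x => b x * ψ x) 2 volume from h'))
  filter_upwards [Lp.coeFn_add φ ψ] with x hx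
  rw [hx]
  simp only [Pi.add_apply]; ring

lemma mulOp_app_add {φ ψ : L2 d} (h : φ ∈ (mulOp b).dom) (h' : ψ ∈ (mulOp b).dom) :
    (mulOp b).app (φ + ψ) = (mulOp b).app φ + (mulOp b).app ψ := by
  refine L2.ext_ae ?_
  filter_upwards [mulOp_app_ae h, mulOp_app_ae h', mulOp_app_ae (mulOp_dom_add h h'),
    Lp.coeFn_add φ ψ, Lp.coeFn_add ((mulOp b).app φ) ((mulOp b).app ψ)] with x h1 h2 h3 h4 h5
  rw [h3, h5, Pi.add_apply, h1, h2, h4, Pi.add_apply, mul_add]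

lemma mulOp_app_smul (c : ℂ) {φ : L2 d} (h : φ ∈ (mulOp b).dom) :
    (mulOp b).app (c • φ) = c • (mulOp b).app φ := by
  refine L2.ext_ae ?_
  filter_upwards [mulOp_app_ae h, mulOp_app_ae (mulOp_dom_smul c h),
    Lp.coeFn_smul c φ, Lp.coeFn_smul c ((mulOp b).app φ)] with x h1 h3 h4 h5
  rw [h3, h5, Pi.smul_apply, h1, h4, Pi.smul_apply]
  simp only [smul_eq_mul]; ring

/-- For a homogeneous operator, the operator norm bounds the operator. -/
lemma PartialOp.norm_app_le {T : PartialOp d} (hA : T.opNorm ≤ A)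
    (hdom : ∀ (c : ℂ) {φ : L2 d}, φ ∈ T.dom → c • φ ∈ T.dom)
    (happ : ∀ (c : ℂ) {φ : L2 d}, φ ∈ T.dom → T.app (c • φ) = c • T.app φ ∨
      T.app (c • φ) = conj c • T.app φ)
    {φ : L2 d} (hφ : φ ∈ T.dom) : ‖T.app φ‖ ≤ A * ‖φ‖ := by
  rcases eq_or_lt_of_le (norm_nonneg φ) with h0 | h0
  · have h1 : φ = (0 : ℂ) • φ := by rw [zero_smul]; exact norm_eq_zero.1 h0.symm
    have h2 : T.app φ = 0 := by
      rw [h1]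
      -- Both kinds of homogeneity are needed: the commutator is linear, the Hankel operator
      -- conjugate linear.
      rcases happ 0 hφ with h | h <;> rw [h] <;> simp
    rw [h2, norm_zero]; positivity
  · have h1 := hdom ((‖φ‖⁻¹ : ℝ) : ℂ) hφ
    have h2 : ‖((‖φ‖⁻¹ : ℝ) : ℂ) • φ‖ ≤ 1 := by
      rw [norm_smul, Complex.norm_real, norm_inv, norm_norm, inv_mul_cancel₀ h0.ne']
    have h3 : ‖T.app (((‖φ‖⁻¹ : ℝ) : ℂ) • φ)‖ₑ ≤ A :=
      (le_iSup₂_of_le (f := fun φ (_ : φ ∈ T.dom) => ⨆ _ : ‖φ‖ ≤ 1, ‖T.app φ‖ₑ) _ h1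
      (le_iSup (fun _ : ‖((‖φ‖⁻¹ : ℝ) : ℂ) • φ‖ ≤ 1 => ‖T.app (((‖φ‖⁻¹ : ℝ) : ℂ) • φ)‖ₑ) h2)).trans hA
    rw [enorm_le_coe] at h3
    have h4 : ‖T.app (((‖φ‖⁻¹ : ℝ) : ℂ) • φ)‖ = ‖φ‖⁻¹ * ‖T.app φ‖ := by
      rcases happ ((‖φ‖⁻¹ : ℝ) : ℂ) hφ with h | h <;> rw [h, norm_smul]
      · rw [Complex.norm_real, norm_inv, norm_norm]
      · rw [RCLike.norm_conj, Complex.norm_real, norm_inv, norm_norm]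
    have h5 : ‖φ‖⁻¹ * ‖T.app φ‖ ≤ A := by rw [← h4]; exact_mod_cast h3
    rwa [inv_mul_le_iff₀ h0, mul_comm] at h5

lemma PartialOp.opNorm_le {T : PartialOp d} (h : ∀ φ ∈ T.dom, ‖T.app φ‖ ≤ A * ‖φ‖) :
    T.opNorm ≤ A := by
  refine iSup₂_le fun φ hφ => iSup_le fun h1 => ?_
  rw [enorm_le_coe]
  have := (h φ hφ).trans (mul_le_of_le_one_right A.2 h1)
  exact_mod_cast this

lemma star_smul_L2 (c : ℂ) (f : L2 d) : (star (c • f) : L2 d) = conj c • star f := by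
  refine L2.ext_ae ?_
  filter_upwards [star_ae f, star_ae (c • f), Lp.coeFn_smul c f, Lp.coeFn_smul (conj c) (star f)]
    with x h1 h2 h3 h4
  rw [h2, h4, h3, Pi.smul_apply, Pi.smul_apply, h1]
  simp

theorem hankel_opNorm_le_iff (hb : IsSymbol b) : (hankel b).opNorm ≤ A ↔ BddH 1 b A := by
  rw [bddH_iff hb]
  constructor
  · intro h φ hφ hm
    have hdom : φ ∈ (hankel b).dom := ⟨spec_one_iff.1 hφ, star_mem_of_memLp_conj hm⟩
    have := PartialOp.norm_app_le h (fun c φ hφ => ⟨spec_one_iff.1 ((spec_one_iff.2 hφ.1).smul c), ?_⟩)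
      (fun c φ hφ => Or.inr ?_) hdom
    · rwa [show (hankel b).app φ = proj 1 (hm.toLp _) by rw [← mulOp_app_star hm]; rfl] at this
    · rw [star_smul_L2]
      exact mulOp_dom_smul _ hφ.2
    · change projL 1 ((mulOp b).app (star (c • φ))) = conj c • projL 1 ((mulOp b).app (star φ))
      rw [star_smul_L2, mulOp_app_smul _ hφ.2, map_smul]
  · intro h
    refine PartialOp.opNorm_le fun φ hφ => ?_
    have hm := memLp_conj_of_star_mem hφ.2
    have := h φ (spec_one_iff.2 hφ.1) hm
    rwa [← mulOp_app_star hm] at this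

/-! ### The iterated commutator -/

/-- The operator is linear on its domain. -/
structure PartialOp.IsLinear (T : PartialOp d) : Prop where
  dom_add : ∀ {φ ψ : L2 d}, φ ∈ T.dom → ψ ∈ T.dom → φ + ψ ∈ T.dom
  dom_smul : ∀ (c : ℂ) {φ : L2 d}, φ ∈ T.dom → c • φ ∈ T.dom
  app_add : ∀ {φ ψ : L2 d}, φ ∈ T.dom → ψ ∈ T.dom → T.app (φ + ψ) = T.app φ + T.app ψ
  app_smul : ∀ (c : ℂ) {φ : L2 d}, φ ∈ T.dom → T.app (c • φ) = c • T.app φ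

lemma isLinear_mulOp : (mulOp b).IsLinear :=
  ⟨mulOp_dom_add, mulOp_dom_smul, mulOp_app_add, mulOp_app_smul⟩

/-- `P_{±,j}` as a continuous linear map. -/
abbrev projCoordL (s : ℤˣ) (j : Fin d) : L2 d →L[ℂ] L2 d :=
  freqProjL (halfSpace s j) (measurableSet_halfSpace s j)

/-- The Hilbert transform as a continuous linear map. -/
def hilbertL (j : Fin d) : L2 d →L[ℂ] L2 d := -projCoordL (-1) j + projCoordL 1 j

lemma hilbertL_apply (j : Fin d) (f : L2 d) : hilbertL j f = hilbert j f := rfl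

lemma PartialOp.IsLinear.comm {T : PartialOp d} (hT : T.IsLinear) (j : Fin d) :
    (T.comm (hilbert j)).IsLinear where
  dom_add := fun {φ ψ} hφ hψ => ⟨hT.dom_add hφ.1 hψ.1, by
    rw [← hilbertL_apply, map_add]; exact hT.dom_add hφ.2 hψ.2⟩
  dom_smul := fun c {φ} hφ => ⟨hT.dom_smul c hφ.1, by
    rw [← hilbertL_apply, map_smul]; exact hT.dom_smul c hφ.2⟩
  app_add := fun {φ ψ} hφ hψ => by
    simp only [PartialOp.comm, ← hilbertL_apply]
    have h := hT.app_add hφ.2 hψ.2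
    simp only [← hilbertL_apply] at h
    rw [hT.app_add hφ.1 hψ.1, map_add, map_add, h]
    abel
  app_smul := fun c {φ} hφ => by
    simp only [PartialOp.comm, ← hilbertL_apply]
    have h := hT.app_smul c hφ.2
    simp only [← hilbertL_apply] at h
    rw [hT.app_smul c hφ.1, map_smul, map_smul, h, smul_sub]

lemma isLinear_foldl (l : List (Fin d)) : ∀ {T : PartialOp d}, T.IsLinear →
    (l.foldl (fun T j => T.comm (hilbert j)) T).IsLinear := by
  induction l with
  | nil => exact fun h => h
  | cons j l ih => exact fun h => ih (h.comm j)

lemma isLinear_commutator : (commutator b).IsLinear := isLinear_foldl _ isLinear_mulOp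

lemma projCoord_add_projCoord (j : Fin d) (f : L2 d) : projCoord 1 j f + projCoord (-1) j f = f := by
  refine L2.ext_fourier ?_
  rw [map_add]
  filter_upwards [Lp.coeFn_add (fourierL2 (projCoord 1 j f)) (fourierL2 (projCoord (-1) j f)),
    fourierL2_freqProj_ae (hS := measurableSet_halfSpace 1 j) f,
    fourierL2_freqProj_ae (hS := measurableSet_halfSpace (-1) j) f, ae_coord_ne_zero] with ξ h1 h2 h3 h4
  unfold projCoord at h1 ⊢
  rw [h1, Pi.add_apply, h2, h3]
  rcases lt_or_gt_of_ne (h4 j) with h | h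
  · simp [Set.indicator, halfSpace, h, h.le]
  · simp [Set.indicator, halfSpace, h, h.le]

/-- Since `P_{±,j} = (1 ± H_j)/2`, the natural domain of a commutator with `H_j` is carried by both
projections into the domain of `T`. Iterated, this places every `P_σ φ` in the domain of `M_b`. -/
lemma projCoord_mem {T : PartialOp d} (hT : T.IsLinear) (s : ℤˣ) (j : Fin d) {φ : L2 d}
    (hφ : φ ∈ (T.comm (hilbert j)).dom) : projCoord s j φ ∈ T.dom := by
  have h1 := projCoord_add_projCoord j φ
  have h2 : hilbert j φ = -projCoord (-1) j φ + projCoord 1 j φ := rfl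
  rcases Int.units_eq_one_or s with p | p
  · have : projCoord s j φ = (1 / 2 : ℂ) • (φ + hilbert j φ) := by
      rw [p, h2]
      nth_rewrite 2 [← h1]
      rw [show projCoord 1 j φ + projCoord (-1) j φ + (-projCoord (-1) j φ + projCoord 1 j φ) =
        (2 : ℂ) • projCoord 1 j φ by rw [two_smul]; abel, smul_smul]
      norm_num
    rw [this]
    exact hT.dom_smul _ (hT.dom_add hφ.1 hφ.2)
  · have : projCoord s j φ = (1 / 2 : ℂ) • (φ + (-1 : ℂ) • hilbert j φ) := by
      rw [p, h2]
      nth_rewrite 2 [← h1]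
      rw [neg_one_smul, show projCoord 1 j φ + projCoord (-1) j φ + -(-projCoord (-1) j φ + projCoord 1 j φ) =
        (2 : ℂ) • projCoord (-1) j φ by rw [two_smul]; abel, smul_smul]
      norm_num
    rw [this]
    exact hT.dom_smul _ (hT.dom_add hφ.1 (hT.dom_smul _ hφ.2))

/-- The frequencies whose coordinates in the list `l` have the signs prescribed by `σ`. -/
def partialOrthant (σ : Fin d → ℤˣ) (l : List (Fin d)) : Set (Rd d) := {ξ | ∀ j ∈ l, ξ ∈ halfSpace (σ j) j}

lemma measurableSet_partialOrthant (σ : Fin d → ℤˣ) (l : List (Fin d)) :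
    MeasurableSet (partialOrthant σ l) := by
  have : partialOrthant σ l = ⋂ j ∈ {j | j ∈ l}, halfSpace (σ j) j := by
    ext; simp [partialOrthant]
  rw [this]
  exact MeasurableSet.biInter (Set.to_countable _) fun j _ => measurableSet_halfSpace (σ j) j

lemma partialOrthant_finRange (σ : Fin d → ℤˣ) : partialOrthant σ (List.finRange d) = orthant σ := by
  ext; simp [partialOrthant, orthant]

/-- The projection to `partialOrthant σ l`. -/
def partialProj (σ : Fin d → ℤˣ) (l : List (Fin d)) : L2 d →L[ℂ] L2 d :=
  freqProjL (partialOrthant σ l) (measurableSet_partialOrthant σ l)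

lemma partialProj_nil (σ : Fin d → ℤˣ) (f : L2 d) : partialProj σ [] f = f := by
  change freqProj _ _ f = f
  rw [freqProj_eq_self_iff]
  exact .of_forall fun ξ h => absurd (by simp [partialOrthant]) h

lemma partialProj_cons (σ : Fin d → ℤˣ) (j : Fin d) (l : List (Fin d)) (f : L2 d) :
    partialProj σ (j :: l) f = projCoord (σ j) j (partialProj σ l f) := by
  change freqProj _ _ f = freqProj _ _ (freqProj _ _ f)
  rw [freqProj_comp]
  exact freqProj_congr (.of_forall fun ξ => by simp [partialOrthant]) f

lemma partialProj_finRange (σ : Fin d → ℤˣ) (f : L2 d) : partialProj σ (List.finRange d) f = proj σ f :=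
  freqProj_congr (.of_forall fun ξ => by rw [partialOrthant_finRange]) f

lemma partialProj_comm (σ : Fin d → ℤˣ) (l : List (Fin d)) (s : ℤˣ) (j : Fin d) (f : L2 d) :
    partialProj σ l (projCoord s j f) = projCoord s j (partialProj σ l f) := by
  change freqProj _ _ (freqProj _ _ f) = freqProj _ _ (freqProj _ _ f)
  rw [freqProj_comp, freqProj_comp]
  exact freqProj_congr (.of_forall fun ξ => by rw [Set.inter_comm]) f

lemma partialProj_mem (σ : Fin d → ℤˣ) (l : List (Fin d)) : ∀ {T : PartialOp d}, T.IsLinear →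
    ∀ {φ : L2 d}, φ ∈ (l.foldl (fun T j => T.comm (hilbert j)) T).dom → partialProj σ l φ ∈ T.dom := by
  induction l with
  | nil => intro T _ φ h; rwa [partialProj_nil]
  | cons j l ih =>
    intro T hT φ h
    rw [partialProj_cons]
    exact projCoord_mem hT _ j (ih (hT.comm j) h)

lemma projCoord_of_spec {φ : L2 d} (hφ : Spec σ φ) (j : Fin d) :
    projCoord (σ j) j φ = φ ∧ projCoord (-σ j) j φ = 0 := by
  have h : projCoord (σ j) j φ = φ := by
    unfold projCoord
    rw [freqProj_eq_self_iff]
    filter_upwards [spec_iff.1 hφ] with ξ h1 h2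
    exact h1 fun h3 => h2 (Set.mem_iInter.1 h3 j)
  refine ⟨h, ?_⟩
  have h1 := projCoord_add_projCoord j φ
  rcases Int.units_eq_one_or (σ j) with p | p
  · rw [p] at h ⊢
    rw [h] at h1
    simpa using h1
  · rw [p] at h ⊢
    rw [h] at h1
    simpa using h1

/-- On functions with frequencies in an orthant the Hilbert transforms are scalars. -/
lemma hilbert_of_spec {φ : L2 d} (hφ : Spec σ φ) (j : Fin d) :
    hilbert j φ = ((σ j : ℤ) : ℂ) • φ := by
  obtain ⟨h1, h2⟩ := projCoord_of_spec hφ j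
  unfold hilbert
  rcases Int.units_eq_one_or (σ j) with p | p
  · rw [p] at h1 h2 ⊢
    rw [h1, h2]; simp
  · rw [p] at h1 h2 ⊢
    rw [neg_neg] at h2
    rw [h1, h2]; simp

/-- The scalar `s` and `H_j` agree on frequencies of sign `s` and differ by `2s` on the others. -/
lemma smul_sub_hilbert (s : ℤˣ) (j : Fin d) (g : L2 d) :
    ((s : ℤ) : ℂ) • g - hilbert j g = (2 * ((s : ℤ) : ℂ)) • projCoord (-s) j g := by
  have h1 := projCoord_add_projCoord j g
  unfold hilbert
  rcases Int.units_eq_one_or s with p | p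
  · rw [p]
    nth_rewrite 1 [← h1]
    simp only [Units.val_one, Int.cast_one, one_smul, mul_one, two_smul]
    abel
  · rw [p]
    nth_rewrite 1 [← h1]
    simp only [Units.val_neg, Units.val_one, Int.cast_neg, Int.cast_one, neg_smul, one_smul, mul_neg,
      mul_one, two_smul, neg_neg]
    abel

/-- The iterated commutator on functions with frequencies in an orthant. -/
lemma foldl_of_spec {φ : L2 d} (hφ : Spec σ φ) (l : List (Fin d)) :
    ∀ {T : PartialOp d}, T.IsLinear → φ ∈ T.dom →
      φ ∈ (l.foldl (fun T j => T.comm (hilbert j)) T).dom ∧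
      ∃ c : ℂ, ‖c‖ = 2 ^ l.length ∧
        (l.foldl (fun T j => T.comm (hilbert j)) T).app φ = c • partialProj (-σ) l (T.app φ) := by
  induction l with
  | nil => intro T _ h; exact ⟨h, 1, by simp, by simp [partialProj_nil]⟩
  | cons j l ih =>
    intro T hT h
    have h1 : φ ∈ (T.comm (hilbert j)).dom :=
      ⟨h, by rw [hilbert_of_spec hφ]; exact hT.dom_smul _ h⟩
    obtain ⟨h2, c, hc, h3⟩ := ih (hT.comm j) h1
    refine ⟨h2, c * (2 * ((σ j : ℤ) : ℂ)), ?_, ?_⟩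
    · have : ‖((σ j : ℤ) : ℂ)‖ = 1 := by
        rcases Int.units_eq_one_or (σ j) with p | p <;> simp [p]
      rw [norm_mul, hc, norm_mul, this, List.length_cons, pow_succ]
      simp
    · rw [List.foldl_cons, h3]
      -- As `H_j φ = σ(j) φ`, the commutator is `(σ(j) - H_j) T φ`: it flips the sign of the `j`-th
      -- frequency and gains a factor of modulus two.
      have : (T.comm (hilbert j)).app φ =
          (2 * ((σ j : ℤ) : ℂ)) • projCoord (-σ j) j (T.app φ) := by
        rw [← smul_sub_hilbert]
        change T.app (hilbert j φ) - hilbert j (T.app φ) = _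
        rw [hilbert_of_spec hφ, hT.app_smul _ h]
      rw [this, map_smul, smul_smul, partialProj_comm, partialProj_cons]
      rfl

lemma commutator_of_spec {φ : L2 d} (hφ : Spec σ φ) (h : φ ∈ (mulOp b).dom) :
    φ ∈ (commutator b).dom ∧ ∃ c : ℂ, ‖c‖ = 2 ^ d ∧
      (commutator b).app φ = c • proj (-σ) ((mulOp b).app φ) := by
  obtain ⟨h1, c, h2, h3⟩ := foldl_of_spec hφ (List.finRange d) isLinear_mulOp h
  rw [List.length_finRange] at h2
  rw [partialProj_finRange] at h3
  exact ⟨h1, c, h2, h3⟩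

/-- Conjugation exchanges the orthants `σ` and `-σ`, so the Hankel operator on `-σ` becomes the
linear operator `P_{-σ} M_b` on the range of `P_σ`. -/
lemma bddH_iff' (hb : IsSymbol b) : BddH (-σ) b A ↔ ∀ φ : L2 d, Spec σ φ → φ ∈ (mulOp b).dom →
    ‖proj (-σ) ((mulOp b).app φ)‖ ≤ A * ‖φ‖ := by
  rw [bddH_iff hb]
  constructor
  · intro h φ hφ hm
    have h1 : star (star φ) ∈ (mulOp b).dom := by rwa [star_star]
    have h2 := h (star φ) hφ.star (memLp_conj_of_star_mem h1)
    rwa [← mulOp_app_star, star_star, norm_star_L2] at h2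
  · intro h φ hφ hm
    have h1 := h (star φ) (by simpa using hφ.star) (star_mem_of_memLp_conj hm)
    rwa [mulOp_app_star hm, norm_star_L2] at h1

lemma isLinear_sum_app {T : PartialOp d} (hT : T.IsLinear) (h0 : (0 : L2 d) ∈ T.dom) {ι : Type*}
    (s : Finset ι) (f : ι → L2 d) (hf : ∀ i ∈ s, f i ∈ T.dom) :
    ∑ i ∈ s, f i ∈ T.dom ∧ T.app (∑ i ∈ s, f i) = ∑ i ∈ s, T.app (f i) := by
  classical
  induction s using Finset.induction_on with
  | empty =>
    refine ⟨by simpa using h0, ?_⟩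
    have := hT.app_smul 0 h0
    simpa using this
  | insert a s ha ih =>
    obtain ⟨h1, h2⟩ := ih fun i hi => hf i (Finset.mem_insert_of_mem hi)
    rw [Finset.sum_insert ha, Finset.sum_insert ha]
    exact ⟨hT.dom_add (hf a (Finset.mem_insert_self _ _)) h1,
      by rw [hT.app_add (hf a (Finset.mem_insert_self _ _)) h1, h2]⟩

/-- Orthogonality of both the components `P_σ φ` and their images makes the norm the maximum over
the orthants, so the number of orthants costs nothing. The factor `2^d` is the modulus of the scalar
on each orthant. -/
theorem commutator_opNorm_le (hb : IsSymbol b) (h : ∀ σ, BddH σ b A) :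
    (commutator b).opNorm ≤ 2 ^ d * A := by
  have h' : (commutator b).opNorm ≤ ((2 ^ d * A : ℝ≥0) : ℝ≥0∞) := by
    refine PartialOp.opNorm_le fun φ hφ => ?_
    have hm : ∀ σ, proj σ φ ∈ (mulOp b).dom := fun σ => by
      rw [← partialProj_finRange]
      exact partialProj_mem σ _ isLinear_mulOp hφ
    have hk := fun σ => commutator_of_spec (spec_proj σ φ) (hm σ)
    choose hd c hc happ using hk
    have h0 : (0 : L2 d) ∈ (commutator b).dom := by
      have := isLinear_commutator.dom_smul 0 hφ
      simpa using this
    have h1 := (isLinear_sum_app isLinear_commutator h0 Finset.univ (fun σ => proj σ φ)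
      fun σ _ => hd σ).2
    rw [sum_proj] at h1
    -- The image of `P_σ φ` has frequencies in `-σ`; hence the sum is reindexed by negation.
    have h2 : ‖(commutator b).app φ‖ ^ 2 = ∑ σ, ‖(commutator b).app (proj σ φ)‖ ^ 2 := by
      rw [h1, ← Equiv.sum_comp (Equiv.neg (Fin d → ℤˣ)), norm_sq_sum_of_spec]
      · exact Equiv.sum_comp (Equiv.neg (Fin d → ℤˣ)) (fun σ => ‖(commutator b).app (proj σ φ)‖ ^ 2)
      · intro σ
        rw [Equiv.neg_apply, happ]
        have := (spec_proj (- -σ) ((mulOp b).app (proj (-σ) φ))).smul (c (-σ))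
        rwa [neg_neg] at this ⊢
    have h3 : ∀ σ, ‖(commutator b).app (proj σ φ)‖ ^ 2 ≤ (2 ^ d * A) ^ 2 * ‖proj σ φ‖ ^ 2 := by
      intro σ
      rw [happ, norm_smul, hc, ← mul_pow, mul_assoc]
      have := (bddH_iff' hb).1 (h (-σ)) _ (spec_proj σ φ) (hm σ)
      gcongr
    have h4 : ‖(commutator b).app φ‖ ^ 2 ≤ ((2 ^ d * A) * ‖φ‖) ^ 2 := by
      rw [h2, mul_pow]
      refine (Finset.sum_le_sum fun σ _ => h3 σ).trans ?_
      rw [← Finset.mul_sum, ← norm_sq_sum_of_spec fun σ => spec_proj σ φ, sum_proj]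
    have := abs_le_of_sq_le_sq h4 (by positivity)
    push_cast
    exact (le_abs_self _).trans this
  simpa using h'

/-- Restricted to one orthant, `C_b` is the corresponding Hankel operator up to conjugation and a
scalar of modulus `2^d`, which is simply discarded because it is at least one. -/
theorem BddH.of_commutator (hb : IsSymbol b) (h : (commutator b).opNorm ≤ A) (σ : Fin d → ℤˣ) :
    BddH σ b A := by
  rw [← neg_neg σ, bddH_iff' hb]
  intro φ hφ hm
  obtain ⟨hd, c, hc, happ⟩ := commutator_of_spec hφ hm
  have h1 := PartialOp.norm_app_le h isLinear_commutator.dom_smul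
    (fun c φ hφ => Or.inl (isLinear_commutator.app_smul c hφ)) hd
  rw [happ, norm_smul, hc] at h1
  have h2 : (1 : ℝ) ≤ 2 ^ d := one_le_pow₀ (by norm_num)
  have := norm_nonneg (proj (- -σ) ((mulOp b).app φ))
  nlinarith [norm_nonneg (proj (- -σ) ((mulOp b).app φ))]

end

/-! ### The norms of symbols in the spaces of bounded mean oscillation -/

section

variable {b : Rd d → ℂ} {A : ℝ≥0} {σ : Fin d → ℤˣ}

lemma pairing_smul (b : Rd d → ℂ) (c : ℂ) (f : L2 d) :
    pairing b (c • f) = conj c * pairing b f := by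
  unfold pairing
  rw [← integral_const_mul]
  refine integral_congr_ae ?_
  filter_upwards [Lp.coeFn_smul c f] with x hx
  rw [hx, Pi.smul_apply, smul_eq_mul, map_mul]; ring

lemma InE.smul {g : L2 d} (hg : InE σ g) (c : ℂ) : InE σ (c • g) := by
  refine ⟨hg.1.smul c, (hg.2.const_smul c).ae_eq ?_⟩
  filter_upwards [Lp.coeFn_smul c g] with x hx
  rw [hx]
  simp only [Pi.smul_apply, smul_eq_mul]; ring

lemma InE.integrable {g : L2 d} (hg : InE σ g) : Integrable g volume := integrable_of_weight hg.2

lemma eLpNorm_one_eq {f : Rd d → ℂ} (hf : Integrable f volume) :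
    eLpNorm f 1 volume = ENNReal.ofReal (∫ x, ‖f x‖) := by
  rw [eLpNorm_one_eq_lintegral_enorm, ofReal_integral_norm_eq_lintegral_enorm hf]

lemma integral_norm_smul (c : ℂ) (f : L2 d) : ∫ x, ‖(c • f : L2 d) x‖ = ‖c‖ * ∫ x, ‖f x‖ := by
  rw [← integral_const_mul]
  refine integral_congr_ae ?_
  filter_upwards [Lp.coeFn_smul c f] with x hx
  rw [hx, Pi.smul_apply, norm_smul]

lemma proj_inE {τ : Fin d → ℤˣ} {g : L2 d} (hg : InE σ g) : proj τ g = if τ = σ then g else 0 := by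
  split_ifs with h
  · rw [h]; exact hg.1
  · exact proj_eq_zero_of_ne h hg.1

lemma zero_ae : ∀ᵐ x : Rd d, (0 : L2 d) x = 0 := Lp.coeFn_zero ℂ 2 (volume : Measure (Rd d))

lemma pairing_zero (b : Rd d → ℂ) : pairing b (0 : L2 d) = 0 := by
  rw [pairing_congr zero_ae]; simp

lemma InE.mem_pairingDomain (hb : IsSymbol b) {g : L2 d} (hg : InE σ g) : g ∈ pairingDomain b := by
  intro τ
  rw [proj_inE hg]
  split_ifs
  · exact ⟨hg.integrable, hb.integrable_mul_conj hg.2⟩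
  · constructor
    · exact (integrable_congr zero_ae).2 (integrable_zero _ _ _)
    · refine (integrable_congr ?_).2 (integrable_zero _ _ _)
      filter_upwards with x
      simp

lemma InE.reHardyNorm_eq {g : L2 d} (hg : InE σ g) :
    reHardyNorm g = ENNReal.ofReal (∫ x, ‖g x‖) := by
  unfold reHardyNorm
  rw [Finset.sum_eq_single σ, proj_inE hg, if_pos rfl, eLpNorm_one_eq hg.integrable]
  · intro τ _ hτ
    rw [proj_inE hg, if_neg hτ, eLpNorm_congr_ae zero_ae]
    exact eLpNorm_zero
  · simp

lemma eq_zero_of_integral_norm {g : L2 d} (hg : Integrable g volume) (h : ∫ x, ‖g x‖ = 0) : g = 0 := by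
  refine L2.ext_ae ?_
  rw [integral_eq_zero_iff_of_nonneg (fun x => norm_nonneg _) hg.norm] at h
  filter_upwards [h, zero_ae] with x h1 h2
  rw [h2]
  exact norm_eq_zero.1 h1

/-- A homogeneous functional bounded by `A` on the unit ball of `L¹` is bounded by `A`. -/
lemma norm_le_of_forall_unit {Λ : L2 d → ℂ} (hΛ : ∀ (c : ℂ) (f : L2 d), Λ (c • f) = conj c * Λ f)
    (h : ∀ g, InE σ g → ∫ x, ‖g x‖ = 1 → ‖Λ g‖ₑ ≤ A) {g : L2 d} (hg : InE σ g) :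
    ‖Λ g‖ ≤ A * ∫ x, ‖g x‖ := by
  have h0 : 0 ≤ ∫ x, ‖g x‖ := integral_nonneg fun x => norm_nonneg _
  rcases eq_or_lt_of_le h0 with h1 | h1
  · have h2 := hΛ 0 g
    rw [zero_smul, map_zero, zero_mul] at h2
    rw [eq_zero_of_integral_norm hg.integrable h1.symm, h2, norm_zero]
    exact mul_nonneg A.2 (integral_nonneg fun x => norm_nonneg _)
  · set R := ∫ x, ‖g x‖
    have h2 := h _ (hg.smul ((R⁻¹ : ℝ) : ℂ)) (by
      rw [integral_norm_smul, Complex.norm_real, norm_inv, Real.norm_of_nonneg h0,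
        inv_mul_cancel₀ h1.ne'])
    rw [enorm_le_coe, hΛ] at h2
    have h3 : ‖conj ((R⁻¹ : ℝ) : ℂ) * Λ g‖ ≤ A := by exact_mod_cast h2
    rw [norm_mul, RCLike.norm_conj, Complex.norm_real, norm_inv, Real.norm_of_nonneg h0,
      inv_mul_le_iff₀ h1, mul_comm] at h3
    exact h3

lemma enorm_le_of_dualNorm {D : Set (L2 d)} {Λ : L2 d → ℂ} (h : dualNorm D Λ ≤ A) {f : L2 d}
    (hf : f ∈ D) (h1 : reHardyNorm f ≤ 1) : ‖Λ f‖ₑ ≤ A :=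
  (le_iSup₂_of_le (f := fun f (_ : f ∈ D) => ⨆ _ : reHardyNorm f ≤ 1, ‖Λ f‖ₑ) f hf
    (le_iSup (fun _ : reHardyNorm f ≤ 1 => ‖Λ f‖ₑ) h1)).trans h

lemma sum_integral_norm_proj_le {f : L2 d} (hf : f ∈ pairingDomain b) (h1 : reHardyNorm f ≤ 1) :
    ∑ σ, ∫ x, ‖proj σ f x‖ ≤ 1 := by
  unfold reHardyNorm at h1
  simp only [eLpNorm_one_eq (hf _).1] at h1
  rw [← ENNReal.ofReal_sum_of_nonneg fun σ _ => integral_nonneg fun x => norm_nonneg _] at h1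
  exact ENNReal.ofReal_le_one.1 h1

/-- On weighted test functions of the positive orthant `P_⊕` is the identity and the real Hardy norm
is the `L¹` norm. Conversely `‖P_⊕ f‖₁` is one summand of the real Hardy norm. -/
theorem bmoNormProjPlus_le_iff (hb : IsSymbol b) : bmoNormProjPlus b ≤ A ↔ BddE 1 b A := by
  constructor
  · intro h g hg
    have key := norm_le_of_forall_unit (A := A) (σ := 1) (Λ := fun f => pairing b (projPlus f))
      (fun c f => by
        change pairing b (projL 1 (c • f)) = _
        rw [map_smul, pairing_smul]; rfl)
      (fun g hg hg1 => enorm_le_of_dualNorm h (hg.mem_pairingDomain hb)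
        (by rw [hg.reHardyNorm_eq, hg1, ENNReal.ofReal_one])) hg
    simpa only [show projPlus g = g from hg.1] using key
  · intro h
    refine iSup₂_le fun f hf => iSup_le fun h1 => ?_
    rw [enorm_le_coe]
    have h2 := h.of_integrable (spec_proj 1 f) (hf 1).1 (hf 1).2
    have h3 : ∫ x, ‖proj 1 f x‖ ≤ 1 := (Finset.single_le_sum
      (f := fun σ => ∫ x, ‖proj σ f x‖) (fun σ _ => integral_nonneg fun x => norm_nonneg _)
      (Finset.mem_univ 1)).trans (sum_integral_norm_proj_le hf h1)
    exact_mod_cast h2.trans (mul_le_of_le_one_right A.2 h3)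

lemma pairing_eq_sum {f : L2 d} (hf : f ∈ pairingDomain b) :
    pairing b f = ∑ σ, pairing b (proj σ f) := by
  unfold pairing
  rw [← integral_finsetSum _ fun σ _ => (hf σ).2]
  refine integral_congr_ae ?_
  have h := Lp.coeFn_finsetSum (s := Finset.univ) (fun σ => proj σ f)
  rw [sum_proj] at h
  filter_upwards [h] with x hx
  rw [hx, Finset.sum_apply, map_sum, Finset.mul_sum]

/-- The real Hardy norm is an `ℓ¹` sum over the orthants and the pairing splits accordingly, so the
dual norm is a supremum over the orthants. -/
theorem bmoNorm_le_iff (hb : IsSymbol b) : bmoNorm b ≤ A ↔ ∀ σ, BddE σ b A := by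
  constructor
  · intro h σ g hg
    exact norm_le_of_forall_unit (A := A) (σ := σ) (Λ := pairing b) (pairing_smul b)
      (fun g hg hg1 => enorm_le_of_dualNorm h (hg.mem_pairingDomain hb)
        (by rw [hg.reHardyNorm_eq, hg1, ENNReal.ofReal_one])) hg
  · intro h
    refine iSup₂_le fun f hf => iSup_le fun h1 => ?_
    rw [enorm_le_coe]
    have h2 : ‖pairing b f‖ ≤ A := by
      rw [pairing_eq_sum hf]
      refine (norm_sum_le _ _).trans ?_
      refine (Finset.sum_le_sum fun σ _ =>
        (h σ).of_integrable (spec_proj σ f) (hf σ).1 (hf σ).2).trans ?_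
      rw [← Finset.mul_sum]
      exact mul_le_of_le_one_right A.2 (sum_integral_norm_proj_le hf h1)
    exact_mod_cast h2

theorem analyticBmoNorm_le_iff (hb : IsSymbol b) : analyticBmoNorm b ≤ A ↔ BddE 1 b A := by
  constructor
  · intro h g hg
    refine norm_le_of_forall_unit (A := A) (σ := 1) (Λ := pairing b) (pairing_smul b)
      (fun g hg hg1 => le_trans ?_ h) hg
    refine le_trans ?_ (le_iSup _ g)
    refine le_trans ?_ (le_iSup _ (hardySign_one_iff.1 ((spec_iff_hardySign hg.integrable).1 hg.1)))
    refine le_trans ?_ (le_iSup _ (hb.integrable_mul_conj hg.2))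
    exact le_iSup (fun _ : eLpNorm g 1 volume ≤ 1 => ‖pairing b g‖ₑ)
      (by rw [eLpNorm_one_eq hg.integrable, hg1, ENNReal.ofReal_one])
  · intro h
    refine iSup_le fun f => iSup_le fun hf => iSup_le fun hfb => iSup_le fun h1 => ?_
    rw [enorm_le_coe]
    rw [eLpNorm_one_eq hf.1, ENNReal.ofReal_le_one] at h1
    have h2 := h.of_integrable ((spec_iff_hardySign hf.1).2 (hardySign_one_iff.2 hf)) hf.1 hfb
    exact_mod_cast h2.trans (mul_le_of_le_one_right A.2 h1)

/-! ### Reflections, and analytic parts of symbols -/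

lemma weight_signFlip (σ : Fin d → ℤˣ) (x : Rd d) : weight (signFlip σ x) = weight x := by
  unfold weight
  refine Finset.prod_congr rfl fun j _ => ?_
  rw [signFlip_apply]
  rcases Int.units_eq_one_or (σ j) with p | p <;> simp [p]

lemma IsSymbol.signFlip (hb : IsSymbol b) (σ : Fin d → ℤˣ) : IsSymbol fun x => b (signFlip σ x) := by
  rw [isSymbol_iff] at hb ⊢
  have := hb.comp_measurePreserving (Polydisk.signFlip σ).measurePreserving
  simpa only [Function.comp_def, weight_signFlip] using this

lemma integral_comp_signFlip (σ : Fin d → ℤˣ) {E : Type*} [NormedAddCommGroup E] [NormedSpace ℝ E]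
    (f : Rd d → E) : ∫ x, f (signFlip σ x) = ∫ x, f x :=
  (signFlip σ).measurePreserving.integral_comp (signFlip σ).toHomeomorph.measurableEmbedding f

lemma signs_mul_self (σ : Fin d → ℤˣ) : σ * σ = 1 := by
  ext j; simp

lemma quasi_signFlip (σ : Fin d → ℤˣ) :
    Measure.QuasiMeasurePreserving (signFlip σ) (volume : Measure (Rd d)) volume :=
  (signFlip σ).measurePreserving.quasiMeasurePreserving

lemma Nice.reflect {ψ : L2 d} (h : Nice ψ) (σ : Fin d → ℤˣ) : Nice (reflect (signFlip σ) ψ) := by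
  obtain ⟨M, hM⟩ := h
  refine ⟨M, ?_⟩
  filter_upwards [reflect_ae (signFlip σ) ψ, (quasi_signFlip σ).ae hM] with x h1 h2
  rwa [h1, ← weight_signFlip σ]

/-- Reflection by `σ` exchanges the orthant of `σ` with the positive one and preserves the `L²` norm
and the weight. Together with `BddE.of_signFlip` it transports an estimate on the positive orthant
to any other. -/
lemma BddH.signFlip (h : BddH σ b A) : BddH 1 (fun x => b (signFlip σ x)) A := by
  intro φ ψ hφ hψ hn
  have h1 := h (reflect (Polydisk.signFlip σ) φ) (reflect (Polydisk.signFlip σ) ψ)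
    (by simpa using hφ.reflect (τ := σ)) (by simpa using hψ.reflect (τ := σ)) (hn.reflect σ)
  rw [norm_reflect, norm_reflect] at h1
  convert h1 using 2
  rw [← integral_comp_signFlip σ]
  refine integral_congr_ae ?_
  filter_upwards [reflect_ae (Polydisk.signFlip σ) φ, reflect_ae (Polydisk.signFlip σ) ψ]
    with x h2 h3
  simp only [signFlip_signFlip, h2, h3]

lemma BddE.of_signFlip (h : BddE 1 (fun x => b (signFlip σ x)) A) : BddE σ b A := by
  intro g hg
  have h1 := reflect_ae (signFlip σ) g
  have h2 := h (reflect (signFlip σ) g) ⟨by simpa [signs_mul_self] using hg.1.reflect (τ := σ), by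
    refine (hg.2.comp_measurePreserving (signFlip σ).measurePreserving).ae_eq ?_
    filter_upwards [h1] with x hx
    simp only [Function.comp_apply, weight_signFlip, hx]⟩
  rw [pairing_congr h1, integral_comp_signFlip σ (fun x => b x * conj (g x)),
    integral_congr_ae (g := fun x => ‖g (signFlip σ x)‖) (h1.mono fun x hx => congrArg _ hx),
    integral_comp_signFlip σ (fun x => ‖g x‖)] at h2
  exact h2

end

section

variable {b : Rd d → ℂ} {A : ℝ≥0} {σ : Fin d → ℤˣ}

/-- Multiplication by a coordinate function preserves the frequencies. -/
lemma Spec.coord_mul {g : L2 d} (hg : Spec σ g) (j : Fin d)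
    (h : MemLp (fun x => ((x j : ℝ) : ℂ) * g x) 2 volume) : Spec σ (h.toLp _) := by
  set s : ℝ := ((σ j : ℤ) : ℝ) with hs
  have hs1 : s * s = 1 := by
    rcases Int.units_eq_one_or (σ j) with p | p <;> simp [hs, p]
  have hs0 : s ≠ 0 := fun h => by simp [h] at hs1
  -- `x_j g` is the `L²` limit of the difference quotients `(e^{i a x_j} - 1) g / (i a)`, dominated
  -- by `|x_j g|`. Giving `a` the sign `σ(j)` makes the modulations push frequencies further into
  -- the orthant.
  set t : ℕ → Rd d := fun n => EuclideanSpace.single j (scale n * s) with ht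
  set a : ℕ → ℝ := fun n => 2 * Real.pi * (scale n * s) with ha
  have ha0 : ∀ n, a n ≠ 0 := fun n => by
    have := (scale_pos n).ne'
    have := Real.pi_ne_zero
    simp only [ha]; positivity
  have hchar : ∀ n x, character (t n) x = Complex.exp (Complex.I * ((a n * x j : ℝ) : ℂ)) := by
    intro n x
    unfold character
    rw [Real.fourierChar_apply]
    congr 1
    simp only [ht, ha, EuclideanSpace.inner_single_right]
    simp
    ring
  set F : ℕ → L2 d := fun n => (Complex.I * (a n : ℂ))⁻¹ • (mulUnit (character (t n)) g - g) with hF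
  have hFae : ∀ᵐ x, ∀ n, F n x =
      (Complex.I * (a n : ℂ))⁻¹ * ((Complex.exp (Complex.I * ((a n * x j : ℝ) : ℂ)) - 1) * g x) := by
    refine ae_all_iff.2 fun n => ?_
    filter_upwards [Lp.coeFn_smul (Complex.I * (a n : ℂ))⁻¹ (mulUnit (character (t n)) g - g),
      Lp.coeFn_sub (mulUnit (character (t n)) g) g, mulUnit_ae (isContractor_character (t n)) g]
      with x h1 h2 h3
    rw [hF, h1, Pi.smul_apply, h2, Pi.sub_apply, h3, hchar, smul_eq_mul]
    ring
  have hlim : Filter.Tendsto F Filter.atTop (nhds (h.toLp _)) := by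
    refine tendsto_L2_of_dominated h (fun n => ?_) ?_
    · filter_upwards [hFae] with x hx
      rw [hx, norm_mul, norm_mul, norm_mul, norm_inv, norm_mul, Complex.norm_I, one_mul,
        Complex.norm_real, Complex.norm_real, ← mul_assoc]
      refine mul_le_mul_of_nonneg_right ?_ (norm_nonneg _)
      rw [inv_mul_le_iff₀ (norm_pos_iff.2 (ha0 n)), ← norm_mul]
      exact Real.norm_exp_I_mul_ofReal_sub_one_le
    · filter_upwards [hFae, h.coeFn_toLp] with x hx hx2
      simp only [hx, hx2]
      have hd : HasDerivAt (fun u : ℝ => Complex.exp (Complex.I * ((u * x j : ℝ) : ℂ)))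
          (Complex.I * (x j : ℂ)) 0 := by
        have h1 : HasDerivAt (fun u : ℝ => Complex.I * ((u * x j : ℝ) : ℂ)) (Complex.I * (x j : ℂ)) 0 := by
          have := ((hasDerivAt_id (0 : ℝ)).mul_const (x j)).ofReal_comp.const_mul Complex.I
          simpa using this
        have := h1.cexp
        simpa using this
      have h2 := hasDerivAt_iff_tendsto_slope.1 hd
      have h3 : Filter.Tendsto a Filter.atTop (nhdsWithin 0 {0}ᶜ) := by
        refine tendsto_nhdsWithin_iff.2 ⟨?_, .of_forall fun n => ha0 n⟩
        have := (tendsto_scale.mul_const s).const_mul (2 * Real.pi)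
        simpa using this
      have h4 := ((h2.comp h3).const_mul (Complex.I)⁻¹).mul_const (g x)
      rw [← mul_assoc, inv_mul_cancel₀ Complex.I_ne_zero, one_mul] at h4
      refine h4.congr fun n => ?_
      simp only [Function.comp_apply, slope, sub_zero, vsub_eq_sub, zero_mul, Complex.ofReal_zero,
        mul_zero, Complex.exp_zero, Complex.real_smul, Complex.ofReal_inv, mul_inv]
      ring
  refine (isClosed_spec σ).mem_of_tendsto hlim (.of_forall fun n => ?_)
  refine ((hg.mulUnit_character fun i => ?_).sub hg).smul _
  by_cases hij : i = j
  · subst hij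
    simp only [ht, PiLp.single_apply, if_true]
    rw [← hs, mul_comm (scale n), ← mul_assoc, hs1, one_mul]
    exact (scale_pos n).le
  · simp [ht, hij]

/-- The polynomial `∏_j (x_j + i)`. -/
def cayleyPoly (x : Rd d) : ℂ := ∏ j, ((x j : ℂ) + Complex.I)

lemma norm_coord_add_I (t : ℝ) : ‖(t : ℂ) + Complex.I‖ = √(1 + t ^ 2) := by
  rw [Complex.norm_def, Complex.normSq_apply]
  congr 1
  simp
  ring

lemma norm_cayleyPoly (x : Rd d) : ‖cayleyPoly x‖ = weight x := by
  unfold cayleyPoly weight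
  rw [norm_prod]
  exact Finset.prod_congr rfl fun j _ => norm_coord_add_I _

lemma cayleyPoly_ne_zero (x : Rd d) : cayleyPoly x ≠ 0 := by
  rw [← norm_pos_iff, norm_cayleyPoly]; exact weight_pos x

lemma continuous_cayleyPoly : Continuous (cayleyPoly : Rd d → ℂ) := by
  unfold cayleyPoly
  exact continuous_finsetProd _ fun j _ => by fun_prop

lemma prod_sqrt_le_weight (s : Finset (Fin d)) (x : Rd d) : ∏ j ∈ s, √(1 + x j ^ 2) ≤ weight x :=
  Finset.prod_le_prod_of_subset_of_one_le (Finset.subset_univ s) (fun j _ => by positivity)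
    fun j _ _ => Real.one_le_sqrt.2 (by nlinarith [sq_nonneg (x j)])

/-- The factors `x_j - i` are multiplied in one at a time. Each partial product is dominated by the
weight, so every intermediate function is in `L²` and `Spec.coord_mul` applies. -/
lemma InE.exists_poly_mul {g : L2 d} (hg : InE σ g) :
    ∃ h : L2 d, Spec σ h ∧ ∀ᵐ x, h x = conj (cayleyPoly x) * g x := by
  have key : ∀ s : Finset (Fin d), ∃ h : L2 d, Spec σ h ∧
      ∀ᵐ x, h x = (∏ j ∈ s, conj ((x j : ℂ) + Complex.I)) * g x := by
    intro s
    induction s using Finset.induction_on with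
    | empty => exact ⟨g, hg.1, by simp⟩
    | insert a s ha ih =>
      obtain ⟨h, h1, h2⟩ := ih
      have hm : MemLp (fun x => ((x a : ℝ) : ℂ) * h x) 2 volume := by
        refine hg.2.of_le (AEStronglyMeasurable.mul
          (Continuous.aestronglyMeasurable (by fun_prop)) (Lp.aestronglyMeasurable h)) ?_
        filter_upwards [h2] with x hx
        rw [hx, norm_mul, norm_mul, norm_mul, ← mul_assoc, norm_prod, Complex.norm_real,
          Complex.norm_real, Real.norm_of_nonneg (weight_pos x).le]
        refine mul_le_mul_of_nonneg_right ?_ (norm_nonneg _)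
        simp only [RCLike.norm_conj, norm_coord_add_I]
        refine le_trans ?_ (prod_sqrt_le_weight (insert a s) x)
        rw [Finset.prod_insert ha]
        refine mul_le_mul_of_nonneg_right ?_ (Finset.prod_nonneg fun _ _ => Real.sqrt_nonneg _)
        exact Real.abs_le_sqrt (by linarith)
      refine ⟨hm.toLp _ + (-Complex.I) • h, (h1.coord_mul a hm).add (h1.smul _), ?_⟩
      filter_upwards [h2, hm.coeFn_toLp, Lp.coeFn_add (hm.toLp _) ((-Complex.I) • h),
        Lp.coeFn_smul (-Complex.I) h] with x e1 e2 e3 e4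
      rw [e3, Pi.add_apply, e2, e4, Pi.smul_apply, e1, Finset.prod_insert ha]
      simp
      ring
  obtain ⟨h, h1, h2⟩ := key Finset.univ
  refine ⟨h, h1, ?_⟩
  filter_upwards [h2] with x hx
  rw [hx, cayleyPoly, map_prod]

/-- The analytic part of a symbol: the symbol that has the same action on the analytic test
functions and annihilates the test functions with frequencies in the other orthants. -/
lemma exists_analytic_part (hb : IsSymbol b) : ∃ b' : Rd d → ℂ, IsSymbol b' ∧
    (∀ g, InE 1 g → pairing b' g = pairing b g) ∧
    ∀ σ, σ ≠ 1 → ∀ g, InE σ g → pairing b' g = 0 := by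
  -- The symbol need not be in `L²` and cannot be projected directly: it is divided by a polynomial
  -- of modulus `weight`, projected, and multiplied back. In the pairing the polynomial passes to
  -- the test function as its conjugate, which preserves every orthant.
  have hu : MemLp (fun x => b x / cayleyPoly x) 2 volume := by
    refine (isSymbol_iff.1 hb).of_le (hb.aestronglyMeasurable.div₀
      continuous_cayleyPoly.aestronglyMeasurable) (.of_forall fun x => ?_)
    rw [norm_div, norm_div, norm_cayleyPoly, Complex.norm_real, Real.norm_of_nonneg (weight_pos x).le]
  set u : L2 d := hu.toLp _ with hudef
  set v : L2 d := proj 1 u with hv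
  have key : ∀ σ g, InE σ g → ∃ h : L2 d, Spec σ h ∧ (∀ᵐ x, h x = conj (cayleyPoly x) * g x) ∧
      pairing (fun x => cayleyPoly x * v x) g = inner ℂ (proj 1 h) u := by
    intro σ g hg
    obtain ⟨h, h1, h2⟩ := hg.exists_poly_mul
    refine ⟨h, h1, h2, ?_⟩
    rw [show inner ℂ (proj 1 h) u = inner ℂ h (proj 1 u) from inner_freqProj_left h u, L2.inner_def]
    refine integral_congr_ae ?_
    filter_upwards [h2] with x hx
    rw [hx]
    simp
    ring
  refine ⟨fun x => cayleyPoly x * v x, ?_, fun g hg => ?_, fun σ hσ g hg => ?_⟩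
  · rw [isSymbol_iff]
    refine (Lp.memLp v).of_le ((continuous_cayleyPoly.aestronglyMeasurable.mul
      (Lp.aestronglyMeasurable v)).div₀
        (Complex.continuous_ofReal.comp continuous_weight).aestronglyMeasurable)
      (.of_forall fun x => ?_)
    rw [norm_div, norm_mul, norm_cayleyPoly, Complex.norm_real, Real.norm_of_nonneg (weight_pos x).le,
      mul_div_cancel_left₀ _ (weight_pos x).ne']
  · obtain ⟨h, h1, h2, h3⟩ := key 1 g hg
    rw [h3, show proj 1 h = h from h1, L2.inner_def]
    refine integral_congr_ae ?_
    filter_upwards [h2, hu.coeFn_toLp] with x e1 e2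
    rw [hudef, e2, e1]
    have := cayleyPoly_ne_zero x
    simp
    field_simp
  · obtain ⟨h, h1, h2, h3⟩ := key σ g hg
    rw [h3, proj_eq_zero_of_ne hσ.symm h1, inner_zero_left]

/-- Vanishing on the weighted test functions of an orthant is `BddE` with constant zero, and
`BddE.of_integrable` extends it to the full domain of the pairing. -/
lemma isAnalyticSymbol_of_forall (hb : IsSymbol b)
    (h : ∀ σ, σ ≠ 1 → ∀ g, InE σ g → pairing b g = 0) : IsAnalyticSymbol b := by
  refine ⟨hb, fun f hf => ?_⟩
  rw [pairing_eq_sum hf, Finset.sum_eq_single 1]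
  · rfl
  · intro σ _ hσ
    have h0 : BddE σ b 0 := fun g hg => by simp [h σ hσ g hg]
    have := h0.of_integrable (spec_proj σ f) (hf σ).1 (hf σ).2
    simpa using this
  · simp

lemma IsAnalyticSymbol.bddE_zero (hb : IsAnalyticSymbol b) (hσ : σ ≠ 1) : BddE σ b 0 := by
  intro g hg
  rw [← hb.2 g (hg.mem_pairingDomain hb.1)]
  have : projPlus g = 0 := proj_eq_zero_of_ne hσ.symm hg.1
  rw [this, pairing_zero]
  simp

lemma BddE.mono {A' : ℝ≥0} (h : BddE σ b A) (hA : A ≤ A') : BddE σ b A' := fun g hg =>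
  (h g hg).trans (mul_le_mul_of_nonneg_right (by exact_mod_cast hA)
    (integral_nonneg fun x => norm_nonneg _))

lemma BddH.norm_pairing_le (h : BddH σ b A) {φ ψ g : L2 d} (hφ : Spec σ φ) (hψ : Spec σ ψ)
    (hn : Nice ψ) (hg : ∀ᵐ x, g x = φ x * ψ x) : ‖pairing b g‖ ≤ A * (‖φ‖ * ‖ψ‖) := by
  rw [pairing_congr hg]; exact h φ ψ hφ hψ hn

lemma Nice.star {ψ : L2 d} (h : Nice ψ) : Nice (star ψ) := by
  obtain ⟨M, hM⟩ := h
  refine ⟨M, ?_⟩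
  filter_upwards [hM, star_ae ψ] with x h1 h2
  rwa [h2, RCLike.norm_conj]

lemma InE.star {g : L2 d} (hg : InE σ g) : InE (-σ) (star g) := by
  refine ⟨hg.1.star, (conj_memLp hg.2).ae_eq ?_⟩
  filter_upwards [star_ae g] with x hx
  rw [hx, map_mul, Complex.conj_ofReal]

lemma IsSymbol.re (hb : IsSymbol b) : IsSymbol fun x => ((b x).re : ℂ) := by
  rw [isSymbol_iff] at hb ⊢
  have hm := IsSymbol.aestronglyMeasurable (b := b) hb
  refine hb.of_le (((Complex.continuous_ofReal.comp Complex.continuous_re).comp_aestronglyMeasurable hm).div₀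
    (Complex.continuous_ofReal.comp continuous_weight).aestronglyMeasurable)
    (.of_forall fun x => ?_)
  rw [norm_div, norm_div, Complex.norm_real]
  gcongr
  exact Complex.abs_re_le_norm _

/-- The conjugate symbol acts on `g` as the conjugate of the action of `b` on `ḡ`, which has the
opposite frequencies. -/
lemma pairing_re (hb : IsSymbol b) {g : L2 d} (hg : InE σ g) :
    pairing (fun x => ((b x).re : ℂ)) g = (pairing b g + conj (pairing b (star g))) / 2 := by
  have h1 := hb.integrable_mul_conj hg.2
  have h2 := hb.integrable_mul_conj hg.star.2
  unfold pairing
  rw [← integral_conj, ← integral_add h1, ← integral_div]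
  · refine integral_congr_ae ?_
    filter_upwards [star_ae g] with x hx
    rw [hx]
    have := Complex.add_conj (b x)
    simp only [map_mul, Complex.conj_conj]
    rw [← add_mul, this]
    push_cast
    ring
  · exact (Complex.conjLIE.toContinuousLinearEquiv : ℂ →L[ℝ] ℂ).integrable_comp h2

/-! ### The estimates in terms of forms -/

/-- The Hankel form controls the analytic functional, for all symbols. -/
def HankelEstimate (d : ℕ) : Prop :=
  ∃ C : ℝ≥0, ∀ b : Rd d → ℂ, IsSymbol b → ∀ A : ℝ≥0, BddH 1 b A → BddE 1 b (C * A)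

/-- All the Hankel forms together control the functional, for all symbols with the property `P`. -/
def CommutatorEstimate (d : ℕ) (P : (Rd d → ℂ) → Prop) : Prop :=
  ∃ C : ℝ≥0, ∀ b : Rd d → ℂ, IsSymbol b → P b → ∀ A : ℝ≥0, (∀ σ, BddH σ b A) →
    ∀ σ, BddE σ b (C * A)

/-- All the Hankel forms together control the functional, for analytic symbols. -/
def AnalyticEstimate (d : ℕ) : Prop :=
  ∃ C : ℝ≥0, ∀ b : Rd d → ℂ, IsAnalyticSymbol b → ∀ A : ℝ≥0, (∀ σ, BddH σ b A) → BddE 1 b (C * A)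

lemma HankelEstimate.commutatorEstimate (h : HankelEstimate d) :
    CommutatorEstimate d fun _ => True := by
  obtain ⟨C, hC⟩ := h
  exact ⟨C, fun b hb _ A hA σ => BddE.of_signFlip (hC _ (hb.signFlip σ) A (hA σ).signFlip)⟩

lemma CommutatorEstimate.mono {P Q : (Rd d → ℂ) → Prop} (h : CommutatorEstimate d P)
    (hPQ : ∀ b, Q b → P b) : CommutatorEstimate d Q := by
  obtain ⟨C, hC⟩ := h
  exact ⟨C, fun b hb hQ => hC b hb (hPQ b hQ)⟩

lemma CommutatorEstimate.analyticEstimate (h : CommutatorEstimate d fun _ => True) :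
    AnalyticEstimate d := by
  obtain ⟨C, hC⟩ := h
  exact ⟨C, fun b hb A hA => hC b hb.1 trivial A hA 1⟩

/-- The analytic part of `b` has the same form on the positive orthant and zero forms on all others,
so a bound for one Hankel form becomes a bound for all of them. -/
lemma AnalyticEstimate.hankelEstimate (h : AnalyticEstimate d) : HankelEstimate d := by
  obtain ⟨C, hC⟩ := h
  refine ⟨C, fun b hb A hA g hg => ?_⟩
  obtain ⟨b', hb', h1, h2⟩ := exists_analytic_part hb
  rw [← h1 g hg]
  refine hC b' (isAnalyticSymbol_of_forall hb' h2) A (fun σ φ ψ hφ hψ hn => ?_) g hg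
  obtain ⟨k, hk, hkf⟩ := exists_inE_mul hφ hψ hn
  rw [← pairing_congr hkf]
  by_cases hσ : σ = 1
  · subst hσ
    rw [h1 k hk]
    exact hA.norm_pairing_le hφ hψ hn hkf
  · rw [h2 σ hσ k hk, norm_zero]; positivity

lemma one_ne_neg_one_signs (hd : 1 ≤ d) : (1 : Fin d → ℤˣ) ≠ -1 := fun h => by
  have := congrFun h ⟨0, hd⟩
  simp at this

/-- The test symbol is the real part of the analytic part `b'`. Since the orthants `1` and `-1`
differ when `d ≥ 1`, it acts as `b'/2` on the first, as half the conjugate of `b'` on the second,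
and as zero elsewhere. The factor two in the constant undoes this half. -/
lemma CommutatorEstimate.hankelEstimate_of_real (hd : 1 ≤ d)
    (h : CommutatorEstimate d fun b => ∀ x, (b x).im = 0) : HankelEstimate d := by
  obtain ⟨C, hC⟩ := h
  refine ⟨2 * C, fun b hb A hA g hg => ?_⟩
  obtain ⟨b', hb', h1, h2⟩ := exists_analytic_part hb
  have hne := one_ne_neg_one_signs hd
  have key : BddE 1 (fun x => ((b' x).re : ℂ)) (C * A) := by
    refine hC _ hb'.re (fun x => Complex.ofReal_im _) A (fun σ φ ψ hφ hψ hn => ?_) 1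
    obtain ⟨k, hk, hkf⟩ := exists_inE_mul hφ hψ hn
    have h0 : (0 : ℝ) ≤ A * (‖φ‖ * ‖ψ‖) := by positivity
    rw [← pairing_congr hkf, pairing_re hb' hk]
    by_cases hσ : σ = 1
    · subst hσ
      rw [h2 (-1) hne.symm _ hk.star, h1 k hk, map_zero, add_zero, norm_div, RCLike.norm_two]
      have := hA.norm_pairing_le hφ hψ hn hkf
      linarith [norm_nonneg (pairing b k)]
    · rw [h2 σ hσ k hk, zero_add, norm_div, RCLike.norm_conj, RCLike.norm_two]
      by_cases hσ' : -σ = 1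
      · have hk' := hk.star
        have hφ' := hφ.star
        have hψ' := hψ.star
        rw [hσ'] at hk' hφ' hψ'
        rw [h1 _ hk']
        have := hA.norm_pairing_le hφ' hψ' hn.star (g := star k) (by
          filter_upwards [hkf, star_ae k, star_ae φ, star_ae ψ] with x e1 e2 e3 e4
          rw [e2, e1, e3, e4, map_mul])
        rw [norm_star_L2, norm_star_L2] at this
        linarith
      · rw [h2 _ hσ' _ hk.star, norm_zero, zero_div]; exact h0
  have h3 := key g hg
  rw [pairing_re hb' hg, h2 (-1) hne.symm _ hg.star, h1 g hg, map_zero, add_zero, norm_div,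
    RCLike.norm_two] at h3
  push_cast at h3 ⊢
  linarith

/-! ### From forms to norms -/

/-- An inequality between norms is the same as an implication between their finite upper bounds, the
form in which `BddE` and `BddH` are stated. One direction being known, only the other remains. -/
lemma equivalent_iff {α : Type*} {S : α → Prop} {N M : α → ℝ≥0∞} (C₀ : ℝ≥0)
    (h₀ : ∀ a, S a → ∀ A : ℝ≥0, M a ≤ A → N a ≤ C₀ * A) :
    Equivalent S N M ↔ ∃ C : ℝ≥0, ∀ a, S a → ∀ A : ℝ≥0, N a ≤ A → M a ≤ C * A := by
  constructor
  · rintro ⟨C, hC⟩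
    exact ⟨C, fun a ha A hA => (hC a ha).2.trans (mul_le_mul_right hA _)⟩
  · rintro ⟨C, hC⟩
    -- The added `1` keeps the constant nonzero, so that its product with an infinite norm is
    -- infinite; the spare `E` lets one constant serve both inequalities.
    have key : ∀ (D E : ℝ≥0) (u v : ℝ≥0∞), (∀ A : ℝ≥0, u ≤ A → v ≤ D * A) →
        v ≤ ((D + E + 1 : ℝ≥0) : ℝ≥0∞) * u := by
      intro D E u v h
      induction u using ENNReal.recTopCoe with
      | top => rw [ENNReal.mul_top (by exact_mod_cast (by positivity : D + E + 1 ≠ 0))]; exact le_top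
      | coe u =>
        refine (h u le_rfl).trans ?_
        refine mul_le_mul_left (ENNReal.coe_le_coe.2 ?_) _
        exact le_add_right (le_add_right le_rfl)
    refine ⟨C + C₀ + 1, fun a ha => ⟨?_, key C C₀ _ _ (hC a ha)⟩⟩
    rw [add_comm C]
    exact key C₀ C _ _ (h₀ a ha)

theorem equivalent_hankel_iff : Equivalent (fun b : Rd d → ℂ => IsSymbol b)
    (fun b => (hankel b).opNorm) bmoNormProjPlus ↔ HankelEstimate d := by
  rw [equivalent_iff 1]
  · simp only [HankelEstimate, ← ENNReal.coe_mul]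
    refine exists_congr fun C => forall_congr' fun b => forall_congr' fun hb => forall_congr' fun A => ?_
    rw [hankel_opNorm_le_iff hb, bmoNormProjPlus_le_iff hb]
  · intro b hb A hA
    rw [ENNReal.coe_one, one_mul, hankel_opNorm_le_iff hb]
    exact ((bmoNormProjPlus_le_iff hb).1 hA).bddH

theorem equivalent_commutator_iff (P : (Rd d → ℂ) → Prop) : Equivalent (fun b => IsSymbol b ∧ P b)
    (fun b => (commutator b).opNorm) bmoNorm ↔ CommutatorEstimate d P := by
  rw [equivalent_iff (2 ^ d)]
  · constructor
    · rintro ⟨C, hC⟩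
      -- Hankel forms bounded by `A` bound the commutator only by `2^d A`.
      refine ⟨C * 2 ^ d, fun b hb hP A hA => ?_⟩
      rw [← bmoNorm_le_iff hb]
      have := hC b ⟨hb, hP⟩ (2 ^ d * A) (by simpa using commutator_opNorm_le hb hA)
      simpa [mul_assoc] using this
    · rintro ⟨C, hC⟩
      refine ⟨C, fun b hb A hA => ?_⟩
      rw [← ENNReal.coe_mul, bmoNorm_le_iff hb.1]
      exact hC b hb.1 hb.2 A fun σ => BddH.of_commutator hb.1 hA σ
  · intro b hb A hA
    simpa using commutator_opNorm_le hb.1 fun σ => ((bmoNorm_le_iff hb.1).1 hA σ).bddH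

theorem equivalent_analytic_iff : Equivalent (fun b : Rd d → ℂ => IsAnalyticSymbol b)
    (fun b => (commutator b).opNorm) analyticBmoNorm ↔ AnalyticEstimate d := by
  rw [equivalent_iff (2 ^ d)]
  · constructor
    · rintro ⟨C, hC⟩
      refine ⟨C * 2 ^ d, fun b hb A hA => ?_⟩
      rw [← analyticBmoNorm_le_iff hb.1]
      have := hC b hb (2 ^ d * A) (by simpa using commutator_opNorm_le hb.1 hA)
      simpa [mul_assoc] using this
    · rintro ⟨C, hC⟩
      refine ⟨C, fun b hb A hA => ?_⟩
      rw [← ENNReal.coe_mul, analyticBmoNorm_le_iff hb.1]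
      exact hC b hb A fun σ => BddH.of_commutator hb.1 hA σ
  · intro b hb A hA
    -- The analytic norm sees one orthant only, but an analytic symbol vanishes on the others.
    have h : ∀ σ, BddH σ b A := fun σ => by
      by_cases hσ : σ = 1
      · subst hσ; exact ((analyticBmoNorm_le_iff hb.1).1 hA).bddH
      · exact ((hb.bddE_zero hσ).mono zero_le).bddH
    simpa using commutator_opNorm_le hb.1 h

end

/-! ### Averages of translates -/

/-- The uniform probability measure on the ball of radius `r`. -/
def ballMeasure (d : ℕ) (r : ℝ) : Measure (Rd d) :=
  (volume (Metric.ball (0 : Rd d) r))⁻¹ • volume.restrict (Metric.ball 0 r)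

lemma isProbabilityMeasure_ballMeasure {r : ℝ} (hr : 0 < r) : IsProbabilityMeasure (ballMeasure d r) := by
  refine ⟨?_⟩
  rw [ballMeasure, Measure.smul_apply, Measure.restrict_apply_univ, smul_eq_mul,
    ENNReal.inv_mul_cancel (Metric.measure_ball_pos _ _ hr).ne' measure_ball_lt_top.ne]

lemma ae_ballMeasure (r : ℝ) : ∀ᵐ y ∂(ballMeasure d r), y ∈ Metric.ball (0 : Rd d) r :=
  Measure.ae_smul_measure (ae_restrict_mem measurableSet_ball) _

lemma ballMeasure_le (r : ℝ) : ballMeasure d r ≤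
    (volume (Metric.ball (0 : Rd d) r))⁻¹ • volume := by
  refine Measure.le_iff.2 fun s _ => ?_
  rw [ballMeasure, Measure.smul_apply, Measure.smul_apply]
  exact mul_le_mul_right (Measure.restrict_le_self s) _

/-- An integrable function averages to a bounded function. -/
lemma integral_ballMeasure_le {r : ℝ} (hr : 0 < r) {F : Rd d → ℝ} (hF : Integrable F volume)
    (h0 : ∀ x, 0 ≤ F x) : ∃ M : ℝ, ∀ x, Integrable (fun y => F (x + y)) (ballMeasure d r) ∧
      ∫ y, F (x + y) ∂(ballMeasure d r) ≤ M := by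
  refine ⟨(volume (Metric.ball (0 : Rd d) r))⁻¹.toReal * ∫ x, F x, fun x => ?_⟩
  have h1 : Integrable (fun y => F (x + y)) ((volume (Metric.ball (0 : Rd d) r))⁻¹ • volume) :=
    (hF.comp_add_left x).smul_measure (ENNReal.inv_ne_top.2 (Metric.measure_ball_pos _ _ hr).ne')
  refine ⟨h1.mono_measure (ballMeasure_le r),
    (integral_mono_measure (ballMeasure_le r) (.of_forall fun y => h0 _) h1).trans ?_⟩
  rw [integral_smul_measure, integral_add_left_eq_self F x, smul_eq_mul]

/-- The average of the translates of `u` over a ball. -/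
def average (r : ℝ) (u : Rd d → ℂ) (x : Rd d) : ℂ := ∫ y, u (x + y) ∂(ballMeasure d r)

section

variable {r : ℝ} {u v : Rd d → ℂ} {M : ℝ}

lemma stronglyMeasurable_average (hr : 0 < r) (hu : StronglyMeasurable u) :
    StronglyMeasurable (average r u) := by
  have := isProbabilityMeasure_ballMeasure (d := d) hr
  have h : StronglyMeasurable (Function.uncurry fun x y : Rd d => u (x + y)) :=
    hu.comp_measurable measurable_add
  exact h.integral_prod_right

lemma integrable_translate_mul (hr : 0 < r) (hu : StronglyMeasurable u)
    (hv : AEStronglyMeasurable v volume)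
    (h : ∀ y, Integrable (fun x => u (x + y) * v x) volume ∧ ∫ x, ‖u (x + y) * v x‖ ≤ M) :
    Integrable (fun p : Rd d × Rd d => u (p.1 + p.2) * v p.1) (volume.prod (ballMeasure d r)) := by
  have := isProbabilityMeasure_ballMeasure (d := d) hr
  have hm : AEStronglyMeasurable (fun p : Rd d × Rd d => u (p.1 + p.2) * v p.1)
      (volume.prod (ballMeasure d r)) :=
    (hu.comp_measurable measurable_add).aestronglyMeasurable.mul hv.comp_fst
  rw [integrable_prod_iff' hm]
  refine ⟨.of_forall fun y => (h y).1, ?_⟩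
  refine Integrable.of_bound hm.norm.prod_swap.integral_prod_right' M (.of_forall fun y => ?_)
  rw [Real.norm_of_nonneg (integral_nonneg fun x => norm_nonneg _)]
  exact (h y).2

lemma integral_average_mul (hr : 0 < r) (hu : StronglyMeasurable u)
    (hv : AEStronglyMeasurable v volume)
    (h : ∀ y, Integrable (fun x => u (x + y) * v x) volume ∧ ∫ x, ‖u (x + y) * v x‖ ≤ M) :
    ∫ x, average r u x * v x = ∫ y, (∫ x, u (x + y) * v x) ∂(ballMeasure d r) := by
  have := isProbabilityMeasure_ballMeasure (d := d) hr
  rw [← integral_integral_swap (f := fun x y => u (x + y) * v x) (integrable_translate_mul hr hu hv h)]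
  refine integral_congr_ae (.of_forall fun x => ?_)
  simp only [average]
  rw [integral_mul_const]

/-- By Fubini the pairing with an average of translates is the average of the pairings, so a bound
common to all translates in the ball survives. -/
lemma norm_integral_average_mul_le (hr : 0 < r) (hu : StronglyMeasurable u)
    (hv : AEStronglyMeasurable v volume)
    (h : ∀ y, Integrable (fun x => u (x + y) * v x) volume ∧ ∫ x, ‖u (x + y) * v x‖ ≤ M)
    {K : ℝ} {c : ℂ} (hK : ∀ y ∈ Metric.ball (0 : Rd d) r, ‖(∫ x, u (x + y) * v x) - c‖ ≤ K) :
    ‖(∫ x, average r u x * v x) - c‖ ≤ K := by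
  have hp := isProbabilityMeasure_ballMeasure (d := d) hr
  have hi : Integrable (fun y => ∫ x, u (x + y) * v x) (ballMeasure d r) :=
    (integrable_translate_mul hr hu hv h).integral_prod_right
  rw [integral_average_mul hr hu hv h]
  have h2 : (∫ y, (∫ x, u (x + y) * v x) ∂(ballMeasure d r)) - c =
      ∫ y, ((∫ x, u (x + y) * v x) - c) ∂(ballMeasure d r) := by
    rw [integral_sub hi (integrable_const _)]; simp
  rw [h2]
  refine (norm_integral_le_of_norm_le_const ((ae_ballMeasure r).mono hK)).trans ?_
  simp

end

lemma integrable_translate_mul_L2 (u v : L2 d) (y : Rd d) :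
    Integrable (fun x => u (x + y) * v x) volume ∧ ∫ x, ‖u (x + y) * v x‖ ≤ ‖u‖ * ‖v‖ := by
  have h := translate_ae y u
  constructor
  · refine (integrable_congr ?_).1 (integrable_mul_L2 (translate y u) v)
    filter_upwards [h] with x hx
    rw [hx]
  · have h1 := integral_norm_mul_le (translate y u) v
    rw [norm_translate] at h1
    refine le_trans (le_of_eq (integral_congr_ae ?_)) h1
    filter_upwards [h] with x hx
    simp only [hx]

lemma integral_translate_mul (u v : L2 d) (y : Rd d) :
    ∫ x, u (x + y) * v x = inner ℂ (star v) (translate y u) := by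
  rw [inner_star_left]
  refine integral_congr_ae ?_
  filter_upwards [translate_ae y u] with x hx
  rw [hx, mul_comm]

lemma continuous_translate_left (u : L2 d) : Continuous fun y => translate y u := by
  let g : C(Rd d, C(Rd d, Rd d)) :=
    (ContinuousMap.mk (fun p : Rd d × Rd d => p.2 + p.1) (by fun_prop)).curry
  exact (continuous_const (y := u)).compMeasurePreservingLp g.continuous
    (fun y => measurePreserving_add_right volume y) (by norm_num)

/-- Coordinatewise `1 + (x+y)² ≤ 2(1+x²)(1+y²)`; therefore translation preserves decay. -/
lemma weight_add_le (x y : Rd d) : weight (x + y) ≤ (∏ j, √(2 * (1 + y j ^ 2))) * weight x := by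
  unfold weight
  rw [← Finset.prod_mul_distrib]
  refine Finset.prod_le_prod (fun j _ => Real.sqrt_nonneg _) fun j _ => ?_
  rw [← Real.sqrt_mul (by positivity)]
  refine Real.sqrt_le_sqrt ?_
  simp only [PiLp.add_apply]
  nlinarith [sq_nonneg (x j - y j), mul_nonneg (sq_nonneg (x j)) (sq_nonneg (y j))]

lemma Nice.translate {ψ : L2 d} (h : Nice ψ) (y : Rd d) : Nice (translate y ψ) := by
  obtain ⟨M, hM⟩ := h
  refine ⟨(∏ j, √(2 * (1 + (-y) j ^ 2))) * M, ?_⟩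
  filter_upwards [translate_ae y ψ, (quasi_add y).ae hM] with x h1 h2
  rw [h1]
  have h3 := weight_add_le (x + y) (-y)
  rw [add_neg_cancel_right] at h3
  calc weight x * ‖ψ (x + y)‖ ≤ (∏ j, √(2 * (1 + (-y) j ^ 2))) * weight (x + y) * ‖ψ (x + y)‖ := by
        gcongr
    _ ≤ _ := by rw [mul_assoc]; gcongr

lemma Nice.exists_conj_mul {φ ψ : L2 d} (hn : Nice ψ) : ∃ v : L2 d, ∀ᵐ x, v x = conj (φ x * ψ x) := by
  obtain ⟨M, hM⟩ := hn
  have h : MemLp (fun x => conj (ψ x) * conj (φ x)) 2 volume := by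
    refine memLp_two_mul_of_le (C := M) (conj_memLp (Lp.memLp ψ)).1 ?_ (conj_memLp (Lp.memLp φ))
    filter_upwards [hM] with x hx
    rw [RCLike.norm_conj]
    nlinarith [one_le_weight x, norm_nonneg (ψ x)]
  refine ⟨h.toLp _, ?_⟩
  filter_upwards [h.coeFn_toLp] with x hx
  rw [hx, map_mul, mul_comm]

/-- A Hankel form with square integrable symbol can be approximated by forms with bounded symbols
without increasing its bound. -/
lemma exists_bounded_symbol {σ : Fin d → ℤˣ} {u : L2 d} {A : ℝ≥0} (hu : BddH σ u A) (g : L2 d)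
    {ε : ℝ} (hε : 0 < ε) : ∃ b : Rd d → ℂ, StronglyMeasurable b ∧ (∃ M : ℝ, ∀ x, ‖b x‖ ≤ M) ∧
      BddH σ b A ∧ ‖pairing b g - pairing u g‖ ≤ ε := by
  have hum : StronglyMeasurable u := Lp.stronglyMeasurable u
  have hconj : ∀ᵐ x, (star g : L2 d) x = conj (g x) := star_ae g
  have hpair : ∀ b : Rd d → ℂ, pairing b g = ∫ x, b x * (star g : L2 d) x := fun b =>
    integral_congr_ae (hconj.mono fun x hx => by simp only [hx])
  obtain ⟨r, hr, hrε⟩ : ∃ r > 0, ∀ y ∈ Metric.ball (0 : Rd d) r,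
      ‖(∫ x, u (x + y) * (star g : L2 d) x) - pairing u g‖ ≤ ε := by
    have hG : Continuous fun y => ∫ x, u (x + y) * (star g : L2 d) x := by
      simp only [integral_translate_mul]
      exact continuous_const.inner (continuous_translate_left u)
    have h0 := Metric.tendsto_nhds_nhds.1 (hG.tendsto 0) ε hε
    obtain ⟨r, hr, h1⟩ := h0
    refine ⟨r, hr, fun y hy => ?_⟩
    have h2 := h1 (x := y) hy
    simp only [add_zero] at h2
    rw [hpair, ← dist_eq_norm]
    exact h2.le
  refine ⟨average r u, stronglyMeasurable_average hr hum, ?_, ?_, ?_⟩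
  · have := isProbabilityMeasure_ballMeasure (d := d) hr
    obtain ⟨M, hM⟩ := integral_ballMeasure_le hr (integrable_norm_sq (Lp.memLp u))
      (fun x => by positivity)
    refine ⟨1 + M, fun x => (norm_integral_le_integral_norm _).trans ?_⟩
    -- The integrable function `‖u‖²` has bounded averages, and `t ≤ 1 + t²`.
    calc ∫ y, ‖u (x + y)‖ ∂(ballMeasure d r) ≤ ∫ y, (1 + ‖u (x + y)‖ ^ 2) ∂(ballMeasure d r) := by
          refine integral_mono_of_nonneg (.of_forall fun y => norm_nonneg _)
            ((integrable_const _).add (hM x).1) (.of_forall fun y => ?_)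
          nlinarith [sq_nonneg (‖u (x + y)‖ - 1), norm_nonneg (u (x + y))]
      _ = 1 + ∫ y, ‖u (x + y)‖ ^ 2 ∂(ballMeasure d r) := by
          rw [integral_add (integrable_const _) (hM x).1]; simp
      _ ≤ 1 + M := by linarith [(hM x).2]
  · intro φ ψ hφ hψ hn
    obtain ⟨v, hv⟩ := hn.exists_conj_mul (φ := φ)
    have h1 : ∫ x, average r u x * conj (φ x * ψ x) = ∫ x, average r u x * v x :=
      integral_congr_ae (hv.mono fun x hx => by simp only [hx])
    rw [h1]
    have := norm_integral_average_mul_le hr hum (Lp.aestronglyMeasurable v)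
      (integrable_translate_mul_L2 u v) (K := A * (‖φ‖ * ‖ψ‖)) (c := 0) (fun y _ => ?_)
    · simpa using this
    · rw [sub_zero]
      -- Translating the symbol amounts to translating both factors backwards, which changes neither
      -- norms nor frequencies. So every translate of `u` has the same Hankel bound.
      have h2 := hu (translate (-y) φ) (translate (-y) ψ) (hφ.translate _) (hψ.translate _) ?_
      · rw [norm_translate, norm_translate] at h2
        convert h2 using 2
        rw [← integral_add_right_eq_self (μ := volume)
          (fun x => u x * conj (translate (-y) φ x * translate (-y) ψ x)) y]
        refine integral_congr_ae ?_
        filter_upwards [hv, (quasi_add y).ae (translate_ae (-y) φ),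
          (quasi_add y).ae (translate_ae (-y) ψ)] with x e1 e2 e3
        rw [e1, e2, e3, add_neg_cancel_right]
      · exact hn.translate _
  · rw [hpair]
    exact norm_integral_average_mul_le hr hum (Lp.aestronglyMeasurable _)
      (integrable_translate_mul_L2 u (star g)) hrε

/-! ### Weighted test functions are dense in the Hardy space -/

lemma exists_translate_near (F : Lp ℂ 1 (volume : Measure (Rd d))) {ε : ℝ} (hε : 0 < ε) :
    ∃ r > 0, ∀ y ∈ Metric.ball (0 : Rd d) r, ∫ x, ‖F (x + y) - F x‖ ≤ ε := by
  let T : Rd d → Lp ℂ 1 (volume : Measure (Rd d)) := fun y =>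
    Lp.compMeasurePreserving (· + y) (measurePreserving_add_right volume y) F
  have hT : Continuous T := by
    let g : C(Rd d, C(Rd d, Rd d)) :=
      (ContinuousMap.mk (fun p : Rd d × Rd d => p.2 + p.1) (by fun_prop)).curry
    exact (continuous_const (y := F)).compMeasurePreservingLp g.continuous
      (fun y => measurePreserving_add_right volume y) (by norm_num)
  have hTae : ∀ y, ∀ᵐ x, T y x = F (x + y) := fun y => Lp.coeFn_compMeasurePreserving _ _
  have h0 : T 0 = F := Lp.ext (by filter_upwards [hTae 0] with x hx; rw [hx, add_zero])
  obtain ⟨r, hr, h1⟩ := Metric.tendsto_nhds_nhds.1 (hT.tendsto 0) ε hε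
  refine ⟨r, hr, fun y hy => ?_⟩
  have h2 := (h1 (x := y) hy).le
  rw [h0, dist_eq_norm, L1.norm_eq_integral_norm] at h2
  refine le_trans (le_of_eq (integral_congr_ae ?_)) h2
  filter_upwards [hTae y, Lp.coeFn_sub (T y) F] with x e1 e2
  rw [e2, Pi.sub_apply, e1]

lemma character_translate (ξ x y : Rd d) : character ξ (x + y) = character ξ x * character ξ y := by
  unfold character
  rw [inner_add_left, AddChar.map_add_eq_mul, Circle.coe_mul]

/-- Averages of an integrable function are bounded and integrable, hence in `L²`. Translation only
multiplies the transform by a character, so the average keeps its vanishing frequencies. -/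
lemma HardySign.exists_average {σ : Fin d → ℤˣ} {u : Rd d → ℂ} (hu : HardySign σ u)
    (hum : StronglyMeasurable u) {r : ℝ} (hr : 0 < r) {ε : ℝ}
    (h : ∀ y ∈ Metric.ball (0 : Rd d) r, ∫ x, ‖u (x + y) - u x‖ ≤ ε) :
    ∃ g : L2 d, Spec σ g ∧ Integrable g volume ∧ ∫ x, ‖g x - u x‖ ≤ ε := by
  have := isProbabilityMeasure_ballMeasure (d := d) hr
  have hint : ∀ v : Rd d → ℂ, Continuous v → (∀ x, ‖v x‖ = 1) → ∀ y,
      Integrable (fun x => u (x + y) * v x) volume ∧ ∫ x, ‖u (x + y) * v x‖ ≤ ∫ x, ‖u x‖ := by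
    intro v hv hv1 y
    constructor
    · refine ((hu.1.comp_add_right y).bdd_mul (c := 1) hv.aestronglyMeasurable
        (.of_forall fun x => (hv1 x).le)).congr (.of_forall fun x => mul_comm _ _)
    · simp only [norm_mul, hv1, mul_one]
      rw [integral_add_right_eq_self (fun x => ‖u x‖) y]
  obtain ⟨M, hM⟩ := integral_ballMeasure_le hr hu.1.norm fun x => norm_nonneg _
  have hbd : ∀ x, ‖average r u x‖ ≤ M := fun x => (norm_integral_le_integral_norm _).trans (hM x).2
  have hsm := stronglyMeasurable_average hr hum
  have hprod : Integrable (fun p : Rd d × Rd d => u (p.1 + p.2) - u p.1)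
      (volume.prod (ballMeasure d r)) := by
    refine Integrable.sub ?_ (hu.1.comp_fst _)
    have := integrable_translate_mul hr hum (v := fun _ => 1) (M := ∫ x, ‖u x‖)
      aestronglyMeasurable_const (hint _ continuous_const (by simp))
    simpa using this
  have hdiff : ∀ x, average r u x - u x = ∫ y, (u (x + y) - u x) ∂(ballMeasure d r) := by
    intro x
    have h1 : Integrable (fun y => u (x + y)) (ballMeasure d r) :=
      (integrable_norm_iff (hum.comp_measurable (measurable_const_add x)).aestronglyMeasurable).1 (hM x).1
    rw [integral_sub h1 (integrable_const _)]
    simp [average]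
  have hdi : Integrable (fun x => average r u x - u x) volume := by
    simp only [hdiff]
    exact hprod.integral_prod_left
  have hai : Integrable (average r u) volume :=
    (hdi.add hu.1).congr (.of_forall fun x => by simp)
  have hL1 : ∫ x, ‖average r u x - u x‖ ≤ ε := by
    simp only [hdiff]
    calc _ ≤ ∫ x, (∫ y, ‖u (x + y) - u x‖ ∂(ballMeasure d r)) := by
          refine integral_mono_of_nonneg (.of_forall fun x => norm_nonneg _)
            hprod.norm.integral_prod_left (.of_forall fun x => norm_integral_le_integral_norm _)
      _ = ∫ y, (∫ x, ‖u (x + y) - u x‖) ∂(ballMeasure d r) :=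
          integral_integral_swap (f := fun x y => ‖u (x + y) - u x‖) hprod.norm
      _ ≤ ∫ _, ε ∂(ballMeasure d r) := by
          refine integral_mono_ae hprod.norm.integral_prod_right (integrable_const _) ?_
          filter_upwards [ae_ballMeasure r] with y hy using h y hy
      _ = ε := by simp
  have hL2 : MemLp (average r u) 2 volume := by
    rw [memLp_two_iff_integrable_sq_norm hsm.aestronglyMeasurable]
    refine (hai.norm.bdd_mul (c := M) hsm.aestronglyMeasurable.norm
      (.of_forall fun x => by simpa using hbd x)).congr (.of_forall fun x => by simp only [sq])
  have hae := hL2.coeFn_toLp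
  have hgi : Integrable (hL2.toLp (average r u)) volume := (integrable_congr hae).2 hai
  refine ⟨hL2.toLp _, ?_, hgi, ?_⟩
  · rw [spec_iff_hardySign hgi]
    refine HardySign.congr ⟨hai, fun ξ hξ => ?_⟩ (hae.mono fun x hx => hx.symm)
    -- With `K = 0` the averaging bound says that the Fourier integral vanishes.
    have h1 := norm_integral_average_mul_le hr hum (v := character (-ξ)) (M := ∫ x, ‖u x‖) (K := 0)
      (c := 0) (continuous_character _).aestronglyMeasurable
      (hint _ (continuous_character _) (norm_character _)) (fun y _ => ?_)
    · rw [sub_zero, norm_le_zero_iff] at h1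
      rw [fourier_eq_character, ← h1]
      simp only [mul_comm]
    · rw [sub_zero, norm_le_zero_iff]
      have h2 := hu.2 ξ hξ
      rw [fourier_eq_character] at h2
      rw [← integral_add_right_eq_self (μ := volume) (fun x => u (x + y) * character (-ξ) x) (-y)]
      simp only [neg_add_cancel_right, character_translate]
      have : ∀ x, u x * (character (-ξ) x * character (-ξ) (-y)) =
          (character (-ξ) x * u x) * character (-ξ) (-y) := fun x => by ring
      simp only [this]
      rw [integral_mul_const, h2, zero_mul]
  · refine le_trans (le_of_eq (integral_congr_ae ?_)) hL1
    filter_upwards [hae] with x hx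
    rw [hx]

/-- Averaging over a small ball reaches `L²`, and damping then reaches the weighted class; both are
small perturbations in `L¹`. -/
lemma HardySign.exists_inE_near {σ : Fin d → ℤˣ} {f : Rd d → ℂ} (hf : HardySign σ f) {ε : ℝ}
    (hε : 0 < ε) : ∃ g : L2 d, InE σ g ∧ ∫ x, ‖g x - f x‖ ≤ ε := by
  have hF : ∀ᵐ x, hf.1.toL1 f x = f x := hf.1.coeFn_toL1
  obtain ⟨r, hr, h1⟩ := exists_translate_near (hf.1.toL1 f) (half_pos hε)
  obtain ⟨h, h2, h3, h4⟩ := (hf.congr (hF.mono fun x hx => hx.symm)).exists_average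
    (Lp.stronglyMeasurable _) hr h1
  have hlim : Filter.Tendsto (fun n => ∫ x, ‖damp σ (scale n) x * h x - h x‖) Filter.atTop
      (nhds (∫ _ : Rd d, (0 : ℝ))) := by
    refine tendsto_integral_of_dominated_convergence (fun x => 2 * ‖h x‖)
      (fun n => (((isContractor_damp σ (scale n)).meas.mul h3.1).sub h3.1).norm)
      (h3.norm.const_mul 2) (fun n => .of_forall fun x => ?_) (.of_forall fun x => ?_)
    · rw [norm_norm]
      refine (norm_sub_le _ _).trans ?_
      rw [norm_mul]
      nlinarith [norm_damp_le σ (scale n) x, norm_nonneg (h x)]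
    · simpa using ((((tendsto_damp σ x tendsto_scale).mul_const (h x)).sub_const (h x)).norm)
  simp only [integral_zero] at hlim
  obtain ⟨n, hn⟩ := (hlim.eventually_lt_const (half_pos hε)).exists
  have hm := mulUnit_ae (isContractor_damp σ (scale n)) h
  have hE := h2.inE_damp (scale_pos n) (scale_le_one n)
  refine ⟨_, hE, ?_⟩
  have hi1 : Integrable (fun x => damp σ (scale n) x * h x - h x) volume :=
    ((integrable_congr hm).1 hE.integrable).sub h3
  have hi2 : Integrable (fun x => h x - hf.1.toL1 f x) volume := h3.sub (L1.integrable_coeFn _)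
  calc ∫ x, ‖mulUnit (damp σ (scale n)) h x - f x‖
      ≤ ∫ x, (‖damp σ (scale n) x * h x - h x‖ + ‖h x - hf.1.toL1 f x‖) := by
        refine integral_mono_of_nonneg (.of_forall fun x => norm_nonneg _)
          (hi1.norm.add hi2.norm) ?_
        filter_upwards [hm, hF] with x e1 e2
        rw [e1, e2]
        refine le_trans (le_of_eq ?_) (norm_add_le _ _)
        congr 1; ring
    _ = _ := integral_add hi1.norm hi2.norm
    _ ≤ ε := by linarith

/-! ### Weak factorization bounds the Hankel forms from below -/

/-- The projective tensor norm is dominated by the `L¹` norm on the Hardy space. -/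
def WeakFactorization (d : ℕ) : Prop :=
  ∃ C : ℝ≥0, ∀ f : Rd d → ℂ, HardyOne f → tensorNorm f ≤ C * eLpNorm f 1 volume

lemma enorm_mul_eq (φ ψ : L2 d) : ‖φ‖ₑ * ‖ψ‖ₑ = ENNReal.ofReal (‖φ‖ * ‖ψ‖) := by
  rw [ENNReal.ofReal_mul (norm_nonneg _), ofReal_norm, ofReal_norm]

/-- Boundedness of `b` is what allows the series to be integrated term by term, and also removes the
decay condition on the factors by continuity. The bound `M` does not enter the conclusion, so
bounded symbols may approximate others. -/
lemma norm_pairing_le_of_hasSum {b : Rd d → ℂ} (hbm : StronglyMeasurable b) {M : ℝ}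
    (hM : ∀ x, ‖b x‖ ≤ M) {A : ℝ≥0} (hb : BddH 1 b A) {φ ψ : ℕ → L2 d}
    (h1 : ∀ j, φ j ∈ hardyTwo d ∧ ψ j ∈ hardyTwo d) {g : L2 d}
    (hg : ∀ᵐ x, HasSum (fun j => φ j x * ψ j x) (g x)) (hs : Summable fun j => ‖φ j‖ * ‖ψ j‖) :
    ‖pairing b g‖ ≤ A * ∑' j, ‖φ j‖ * ‖ψ j‖ := by
  have hmem : ∀ φ : L2 d, MemLp (fun x => b x * conj (φ x)) 2 volume := fun φ =>
    memLp_two_mul_of_le hbm.aestronglyMeasurable (.of_forall hM) (conj_memLp (Lp.memLp φ))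
  have hall : ∀ φ ψ : L2 d, Spec 1 φ → Spec 1 ψ →
      ‖∫ x, b x * conj (φ x * ψ x)‖ ≤ A * (‖φ‖ * ‖ψ‖) := by
    intro φ ψ hφ hψ
    have := le_of_forall_nice (σ := (1 : Fin d → ℤˣ))
      (u := fun ψ => ‖(inner ℂ ψ ((hmem φ).toLp _) : ℂ)‖)
      (v := fun ψ => A * (‖φ‖ * ‖ψ‖)) (by fun_prop) (by fun_prop) (fun ψ hψ hn => ?_) hψ
    · rwa [inner_toLp_mul_conj] at this
    · rw [inner_toLp_mul_conj]
      exact hb φ ψ hφ hψ hn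
  have hint : ∀ j, Integrable (fun x => b x * conj (φ j x * ψ j x)) volume := fun j => by
    refine Integrable.bdd_mul (c := M) ?_ hbm.aestronglyMeasurable (.of_forall hM)
    exact (Complex.conjLIE.toContinuousLinearEquiv : ℂ →L[ℝ] ℂ).integrable_comp
      (integrable_mul_L2 (φ j) (ψ j))
  have hM0 : 0 ≤ M := (norm_nonneg _).trans (hM 0)
  have hnorm : ∀ j, ∫ x, ‖b x * conj (φ j x * ψ j x)‖ ≤ M * (‖φ j‖ * ‖ψ j‖) := fun j => by
    refine le_trans ?_ (mul_le_mul_of_nonneg_left (integral_norm_mul_le (φ j) (ψ j)) hM0)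
    rw [← integral_const_mul]
    refine integral_mono_of_nonneg (.of_forall fun x => norm_nonneg _)
      ((integrable_mul_L2 (φ j) (ψ j)).norm.const_mul M) (.of_forall fun x => ?_)
    simp only [norm_mul, RCLike.norm_conj]
    have := hM x
    gcongr
  have h2 := hasSum_integral_of_summable_integral_norm hint
    (Summable.of_nonneg_of_le (fun j => integral_nonneg fun x => norm_nonneg _) hnorm (hs.mul_left M))
  have h3 : ∫ x, ∑' j, b x * conj (φ j x * ψ j x) = pairing b g := by
    refine integral_congr_ae ?_
    filter_upwards [hg] with x hx
    exact (((Complex.hasSum_conj'.2 hx).mul_left (b x)).tsum_eq)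
  rw [h3] at h2
  rw [← h2.tsum_eq, ← tsum_mul_left]
  refine tsum_of_norm_bounded (hs.mul_left (A : ℝ)).hasSum fun j => ?_
  exact hall _ _ (spec_one_iff.2 (h1 j).1) (spec_one_iff.2 (h1 j).2)

/-- A factorization of `g` estimates the pairing for bounded symbols. Averaging translates extends
this to `L²` symbols and damping to all symbols; neither increases the bound of the Hankel form. -/
lemma WeakFactorization.hankelEstimate (h : WeakFactorization d) : HankelEstimate d := by
  obtain ⟨C, hC⟩ := h
  -- bounded symbols
  have hbdd : ∀ b : Rd d → ℂ, StronglyMeasurable b → (∃ M : ℝ, ∀ x, ‖b x‖ ≤ M) → ∀ A : ℝ≥0,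
      BddH 1 b A → ∀ g, InE 1 g → ‖pairing b g‖ ≤ C * A * ∫ x, ‖g x‖ := by
    rintro b hbm ⟨M, hM⟩ A hA g hg
    have hT := hC g (hardySign_one_iff.1 ((spec_iff_hardySign hg.integrable).1 hg.1))
    rw [eLpNorm_one_eq hg.integrable] at hT
    set R := ∫ x, ‖g x‖ with hR
    have hR0 : 0 ≤ R := integral_nonneg fun x => norm_nonneg _
    refine le_of_forall_pos_le_add fun η hη => ?_
    -- The infimum need not be attained. Slack `η / (A + 1)` costs at most `η` after multiplication
    -- by `A`, also when `A = 0`.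
    have hη' : 0 < η / (A + 1) := by positivity
    have h1 : tensorNorm g < ENNReal.ofReal (C * R + η / (A + 1)) := by
      refine hT.trans_lt ?_
      rw [← ENNReal.ofReal_coe_nnreal, ← ENNReal.ofReal_mul (NNReal.coe_nonneg C)]
      exact (ENNReal.ofReal_lt_ofReal_iff (by positivity)).2 (by linarith)
    unfold tensorNorm at h1
    simp only [iInf_lt_iff] at h1
    obtain ⟨φ, ψ, h2, h3, h4⟩ := h1
    simp only [enorm_mul_eq] at h4
    have hs : Summable fun j => ‖φ j‖ * ‖ψ j‖ := by
      have := ENNReal.summable_toReal (h4.trans ENNReal.ofReal_lt_top).ne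
      simpa [ENNReal.toReal_ofReal, mul_nonneg] using this
    rw [← ENNReal.ofReal_tsum_of_nonneg (fun j => by positivity) hs,
      ENNReal.ofReal_lt_ofReal_iff (by positivity)] at h4
    refine (norm_pairing_le_of_hasSum hbm hM hA h2 h3 hs).trans ?_
    calc (A : ℝ) * ∑' j, ‖φ j‖ * ‖ψ j‖ ≤ A * (C * R + η / (A + 1)) := by gcongr
      _ = C * A * R + A / (A + 1) * η := by ring
      _ ≤ C * A * R + 1 * η := by
          gcongr
          exact (div_le_one (by positivity)).2 (by linarith)
      _ = _ := by ring
  refine ⟨C, fun b hb A hA g hg => ?_⟩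
  refine le_of_tendsto (tendsto_pairing_damp (σ := 1) (hb.integrable_mul_conj hg.2)).norm
    (.of_forall fun n => ?_)
  -- square integrable symbols
  have hmem : MemLp (fun x => b x * conj (damp 1 (scale n) x)) 2 volume := by
    have h1 : MemLp (fun x => ((weight x : ℂ) * conj (damp 1 (scale n) x)) * (b x / (weight x : ℂ))) 2
        volume := by
      refine memLp_two_mul_of_le (C := ((scale n)⁻¹) ^ d)
        ((Complex.continuous_ofReal.comp continuous_weight).mul
          (Complex.continuous_conj.comp (continuous_damp 1 (scale n)))).aestronglyMeasurable
        (.of_forall fun x => ?_) (isSymbol_iff.1 hb)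
      rw [norm_mul, RCLike.norm_conj, Complex.norm_real, Real.norm_of_nonneg (weight_pos x).le]
      exact weight_mul_norm_damp_le 1 (scale_pos n) (scale_le_one n) x
    refine h1.ae_eq (.of_forall fun x => ?_)
    have := weight_ne_zero x
    simp only
    field_simp
  set u : L2 d := hmem.toLp _ with hu
  have hue : ∀ᵐ x, u x = b x * conj (damp 1 (scale n) x) := hmem.coeFn_toLp
  -- The damping of the symbol is moved to `φ`, where it is a contraction preserving the orthant.
  have huH : BddH 1 u A := by
    intro φ ψ hφ hψ hn
    have h1 := hA _ ψ (hφ.damp (scale_pos n).le) hψ hn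
    refine le_trans (le_of_eq (congrArg _ (integral_congr_ae ?_)))
      (h1.trans (mul_le_mul_of_nonneg_left (mul_le_mul_of_nonneg_right
        (norm_mulUnit_le (isContractor_damp 1 (scale n)) φ) (norm_nonneg _)) A.2))
    filter_upwards [hue, mulUnit_ae (isContractor_damp 1 (scale n)) φ] with x e1 e2
    rw [e1, e2, map_mul, map_mul, map_mul]; ring
  have hpu : ∫ x, b x * conj (damp 1 (scale n) x * g x) = pairing u g := by
    refine integral_congr_ae ?_
    filter_upwards [hue] with x hx
    rw [hx, map_mul]; ring
  rw [hpu]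
  refine le_of_forall_pos_le_add fun η hη => ?_
  obtain ⟨b', hb1, hb2, hb3, hb4⟩ := exists_bounded_symbol huH g hη
  have h5 := hbdd b' hb1 hb2 A hb3 g hg
  have h6 : ‖pairing u g‖ ≤ ‖pairing b' g‖ + ‖pairing b' g - pairing u g‖ := by
    have := norm_sub_le (pairing b' g) (pairing b' g - pairing u g)
    rwa [sub_sub_cancel] at this
  push_cast
  linarith

/-! ### Hankel estimates imply weak factorization -/

/-- `L¹(ℝ^d)`. -/
abbrev L1d (d : ℕ) : Type := Lp ℂ 1 (volume : Measure (Rd d))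

/-- The product of two square integrable functions, in `L¹`. -/
def mulL1 (φ ψ : L2 d) : L1d d := (integrable_mul_L2 φ ψ).toL1 _

lemma mulL1_ae (φ ψ : L2 d) : ∀ᵐ x, mulL1 φ ψ x = φ x * ψ x := Integrable.coeFn_toL1 _

lemma norm_mulL1_le (φ ψ : L2 d) : ‖mulL1 φ ψ‖ ≤ ‖φ‖ * ‖ψ‖ := by
  rw [L1.norm_eq_integral_norm]
  refine le_trans (le_of_eq (integral_congr_ae ?_)) (integral_norm_mul_le φ ψ)
  filter_upwards [mulL1_ae φ ψ] with x hx
  rw [hx]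

lemma mulL1_smul (c : ℂ) (φ ψ : L2 d) : mulL1 (c • φ) ψ = c • mulL1 φ ψ := by
  refine Lp.ext ?_
  filter_upwards [mulL1_ae (c • φ) ψ, mulL1_ae φ ψ, Lp.coeFn_smul c φ, Lp.coeFn_smul c (mulL1 φ ψ)]
    with x h1 h2 h3 h4
  rw [h1, h3, h4, Pi.smul_apply, Pi.smul_apply, h2, smul_eq_mul, smul_eq_mul, mul_assoc]

/-- The finite sums of products of functions in `H²` with total norm at most `R`. -/
def finiteProducts (d : ℕ) (R : ℝ) : Set (L1d d) :=
  {F | ∃ (ι : Type) (_ : Fintype ι) (φ ψ : ι → L2 d), (∀ i, Spec 1 (φ i) ∧ Spec 1 (ψ i)) ∧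
    F = ∑ i, mulL1 (φ i) (ψ i) ∧ ∑ i, ‖φ i‖ * ‖ψ i‖ ≤ R}

lemma mulL1_mem {R : ℝ} {φ ψ : L2 d} (hφ : Spec 1 φ) (hψ : Spec 1 ψ) (h : ‖φ‖ * ‖ψ‖ ≤ R) :
    mulL1 φ ψ ∈ finiteProducts d R :=
  ⟨Unit, inferInstance, fun _ => φ, fun _ => ψ, fun _ => ⟨hφ, hψ⟩, by simp, by simpa using h⟩

lemma convex_finiteProducts (R : ℝ) : Convex ℝ (finiteProducts d R) := by
  rintro F ⟨ι, _, φ, ψ, h1, rfl, h2⟩ G ⟨κ, _, φ', ψ', h1', rfl, h2'⟩ a b ha hb hab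
  refine ⟨ι ⊕ κ, inferInstance, Sum.elim (fun i => (a : ℂ) • φ i) (fun i => (b : ℂ) • φ' i),
    Sum.elim ψ ψ', ?_, ?_, ?_⟩
  · rintro (i | i)
    · exact ⟨(h1 i).1.smul _, (h1 i).2⟩
    · exact ⟨(h1' i).1.smul _, (h1' i).2⟩
  · rw [Fintype.sum_sum_type]
    simp only [Sum.elim_inl, Sum.elim_inr, mulL1_smul, ← Finset.smul_sum]
    have hs : ∀ (c : ℝ) (F : L1d d), (c : ℂ) • F = c • F := fun c F => by
      refine Lp.ext ?_
      filter_upwards [Lp.coeFn_smul (c : ℂ) F, Lp.coeFn_smul c F] with x e1 e2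
      rw [e1, e2, Pi.smul_apply, Pi.smul_apply, Complex.coe_smul]
    rw [hs, hs]
  · rw [Fintype.sum_sum_type]
    simp only [Sum.elim_inl, Sum.elim_inr, norm_smul, Complex.norm_real, Real.norm_of_nonneg ha,
      Real.norm_of_nonneg hb, mul_assoc, ← Finset.mul_sum]
    calc a * ∑ i, ‖φ i‖ * ‖ψ i‖ + b * ∑ i, ‖φ' i‖ * ‖ψ' i‖ ≤ a * R + b * R := by gcongr
      _ = R := by rw [← add_mul, hab, one_mul]

lemma HardySign.sub {σ : Fin d → ℤˣ} {f g : Rd d → ℂ} (hf : HardySign σ f) (hg : HardySign σ g) :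
    HardySign σ (fun x => f x - g x) := by
  refine ⟨hf.1.sub hg.1, fun ξ hξ => ?_⟩
  have h1 := hf.2 ξ hξ
  have h2 := hg.2 ξ hξ
  have hb : ∀ f : Rd d → ℂ, Integrable f volume →
      Integrable (fun x => character (-ξ) x * f x) volume := fun f hf =>
    hf.bdd_mul (c := 1) (continuous_character _).aestronglyMeasurable
      (.of_forall fun x => (norm_character _ x).le)
  rw [fourier_eq_character] at h1 h2 ⊢
  simp only [mul_sub]
  rw [integral_sub (hb f hf.1) (hb g hg.1), h1, h2, sub_zero]

/-- The weighted test function `g` as an element of `L¹`. -/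
lemma InE.norm_toL1 {σ : Fin d → ℤˣ} {g : L2 d} (hg : InE σ g) :
    ‖hg.integrable.toL1 g‖ = ∫ x, ‖g x‖ := by
  rw [L1.norm_of_fun_eq_integral_norm]

/-- A functional on `L¹` is given by a symbol on weighted functions. -/
lemma exists_symbol (Λ : StrongDual ℂ (L1d d)) : ∃ b : Rd d → ℂ, IsSymbol b ∧
    ∀ (σ : Fin d → ℤˣ) (g : L2 d) (hg : InE σ g), ‖pairing b g‖ = ‖Λ (hg.integrable.toL1 g)‖ := by
  set ω : L2 d := memLp_inv_weight.toLp _ with hω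
  have hωae : ∀ᵐ x, ω x = (((weight x)⁻¹ : ℝ) : ℂ) := memLp_inv_weight.coeFn_toLp
  -- Division by the weight maps `L²` into `L¹`. Pulling `Λ` back along it gives a functional on
  -- `L²`, represented by some `k`; the symbol is `weight · k`.
  let T : L2 d →ₗ[ℂ] L1d d :=
    { toFun := fun h => mulL1 h ω
      map_add' := fun f g => by
        refine Lp.ext ?_
        filter_upwards [mulL1_ae (f + g) ω, mulL1_ae f ω, mulL1_ae g ω, Lp.coeFn_add f g,
          Lp.coeFn_add (mulL1 f ω) (mulL1 g ω)] with x h1 h2 h3 h4 h5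
        rw [h1, h4, h5, Pi.add_apply, Pi.add_apply, h2, h3, add_mul]
      map_smul' := fun c f => mulL1_smul c f ω }
  let T' : L2 d →L[ℂ] L1d d := T.mkContinuous ‖ω‖ fun h => by
    rw [mul_comm]; exact norm_mulL1_le h ω
  set k : L2 d := (InnerProductSpace.toDual ℂ (L2 d)).symm (Λ.comp T') with hk
  have hkΛ : ∀ h : L2 d, inner ℂ k h = Λ (mulL1 h ω) := fun h => by
    rw [hk, InnerProductSpace.toDual_symm_apply]; rfl
  refine ⟨fun x => (weight x : ℂ) * k x, ?_, fun σ g hg => ?_⟩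
  · rw [isSymbol_iff]
    refine (Lp.memLp k).ae_eq (.of_forall fun x => ?_)
    simp only
    rw [mul_div_cancel_left₀ _ (weight_ne_zero x)]
  · have h1 : mulL1 (hg.2.toLp _) ω = hg.integrable.toL1 g := by
      refine Lp.ext ?_
      filter_upwards [mulL1_ae (hg.2.toLp _) ω, hωae, hg.2.coeFn_toLp, hg.integrable.coeFn_toL1]
        with x e1 e2 e3 e4
      rw [e1, e2, e3, e4]
      have := weight_ne_zero x
      push_cast
      field_simp
    rw [← h1, ← hkΛ, norm_inner_symm, L2.inner_def]
    congr 1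
    refine integral_congr_ae ?_
    filter_upwards [hg.2.coeFn_toLp] with x hx
    rw [hx]
    simp
    ring

/-- A Hankel estimate puts the functions in the Hardy space in the closed convex hull of
products. -/
lemma mem_closure_finiteProducts {C : ℝ≥0}
    (hC : ∀ b : Rd d → ℂ, IsSymbol b → ∀ A : ℝ≥0, BddH 1 b A → BddE 1 b (C * A)) {F : L1d d}
    (hF : HardyOne F) {R : ℝ} (hR : 0 < R) (hFR : C * ‖F‖ ≤ R) : F ∈ closure (finiteProducts d R) := by
  by_contra hne
  obtain ⟨Λ, u, h1, h2⟩ := RCLike.geometric_hahn_banach_closed_point (𝕜 := ℂ)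
    (convex_finiteProducts R).closure isClosed_closure hne
  replace h1 : ∀ G ∈ finiteProducts d R, (Λ G).re < u := fun G hG => h1 G (subset_closure hG)
  replace h2 : u < (Λ F).re := h2
  have hu : 0 < u := by
    have := h1 0 ⟨Empty, inferInstance, Empty.elim, Empty.elim, fun i => i.elim, by simp,
      by simpa using hR.le⟩
    simpa using this
  -- Separation bounds `Re Λ` by `u` on products of size `R`, so `Λ` is a Hankel form of norm at
  -- most `u / R`.
  set A : ℝ≥0 := ⟨u / R, by positivity⟩ with hA
  have hΛ : ∀ φ ψ : L2 d, Spec 1 φ → Spec 1 ψ → ‖Λ (mulL1 φ ψ)‖ ≤ A * (‖φ‖ * ‖ψ‖) := by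
    intro φ ψ hφ hψ
    set z := Λ (mulL1 φ ψ) with hz
    by_cases hz0 : z = 0
    · rw [hz0, norm_zero]; positivity
    have hzp : 0 < ‖z‖ := norm_pos_iff.2 hz0
    have hpos : 0 < ‖φ‖ * ‖ψ‖ := by
      rcases eq_or_lt_of_le (show 0 ≤ ‖φ‖ * ‖ψ‖ by positivity) with h | h
      · exfalso
        have h3 : mulL1 φ ψ = 0 := norm_le_zero_iff.1 ((norm_mulL1_le φ ψ).trans h.ge)
        exact hz0 (by rw [hz, h3, map_zero])
      · exact h
    -- The scalar brings the product to size exactly `R` and rotates its value under `Λ` to be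
    -- positive.
    set c : ℂ := ((R / (‖φ‖ * ‖ψ‖ * ‖z‖) : ℝ) : ℂ) * conj z with hc
    have hcn : ‖c‖ = R / (‖φ‖ * ‖ψ‖) := by
      rw [hc, norm_mul, RCLike.norm_conj, Complex.norm_real, Real.norm_of_nonneg (by positivity)]
      field_simp
    have h3 := h1 (mulL1 (c • φ) ψ) (mulL1_mem (hφ.smul c) hψ (by
      rw [norm_smul, hcn, mul_assoc, div_mul_cancel₀ _ hpos.ne']))
    rw [mulL1_smul, map_smul, smul_eq_mul, ← hz, hc, mul_assoc, ← Complex.normSq_eq_conj_mul_self,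
      ← Complex.ofReal_mul, Complex.ofReal_re, Complex.normSq_eq_norm_sq] at h3
    have h4 : R / (‖φ‖ * ‖ψ‖ * ‖z‖) * ‖z‖ ^ 2 = R * ‖z‖ / (‖φ‖ * ‖ψ‖) := by
      field_simp
    rw [h4, div_lt_iff₀ hpos] at h3
    change ‖z‖ ≤ u / R * (‖φ‖ * ‖ψ‖)
    rw [div_mul_eq_mul_div, le_div_iff₀ hR]
    linarith
  obtain ⟨b, hb, hbΛ⟩ := exists_symbol Λ
  have hbH : BddH 1 b A := by
    intro φ ψ hφ hψ hn
    obtain ⟨g, hg, hgf⟩ := exists_inE_mul hφ hψ hn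
    rw [← pairing_congr hgf, hbΛ 1 g hg]
    have : hg.integrable.toL1 g = mulL1 φ ψ := by
      refine Lp.ext ?_
      filter_upwards [hg.integrable.coeFn_toL1, hgf, mulL1_ae φ ψ] with x e1 e2 e3
      rw [e1, e2, e3]
    rw [this]
    exact hΛ φ ψ hφ hψ
  have hbE := hC b hb A hbH
  -- The symbol represents `Λ` on weighted test functions only, so `F` is approximated by these in
  -- `L¹`.
  have hfin : ∀ ε > 0, ‖Λ F‖ ≤ C * A * (‖F‖ + ε) + ‖Λ‖ * ε := by
    intro ε hε
    obtain ⟨g, hg, hgε⟩ := (hardySign_one_iff.2 hF).exists_inE_near hε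
    set G := hg.integrable.toL1 g with hG
    have hGF : ‖G - F‖ ≤ ε := by
      rw [L1.norm_eq_integral_norm]
      refine le_trans (le_of_eq (integral_congr_ae ?_)) hgε
      filter_upwards [Lp.coeFn_sub G F, hg.integrable.coeFn_toL1] with x e1 e2
      rw [e1, Pi.sub_apply, e2]
    have h3 : ‖Λ G‖ ≤ C * A * ‖G‖ := by
      have := hbE g hg
      rw [hbΛ 1 g hg, ← hg.norm_toL1] at this
      simpa using this
    have h4 : ‖G‖ ≤ ‖F‖ + ε := by
      have := norm_add_le F (G - F)
      rw [add_sub_cancel] at this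
      linarith
    have h5 : ‖Λ F‖ ≤ ‖Λ G‖ + ‖Λ (G - F)‖ := by
      have := norm_sub_le (Λ G) (Λ (G - F))
      rwa [← map_sub, sub_sub_cancel] at this
    have h6 : ‖Λ (G - F)‖ ≤ ‖Λ‖ * ε := (Λ.le_opNorm _).trans (by gcongr)
    have h7 : (C : ℝ) * A * ‖G‖ ≤ C * A * (‖F‖ + ε) := by gcongr
    linarith
  have hlim : ‖Λ F‖ ≤ C * A * ‖F‖ := by
    refine le_of_forall_pos_le_add fun η hη => ?_
    have hK : 0 < C * A + ‖Λ‖ + 1 := by positivity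
    have h3 := hfin (η / (C * A + ‖Λ‖ + 1)) (by positivity)
    have h4 : (C * A + ‖Λ‖) * (η / (C * A + ‖Λ‖ + 1)) ≤ η := by
      rw [mul_div_assoc', div_le_iff₀ hK]
      nlinarith
    linarith
  -- This contradicts `u < Re Λ F`.
  have h5 : (C : ℝ) * A * ‖F‖ ≤ u := by
    change (C : ℝ) * (u / R) * ‖F‖ ≤ u
    calc (C : ℝ) * (u / R) * ‖F‖ = u / R * (C * ‖F‖) := by ring
      _ ≤ u / R * R := by gcongr
      _ = u := by field_simp
  linarith [Complex.re_le_norm (Λ F)]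

lemma tensorNorm_le_of_countable {ι : Type*} [Countable ι] {φ ψ : ι → L2 d} {f : Rd d → ℂ}
    (h1 : ∀ i, Spec 1 (φ i) ∧ Spec 1 (ψ i)) (hf : ∀ᵐ x, HasSum (fun i => φ i x * ψ i x) (f x)) :
    tensorNorm f ≤ ∑' i, ‖φ i‖ₑ * ‖ψ i‖ₑ := by
  obtain ⟨e, he⟩ := exists_injective_nat ι
  set φ' : ℕ → L2 d := Function.extend e φ 0 with hφ'
  set ψ' : ℕ → L2 d := Function.extend e ψ 0 with hψ'
  have e1 : ∀ i, φ' (e i) = φ i := fun i => he.extend_apply φ 0 i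
  have e2 : ∀ i, ψ' (e i) = ψ i := fun i => he.extend_apply ψ 0 i
  have e3 : ∀ n, n ∉ Set.range e → φ' n = 0 := fun n hn => by
    rw [hφ', Function.extend_apply' _ _ _ (fun ⟨a, ha⟩ => hn ⟨a, ha⟩)]; rfl
  have e4 : ∀ n, n ∉ Set.range e → ψ' n = 0 := fun n hn => by
    rw [hψ', Function.extend_apply' _ _ _ (fun ⟨a, ha⟩ => hn ⟨a, ha⟩)]; rfl
  have hz : Spec 1 (0 : L2 d) := by
    unfold Spec; rw [← projL_apply, map_zero]
  have hsum : ∑' n, ‖φ' n‖ₑ * ‖ψ' n‖ₑ = ∑' i, ‖φ i‖ₑ * ‖ψ i‖ₑ := by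
    rw [← he.tsum_eq]
    · simp only [e1, e2]
    · intro n hn
      by_contra h
      exact hn (by simp [e3 n h])
  rw [← hsum]
  unfold tensorNorm
  refine iInf_le_of_le φ' (iInf_le_of_le ψ' (iInf_le_of_le (fun n => ?_) (iInf_le _ ?_)))
  · by_cases hn : n ∈ Set.range e
    · obtain ⟨i, rfl⟩ := hn
      rw [e1, e2]
      exact ⟨spec_one_iff.1 (h1 i).1, spec_one_iff.1 (h1 i).2⟩
    · rw [e3 n hn, e4 n hn]
      exact ⟨spec_one_iff.1 hz, spec_one_iff.1 hz⟩
  · filter_upwards [hf, zero_ae] with x hx h0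
    rw [← he.hasSum_iff]
    · simpa only [Function.comp_def, e1, e2] using hx
    · intro n hn
      rw [e3 n hn, h0, zero_mul]

/-- Products stay in the Hardy space, so the remainder of an approximation can be approximated
again. -/
lemma hardyOne_finiteProducts {R : ℝ} {F G : L1d d} (hF : HardyOne F) (hG : G ∈ finiteProducts d R) :
    HardyOne (F - G : L1d d) := by
  obtain ⟨ι, _, φ, ψ, h1, rfl, -⟩ := hG
  classical
  have key : ∀ s : Finset ι, HardySign 1 (F - ∑ i ∈ s, mulL1 (φ i) (ψ i) : L1d d) := by
    intro s
    induction s using Finset.induction_on with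
    | empty => simpa using hardySign_one_iff.2 hF
    | insert a s ha ih =>
      rw [Finset.sum_insert ha, add_comm, ← sub_sub]
      refine (ih.sub ((h1 a).1.mul (h1 a).2)).congr ?_
      filter_upwards [Lp.coeFn_sub (F - ∑ i ∈ s, mulL1 (φ i) (ψ i)) (mulL1 (φ a) (ψ a)),
        mulL1_ae (φ a) (ψ a)] with x e1 e2
      rw [e1, Pi.sub_apply, e2]
  exact hardySign_one_iff.1 (key Finset.univ)

/-- Approximation by finite sums of products is iterated with remainders halved at each stage. Stage
`n` costs `(C + 1)ρ2⁻ⁿ`, and the geometric series sums to `2(C + 1)ρ`. -/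
lemma HankelEstimate.weakFactorization (h : HankelEstimate d) : WeakFactorization d := by
  obtain ⟨C, hC⟩ := h
  refine ⟨2 * (C + 1), fun f hf => ?_⟩
  set F : L1d d := hf.1.toL1 f with hFdef
  have hFae : ∀ᵐ x, F x = f x := hf.1.coeFn_toL1
  have hF : HardyOne F :=
    hardySign_one_iff.1 ((hardySign_one_iff.2 hf).congr (hFae.mono fun x hx => hx.symm))
  set ρ := ‖F‖ with hρ
  have hL1 : eLpNorm f 1 volume = ENNReal.ofReal ρ := by
    rw [eLpNorm_one_eq hf.1, hρ, hFdef, L1.norm_of_fun_eq_integral_norm]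
  rcases eq_or_lt_of_le (norm_nonneg F) with h0 | h0
  · have hF0 : F = 0 := norm_eq_zero.1 h0.symm
    refine le_trans (tensorNorm_le_of_countable (ι := Empty) (φ := Empty.elim) (ψ := Empty.elim)
      (fun i => i.elim) ?_) (by simp)
    filter_upwards [hFae, Lp.coeFn_zero ℂ 1 (volume : Measure (Rd d))] with x e1 e2
    rw [← e1, hF0, e2]
    exact hasSum_empty
  -- successive approximation
  let P : ℕ → L1d d → Prop := fun n G => HardyOne G ∧ ‖G‖ ≤ ρ * (1 / 2) ^ n
  have step : ∀ n (G : {G : L1d d // P n G}), ∃ K ∈ finiteProducts d ((C + 1) * (ρ * (1 / 2) ^ n)),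
      P (n + 1) (G - K) := by
    rintro n ⟨G, hG1, hG2⟩
    have hp : 0 < ρ * (1 / 2) ^ n := by positivity
    -- `C + 1` in place of `C` keeps the radius positive when `C = 0`.
    have hmem := mem_closure_finiteProducts hC hG1 (R := (C + 1) * (ρ * (1 / 2) ^ n))
      (by positivity) (by nlinarith [C.2, norm_nonneg G])
    obtain ⟨K, hK1, hK2⟩ := Metric.mem_closure_iff.1 hmem (ρ * (1 / 2) ^ (n + 1)) (by positivity)
    exact ⟨K, hK1, hardyOne_finiteProducts hG1 hK1, by rw [← dist_eq_norm]; exact hK2.le⟩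
  choose K hK1 hK2 using step
  let G : (n : ℕ) → {G : L1d d // P n G} := fun n =>
    Nat.rec ⟨F, hF, by simp [hρ]⟩ (fun n G => ⟨G - K n G, hK2 n G⟩) n
  have hGsucc : ∀ n, (G (n + 1)).1 = (G n).1 - K n (G n) := fun n => rfl
  have hrange : ∀ n, ∑ k ∈ Finset.range n, K k (G k) = F - (G n).1 := by
    intro n
    induction n with
    | zero => simp [G]
    | succ n ih => rw [Finset.sum_range_succ, ih, hGsucc]; abel
  have hG0 : Filter.Tendsto (fun n => (G n).1) Filter.atTop (nhds 0) := by
    refine squeeze_zero_norm (fun n => (G n).2.2) ?_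
    simpa using (tendsto_pow_atTop_nhds_zero_of_lt_one (r := (1 / 2 : ℝ)) (by norm_num)
      (by norm_num)).const_mul ρ
  have hfin := fun n => hK1 n (G n)
  choose ι fι φ ψ h1 h2 h3 using hfin
  let φ' : (Σ n, ι n) → L2 d := fun p => φ p.1 p.2
  let ψ' : (Σ n, ι n) → L2 d := fun p => ψ p.1 p.2
  have hgeom : HasSum (fun n : ℕ => (C + 1) * (ρ * (1 / 2) ^ n)) (2 * (C + 1) * ρ) := by
    rw [show 2 * ((C : ℝ) + 1) * ρ = (C + 1) * (ρ * 2) by ring]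
    exact (hasSum_geometric_two.mul_left ρ).mul_left ((C : ℝ) + 1)
  have hsumm : Summable fun p : Σ n, ι n => ‖φ' p‖ * ‖ψ' p‖ := by
    rw [summable_sigma_of_nonneg (fun p => by positivity)]
    refine ⟨fun n => (hasSum_fintype _).summable, ?_⟩
    refine Summable.of_nonneg_of_le (fun n => tsum_nonneg fun i => by positivity) (fun n => ?_)
      hgeom.summable
    rw [tsum_fintype]
    exact h3 n
  have htsum : ∑' p : Σ n, ι n, ‖φ' p‖ * ‖ψ' p‖ ≤ 2 * (C + 1) * ρ := by
    rw [hsumm.tsum_sigma, ← hgeom.tsum_eq]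
    refine hsumm.sigma.tsum_le_tsum (fun n => ?_) hgeom.summable
    rw [tsum_fintype]
    exact h3 n
  have htot : ∑' p : Σ n, ι n, ‖φ' p‖ₑ * ‖ψ' p‖ₑ ≤ ENNReal.ofReal (2 * (C + 1) * ρ) := by
    simp only [enorm_mul_eq]
    rw [← ENNReal.ofReal_tsum_of_nonneg (fun p => by positivity) hsumm]
    exact ENNReal.ofReal_le_ofReal htsum
  have hne : ∑' p : Σ n, ι n, ‖mulL1 (φ' p) (ψ' p)‖ₑ ≠ ∞ := by
    refine ((ENNReal.tsum_le_tsum fun p => ?_).trans_lt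
      (htot.trans_lt ENNReal.ofReal_lt_top)).ne
    rw [enorm_mul_eq, ← ofReal_norm]
    exact ENNReal.ofReal_le_ofReal (norm_mulL1_le _ _)
  have hS : Summable fun p : Σ n, ι n => mulL1 (φ' p) (ψ' p) := Summable.of_enorm hne
  -- Grouped by stages, the partial sums telescope to `F` minus the remainder.
  have hval : ∑' p : Σ n, ι n, mulL1 (φ' p) (ψ' p) = F := by
    have h4 : HasSum (fun n => K n (G n)) (∑' p : Σ n, ι n, mulL1 (φ' p) (ψ' p)) := by
      refine hS.hasSum.sigma fun n => ?_
      rw [h2 n]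
      exact hasSum_fintype _
    have h5 : Filter.Tendsto (fun n => ∑ k ∈ Finset.range n, K k (G k)) Filter.atTop (nhds F) := by
      simp only [hrange]
      simpa using tendsto_const_nhds.sub hG0
    exact tendsto_nhds_unique h4.tendsto_sum_nat h5
  -- Summability of the `L¹` norms upgrades convergence in `L¹` to convergence almost everywhere,
  -- which `tensorNorm` requires.
  have hae := Lp.hasSum_coeFn_tsum hne
  rw [hval] at hae
  refine (tensorNorm_le_of_countable (φ := φ') (ψ := ψ') (fun p => h1 p.1 p.2) ?_).trans
    (htot.trans ?_)
  · have hall : ∀ᵐ x, ∀ p : Σ n, ι n, mulL1 (φ' p) (ψ' p) x = φ' p x * ψ' p x :=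
      ae_all_iff.2 fun p => mulL1_ae _ _
    filter_upwards [hae, hFae, hall] with x e1 e2 e3
    rw [← e2]
    simpa only [e3] using e1
  · rw [hL1, ENNReal.ofReal_mul (by positivity)]
    gcongr
    rw [← ENNReal.ofReal_coe_nnreal]
    exact ENNReal.ofReal_le_ofReal (by push_cast; exact le_rfl)

lemma eLpNorm_le_tensorNorm (f : Rd d → ℂ) : eLpNorm f 1 volume ≤ tensorNorm f := by
  unfold tensorNorm
  refine le_iInf fun φ => le_iInf fun ψ => le_iInf fun _ => le_iInf fun hf => ?_
  rw [eLpNorm_one_eq_lintegral_enorm]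
  calc ∫⁻ x, ‖f x‖ₑ ≤ ∫⁻ x, ∑' j, ‖φ j x * ψ j x‖ₑ := by
        refine lintegral_mono_ae ?_
        filter_upwards [hf] with x hx
        rw [← hx.tsum_eq]
        exact enorm_tsum_le_tsum_enorm
    _ = ∑' j, ∫⁻ x, ‖φ j x * ψ j x‖ₑ :=
        lintegral_tsum fun j => (integrable_mul_L2 (φ j) (ψ j)).1.enorm
    _ ≤ _ := by
        refine ENNReal.tsum_le_tsum fun j => ?_
        rw [← ofReal_integral_norm_eq_lintegral_enorm (integrable_mul_L2 (φ j) (ψ j)), enorm_mul_eq]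
        exact ENNReal.ofReal_le_ofReal (integral_norm_mul_le _ _)

theorem equivalent_tensor_iff : Equivalent (fun f : Rd d → ℂ => HardyOne f)
    (fun f => eLpNorm f 1 volume) tensorNorm ↔ WeakFactorization d := by
  constructor
  · rintro ⟨C, hC⟩
    exact ⟨C, fun f hf => (hC f hf).2⟩
  · rintro ⟨C, hC⟩
    refine ⟨C + 1, fun f hf => ⟨?_, (hC f hf).trans (mul_le_mul_left (by exact_mod_cast le_self_add) _)⟩⟩
    refine (eLpNorm_le_tensorNorm f).trans ?_
    calc tensorNorm f = 1 * tensorNorm f := (one_mul _).symm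
      _ ≤ _ := mul_le_mul_left (by exact_mod_cast le_add_self) _

end Polydisk

end

/-! ### The equivalence of the five statements -/

theorem theoremt (d : ℕ) (hd : 1 ≤ d) :
    List.TFAE [
      -- Nehari: `‖H_b‖ ≃ ‖P_⊕ b‖_BMO`
      Polydisk.Equivalent (fun b : Polydisk.Rd d → ℂ => Polydisk.IsSymbol b)
        (fun b => (Polydisk.hankel b).opNorm) Polydisk.bmoNormProjPlus,
      -- commutators: `‖C_b‖ ≃ ‖b‖_BMO`, for all symbols
      Polydisk.Equivalent (fun b : Polydisk.Rd d → ℂ => Polydisk.IsSymbol b)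
        (fun b => (Polydisk.commutator b).opNorm) Polydisk.bmoNorm,
      -- commutators with real valued symbols
      Polydisk.Equivalent
        (fun b : Polydisk.Rd d → ℂ => Polydisk.IsSymbol b ∧ ∀ x, (b x).im = 0)
        (fun b => (Polydisk.commutator b).opNorm) Polydisk.bmoNorm,
      -- commutators with analytic symbols, and analytic BMO
      Polydisk.Equivalent (fun b : Polydisk.Rd d → ℂ => Polydisk.IsAnalyticSymbol b)
        (fun b => (Polydisk.commutator b).opNorm) Polydisk.analyticBmoNorm,
      -- weak factorization: `‖f‖_{H¹} ≃ ‖f‖_{H² ⊗̂ H²}`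
      Polydisk.Equivalent (fun f : Polydisk.Rd d → ℂ => Polydisk.HardyOne f)
        (fun f => eLpNorm f 1 volume) Polydisk.tensorNorm] := by
  have h2 := Polydisk.equivalent_commutator_iff (d := d) fun _ => True
  simp only [and_true] at h2
  rw [Polydisk.equivalent_hankel_iff, h2, Polydisk.equivalent_commutator_iff,
    Polydisk.equivalent_analytic_iff, Polydisk.equivalent_tensor_iff]
  tfae_have 1 → 2 := Polydisk.HankelEstimate.commutatorEstimate
  tfae_have 2 → 3 := fun h => h.mono fun _ _ => trivial
  tfae_have 3 → 1 := Polydisk.CommutatorEstimate.hankelEstimate_of_real hd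
  tfae_have 2 → 4 := Polydisk.CommutatorEstimate.analyticEstimate
  tfae_have 4 → 1 := Polydisk.AnalyticEstimate.hankelEstimate
  tfae_have 1 → 5 := Polydisk.HankelEstimate.weakFactorization
  tfae_have 5 → 1 := Polydisk.WeakFactorization.hankelEstimate
  tfae_finish
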